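/- A subset $S\subset\mathbb{R}^2$ is $\eta$-Gromov if it is $\eta$-separated (distinct points are at distance $\ge\eta$) and not properly contained in any $\eta$-separated subset of $\mathbb{R}^2$. A Delaunay triangulation of $S$ is a simplicial complex with vertex set $S$ whose polyhedron is the convex hull of $S$, such that no point of $S$ lies in the interior of the circumdisk of any of its triangles. An $\eta$-CDG is a subcomplex of a Delaunay triangulation of some $\eta$-Gromov subset of $\mathbb{R}^2$. A segment between distinct points of $S$ is in the Delaunay graph of $S$ if it is an edge of every Delaunay triangulation of $S$. A segment $ab$ with $a,b\in S$ is $\xi$-stable with respect to $S$ if, for every embedding $\iota:S\to\mathbb{R}^2$ with $|\iota(s)-s|<\xi$ for all $s\in S$, the segment $\iota(a)\iota(b)$ is in the Delaunay graph of $\iota(S)$. **Theorem.** Let $\eta>0$ and let $\mathcal{T}$ be an $\eta$-CDG. There is a subdivision $\tilde{\mathcal{T}}$ of $\mathcal{T}$ that is an $\frac{\eta}{10}$-CDG, say a subcomplex of a Delaunay triangulation of the $\frac{\eta}{10}$-Gromov set $\tilde S$, such that each edge $\tilde e$ of $\tilde{\mathcal{T}}$ that is contained in an edge $e$ of $\mathcal{T}$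 satisfies: 1. if $\tilde e$ does not contain a vertex of $e$, then $\tilde e$ has length less than $\left(\sqrt2-\frac1{10}\right)\frac{\eta}{10}$ and is $\left(\frac1{100}\cdot\frac{\eta}{10}\right)$-stable with respect to $\tilde S$; 2. if $\tilde e$ contains a vertex of $e$, then $\operatorname{length}(\tilde e)=\frac1{10}\operatorname{length}(e)$. Moreover, each triangle $\tilde\Delta$ of $\tilde{\mathcal{T}}$ that has a vertex of $\mathcal{T}$ as one of its vertices is similar to the triangle $\Delta$ of $\mathcal{T}$ with $\tilde\Delta\subset\Delta$. -/

import Mathlib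

noncomputable section

/-- The Euclidean plane. -/
abbrev Plane : Type := EuclideanSpace ℝ (Fin 2)

/-- Simplicial complexes (possibly infinite) in the plane. -/
abbrev PlaneComplex : Type := Geometry.SimplicialComplex ℝ Plane

/-- `Y` is `η`-separated: distinct points of `Y` are at distance at least `η`. -/
def EtaSeparated {X : Type*} [MetricSpace X] (η : ℝ) (Y : Set X) : Prop :=
  ∀ a ∈ Y, ∀ b ∈ Y, a ≠ b → η ≤ dist a b

/-- `Y` is `η`-Gromov: it is `η`-separated and not properly contained in any `η`-separated set. -/
def IsGromov {X : Type*} [MetricSpace X] (η : ℝ) (Y : Set X) : Prop :=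
  Maximal (EtaSeparated η) Y

/-- `K` triangulates the point set `P`: its vertex set is exactly `P`, and its polyhedron is the
convex hull of `P`. -/
def IsTriangulationOf (K : PlaneComplex) (P : Set Plane) : Prop :=
  K.vertices = P ∧ K.space = convexHull ℝ P

/-- `t` is a triangle (a `2`-simplex) of `K`. -/
def IsTriangle (K : PlaneComplex) (t : Finset Plane) : Prop :=
  t ∈ K.faces ∧ t.card = 3

/-- The segment between `a` and `b` is an edge (a `1`-simplex) of `K`. -/
def IsEdge (K : PlaneComplex) (a b : Plane) : Prop :=
  a ≠ b ∧ ∃ s ∈ K.faces, (s : Set Plane) = {a, b}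

/-- `K` is a Delaunay triangulation of `P`: it triangulates `P`, and the open circumdisk of each
triangle of `K` contains no point of `P`. The circumdisk of a triangle is the unique disk whose
boundary circle passes through its three vertices. -/
def IsDelaunayTriangulation (K : PlaneComplex) (P : Set Plane) : Prop :=
  IsTriangulationOf K P ∧
    ∀ t : Finset Plane, IsTriangle K t →
      ∀ (c : Plane) (r : ℝ), (∀ p ∈ t, dist p c = r) → ∀ x ∈ P, x ∉ Metric.ball c r

/-- `T` is a subcomplex of a Delaunay triangulation of the `η`-Gromov set `S`. -/
def IsCDGOf (η : ℝ) (S : Set Plane) (T : PlaneComplex) : Prop :=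
  IsGromov η S ∧ ∃ K : PlaneComplex, IsDelaunayTriangulation K S ∧ T.faces ⊆ K.faces

/-- `T` is an `η`-CDG (Chew-Delaunay-Gromov complex). -/
def IsCDG (η : ℝ) (T : PlaneComplex) : Prop :=
  ∃ S : Set Plane, IsCDGOf η S T

/-- The segment between the distinct points `a, b` of `S` is in the Delaunay graph of `S`: it is an
edge of every Delaunay triangulation of `S`. -/
def InDelaunayGraph (S : Set Plane) (a b : Plane) : Prop :=
  a ∈ S ∧ b ∈ S ∧ a ≠ b ∧ ∀ K : PlaneComplex, IsDelaunayTriangulation K S → IsEdge K a b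

/-- The segment between the points `a, b` of `S` is `ξ`-stable (with respect to `S`): for every
embedding `ι` of `S` in the plane that moves each point by less than `ξ`, the segment between
`ι a` and `ι b` is in the Delaunay graph of `ι(S)`. -/
def IsStable (ξ : ℝ) (S : Set Plane) (a b : Plane) : Prop :=
  ∃ (ha : a ∈ S) (hb : b ∈ S), ∀ ι : S → Plane, Topology.IsEmbedding ι →
    (∀ s : S, dist (ι s) (s : Plane) < ξ) →
      InDelaunayGraph (Set.range ι) (ι ⟨a, ha⟩) (ι ⟨b, hb⟩)

/-- `T'` is a subdivision of `T`: every simplex of `T'` is contained in a simplex of `T`, and every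
simplex of `T` is a finite union of simplices of `T'`. -/
def IsSubdivision (T' T : PlaneComplex) : Prop :=
  (∀ s ∈ T'.faces, ∃ t ∈ T.faces,
      convexHull ℝ (s : Set Plane) ⊆ convexHull ℝ (t : Set Plane)) ∧
    ∀ t ∈ T.faces, ∃ F : Set (Finset Plane), F.Finite ∧ F ⊆ T'.faces ∧
      convexHull ℝ (t : Set Plane) = ⋃ s ∈ F, convexHull ℝ (s : Set Plane)

/-- The triangles with vertex sets `s` and `t` are similar. -/
def SimilarTriangles (s t : Finset Plane) : Prop :=
  ∃ p q : Fin 3 → Plane, Set.range p = (s : Set Plane) ∧ Set.range q = (t : Set Plane) ∧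
    Similar p q

end

noncomputable section

open Set

/-! ### Barycentric weights -/

/-! Put `δ = η / 10`, let `S` be the given `10δ`-Gromov set and `K` its Delaunay triangulation.
Triangles of `K` have sides at least `10δ` and circumradius less than `10δ`, so every angle has sine
at least `1/2`.

Points are prescribed in each triangle (`baseSet`): on an edge, the ends, the points one tenth of
the length away from them, and an equal subdivision of the rest into pieces of length between `δ`
and `9δ/8`; besides, at most one "blocker" for each vertex of each triangle. These points are
`δ`-separated (`baseSet_separated`), so Zorn's lemma extends them to a `δ`-Gromov set `S'`, over
whose remaining points there is no control.

The middle pieces take care of themselves: a pair closer than `√2` times the separation has a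
strictly empty diametral disk, so it is an edge of every Delaunay triangulation, even after a small
perturbation (`isStable_of_dist_lt`). The end pieces can be longer. They are obtained by making the
whole star of an old vertex `v` reappear, shrunk by the factor `1/10`. For this the shrunken
circumdisks at `v` must be empty. A shrunken triangle has circumradius less than `δ`, so all its
points are closer than `δ` to one of its vertices. The danger is the cap of its disk beyond the side
opposite `v`. Either this cap is covered by the `δ`-disks around the ends of that side, or the
blocker, a point at distance `δ` from the shrunken circumcentre, covers the rest (`exists_blocker`).
It follows that `S'` meets a shrunken disk only in shrunken old vertices on its boundary
(`mem_star_of_mem_disk`).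

Cocircular points leave a choice of `K'`. Each Delaunay cell is triangulated by a fan from one of
its points, an old vertex whenever there is one (`pullingComplex`); the shrunken triangles at `v`
are then faces (`star_mem_pullingComplex`).

Hence every old edge is a union of new edges. No new triangle can cross such an edge, so each lies
in an old triangle (`IsRefinement.exists_triangle_superset`), and the faces of `K'` inside simplices
of `T` form the subdivision. -/

theorem plane_dist_sq (a b : Plane) :
    dist a b ^ 2 = (a 0 - b 0) ^ 2 + (a 1 - b 1) ^ 2 := by
  rw [dist_eq_norm, EuclideanSpace.real_norm_sq_eq]
  simp [Fin.sum_univ_two]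

/-- The parallel axis identity for a weighted mean `x`. -/
theorem sum_mul_dist_sq {s : Finset Plane} {w : Plane → ℝ} {x : Plane}
    (h1 : ∑ y ∈ s, w y = 1) (hx : ∑ y ∈ s, w y • y = x) (c : Plane) :
    ∑ y ∈ s, w y * dist y c ^ 2 = dist x c ^ 2 + ∑ y ∈ s, w y * dist y x ^ 2 := by
  have h0 : ∑ y ∈ s, w y * y 0 = x 0 := by rw [← hx]; simp
  have h0' : ∑ y ∈ s, w y * y 1 = x 1 := by rw [← hx]; simp
  have key : ∀ y : Plane, w y * dist y c ^ 2 = w y * dist y x ^ 2 + w y * dist x c ^ 2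
      + (2 * (x 0 - c 0)) * (w y * y 0) - (2 * (x 0 - c 0) * x 0) * w y
      + (2 * (x 1 - c 1)) * (w y * y 1) - (2 * (x 1 - c 1) * x 1) * w y := by
    intro y
    simp only [plane_dist_sq]
    ring
  rw [Finset.sum_congr rfl fun y _ => key y]
  simp only [Finset.sum_add_distrib, Finset.sum_sub_distrib, ← Finset.mul_sum, ← Finset.sum_mul,
    h0, h0', h1]
  ring

/-- Two simplices inscribed in mutually empty disks, both containing a point `x`: the vertices
that carry `x` in one of them lie on the circle of the other. -/
theorem dist_sq_eq_of_mem_both {s s' : Finset Plane} {w w' : Plane → ℝ} {x c c' : Plane}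
    {ρ ρ' : ℝ} (hw : ∀ y ∈ s, 0 ≤ w y) (h1 : ∑ y ∈ s, w y = 1) (hx : ∑ y ∈ s, w y • y = x)
    (hw' : ∀ y ∈ s', 0 ≤ w' y) (h1' : ∑ y ∈ s', w' y = 1) (hx' : ∑ y ∈ s', w' y • y = x)
    (hs : ∀ y ∈ s, dist y c ^ 2 = ρ) (hs' : ∀ y ∈ s', dist y c' ^ 2 = ρ')
    (he : ∀ y ∈ s, ρ' ≤ dist y c' ^ 2) (he' : ∀ y ∈ s', ρ ≤ dist y c ^ 2)
    {y : Plane} (hy : y ∈ s) (hy0 : w y ≠ 0) : dist y c' ^ 2 = ρ' := by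
  have e1 := sum_mul_dist_sq h1 hx c
  have e2 := sum_mul_dist_sq h1 hx c'
  have e3 := sum_mul_dist_sq h1' hx' c
  have e4 := sum_mul_dist_sq h1' hx' c'
  have a1 : ∑ y ∈ s, w y * dist y c ^ 2 = ρ := by
    rw [Finset.sum_congr rfl fun y hy => by rw [hs y hy], ← Finset.sum_mul, h1, one_mul]
  have a4 : ∑ y ∈ s', w' y * dist y c' ^ 2 = ρ' := by
    rw [Finset.sum_congr rfl fun y hy => by rw [hs' y hy], ← Finset.sum_mul, h1', one_mul]
  have a3 : ρ ≤ ∑ y ∈ s', w' y * dist y c ^ 2 := by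
    calc ρ = ∑ y ∈ s', w' y * ρ := by rw [← Finset.sum_mul, h1', one_mul]
      _ ≤ _ := Finset.sum_le_sum fun y hy => mul_le_mul_of_nonneg_left (he' y hy) (hw' y hy)
  have a2 : ∑ y ∈ s, w y * (dist y c' ^ 2 - ρ') = ∑ y ∈ s, w y * dist y c' ^ 2 - ρ' := by
    simp only [mul_sub, Finset.sum_sub_distrib, ← Finset.sum_mul, h1, one_mul]
  have nn : ∀ y ∈ s, 0 ≤ w y * (dist y c' ^ 2 - ρ') := fun y hy =>
    mul_nonneg (hw y hy) (sub_nonneg.2 (he y hy))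
  -- The difference of the squared distances to `c'` and to `c` is an affine function, so its
  -- `w`-mean and its `w'`-mean both equal its value at `x`. This forces the `w`-mean of `dist y c'
  -- ^ 2` to be at most `ρ'`, while no term is below `ρ'`.
  have z : ∑ y ∈ s, w y * (dist y c' ^ 2 - ρ') = 0 :=
    le_antisymm (by linarith) (Finset.sum_nonneg nn)
  have := (Finset.sum_eq_zero_iff_of_nonneg nn).1 z y hy
  rcases mul_eq_zero.1 this with h | h
  · exact absurd h hy0
  · linarith

theorem weights_unique {s : Finset Plane} (hs : AffineIndependent ℝ ((↑) : s → Plane))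
    {w w' : Plane → ℝ} (h1 : ∑ y ∈ s, w y = 1) (h1' : ∑ y ∈ s, w' y = 1)
    (hx : ∑ y ∈ s, w y • y = ∑ y ∈ s, w' y • y) : ∀ y ∈ s, w y = w' y := by
  intro y hy
  have := affineIndependent_iff.1 hs Finset.univ (fun e => w e - w' e) ?_ ?_ ⟨y, hy⟩
    (Finset.mem_univ _)
  · exact sub_eq_zero.1 this
  · rw [Finset.univ_eq_attach, Finset.sum_attach s (fun e => w e - w' e), Finset.sum_sub_distrib,
      h1, h1', sub_self]
  · rw [Finset.univ_eq_attach, Finset.sum_attach s (fun e => (w e - w' e) • e)]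
    simp only [sub_smul, Finset.sum_sub_distrib, hx, sub_self]

/-- Weights on a subset, extended by zero. -/
theorem exists_weights_of_subset {s u : Finset Plane} (hus : u ⊆ s) {x : Plane}
    (hx : x ∈ convexHull ℝ (u : Set Plane)) :
    ∃ w : Plane → ℝ, (∀ y ∈ s, 0 ≤ w y) ∧ ∑ y ∈ s, w y = 1 ∧ ∑ y ∈ s, w y • y = x ∧
      ∀ y, y ∉ u → w y = 0 := by
  classical
  obtain ⟨w, h0, h1, h2⟩ := Finset.mem_convexHull'.1 hx
  refine ⟨fun y => if y ∈ u then w y else 0, ?_, ?_, ?_, ?_⟩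
  · intro y _
    dsimp only
    split_ifs with h
    · exact h0 y h
    · exact le_rfl
  · rw [Finset.sum_ite_mem, Finset.inter_eq_right.2 hus, h1]
  · simp only [ite_smul, zero_smul]
    rw [Finset.sum_ite_mem, Finset.inter_eq_right.2 hus, h2]
  · intro y hy
    simp [hy]

theorem mem_convexHull_of_weights {s : Finset Plane} {w : Plane → ℝ} {x : Plane}
    (hw : ∀ y ∈ s, 0 ≤ w y) (h1 : ∑ y ∈ s, w y = 1) (hx : ∑ y ∈ s, w y • y = x)
    {U : Set Plane} (hU : ∀ y ∈ s, w y ≠ 0 → y ∈ U) : x ∈ convexHull ℝ U := by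
  classical
  rw [← hx, ← Finset.sum_filter_of_ne (p := fun y => w y ≠ 0)]
  · refine (convex_convexHull ℝ U).sum_mem (fun y hy => hw y (Finset.mem_filter.1 hy).1) ?_
      fun y hy => subset_convexHull ℝ U (hU y (Finset.mem_filter.1 hy).1 (Finset.mem_filter.1 hy).2)
    rw [Finset.sum_filter_of_ne, h1]
    exact fun _ _ h => h
  · intro y _ h hy
    exact h (by rw [hy, zero_smul])

/-- The vertices of a face that carry a point of another face belong to that other face. -/
theorem carrier_subset {K : PlaneComplex} {s t : Finset Plane} (hs : s ∈ K.faces)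
    (ht : t ∈ K.faces) {w : Plane → ℝ} {x : Plane} (h1 : ∑ y ∈ s, w y = 1)
    (hw : ∀ y ∈ s, 0 ≤ w y)
    (hx : ∑ y ∈ s, w y • y = x) (hxt : x ∈ convexHull ℝ (t : Set Plane)) {y : Plane}
    (hy : y ∈ s) (hy0 : w y ≠ 0) : y ∈ t := by
  classical
  have hxs : x ∈ convexHull ℝ (s : Set Plane) := mem_convexHull_of_weights hw h1 hx fun y hy _ => hy
  have := K.inter_subset_convexHull hs ht ⟨hxs, hxt⟩
  rw [← Finset.coe_inter] at this
  obtain ⟨w', _, h1', hx', h0'⟩ := exists_weights_of_subset (s := s) Finset.inter_subset_left this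
  by_contra hyt
  have := weights_unique (K.indep hs) h1 h1' (hx.trans hx'.symm) y hy
  rw [h0' y fun h => hyt (Finset.mem_inter.1 h).2] at this
  exact hy0 this

/-- This makes all simplices cut out of Delaunay cells nondegenerate: for them only the number of
vertices has to be checked. -/
theorem affineIndependent_finset_of_cospherical {t : Finset Plane} (ht : t.card ≤ 3) {c : Plane}
    {ρ : ℝ} (hc : ∀ y ∈ t, dist y c ^ 2 = ρ) : AffineIndependent ℝ ((↑) : t → Plane) := by
  classical
  have hsph : EuclideanGeometry.Cospherical (t : Set Plane) := by
    refine ⟨c, √ρ, fun p hp => ?_⟩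
    rw [← hc p hp, Real.sqrt_sq dist_nonneg]
  interval_cases h : t.card
  · rw [Finset.card_eq_zero] at h
    subst h
    exact affineIndependent_of_subsingleton ℝ _
  · obtain ⟨a, rfl⟩ := Finset.card_eq_one.1 h
    have : Subsingleton (({a} : Finset Plane) : Type _) := by
      rw [← Finset.card_le_one_iff_subsingleton_coe]; simp
    exact affineIndependent_of_subsingleton ℝ _
  · obtain ⟨a, b, hab, rfl⟩ := Finset.card_eq_two.1 h
    have h2 := affineIndependent_of_ne ℝ hab
    have := h2.range
    rw [show Set.range ![a, b] = (({a, b} : Finset Plane) : Set Plane) by simp [Set.pair_comm]] at this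
    exact this
  · obtain ⟨a, b, d, hab, had, hbd, rfl⟩ := Finset.card_eq_three.1 h
    have h2 := hsph.affineIndependent_of_mem_of_ne (p₁ := a) (p₂ := b) (p₃ := d)
      (by simp) (by simp) (by simp) hab had hbd
    have := h2.range
    rw [show Set.range ![a, b, d] = (({a, b, d} : Finset Plane) : Set Plane) by
      simp [Matrix.range_cons]; grind] at this
    exact this

theorem face_card_le {K : PlaneComplex} {s : Finset Plane} (hs : s ∈ K.faces) : s.card ≤ 3 := by
  have := (K.indep hs).card_le_finrank_succ
  have h2 := Submodule.finrank_le (vectorSpan ℝ (Set.range ((↑) : s → Plane)))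
  rw [finrank_euclideanSpace_fin] at h2
  rw [Fintype.card_coe] at this
  omega

/-! ### Nets -/

/-- `P` is `ε`-separated and every point of the plane is at distance less than `R` from `P`. -/
def IsNet (ε R : ℝ) (P : Set Plane) : Prop :=
  0 < ε ∧ EtaSeparated ε P ∧ ∀ x, ∃ p ∈ P, dist x p < R

/-- A point at distance at least `η` from `S` could be added to `S`. The strict covering radius is
what later makes circumradii strictly smaller than `η`. -/
theorem IsGromov.isNet {η : ℝ} (hη : 0 < η) {S : Set Plane} (hS : IsGromov η S) :
    IsNet η η S := by
  refine ⟨hη, hS.prop, fun x => ?_⟩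
  by_contra! h
  have hins : EtaSeparated η (insert x S) := by
    rintro a (rfl | ha) b (rfl | hb) hab
    · exact absurd rfl hab
    · exact h b hb
    · rw [dist_comm]; exact h a ha
    · exact hS.prop a ha b hb hab
  have := hS.le_of_ge hins (Set.subset_insert x S) (Set.mem_insert x S)
  have := h x this
  rw [dist_self] at this
  linarith

theorem exists_isGromov_superset {η : ℝ} {B : Set Plane} (hB : EtaSeparated η B) :
    ∃ S, B ⊆ S ∧ IsGromov η S := by
  refine zorn_subset_nonempty {S : Set Plane | EtaSeparated η S} ?_ B hB
  intro c hc hchain hne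
  refine ⟨⋃₀ c, ?_, fun s hs => Set.subset_sUnion_of_mem hs⟩
  rintro a ⟨s, hs, has⟩ b ⟨t, ht, hbt⟩ hab
  rcases hchain.total hs ht with h | h
  · exact hc ht a (h has) b hbt hab
  · exact hc hs a has b (h hbt) hab

theorem EtaSeparated.finite_inter_closedBall {ε : ℝ} (hε : 0 < ε) {P : Set Plane}
    (hP : EtaSeparated ε P) (x : Plane) (r : ℝ) : (P ∩ Metric.closedBall x r).Finite := by
  by_contra hinf
  have hcpt := isCompact_closedBall x r
  obtain ⟨t, htf, hcov⟩ := (Metric.totallyBounded_iff.1 hcpt.totallyBounded) (ε / 2) (half_pos hε)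
  obtain ⟨hft⟩ : Nonempty (Fintype t) := ⟨htf.fintype⟩
  have hch : ∀ y : Plane, y ∈ P ∩ Metric.closedBall x r → ∃ z ∈ t, dist y z < ε / 2 := by
    intro y hy
    obtain ⟨z, hz, hyz⟩ := Set.mem_iUnion₂.1 (hcov hy.2)
    exact ⟨z, hz, hyz⟩
  choose! f hf hd using hch
  apply hinf
  refine Set.Finite.of_finite_image (f := f) (htf.subset ?_) ?_
  · rintro _ ⟨y, hy, rfl⟩
    exact hf y hy
  · intro a ha b hb hab
    by_contra hne
    have := hP a ha.1 b hb.1 hne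
    have h1 := hd a ha
    have h2 := hd b hb
    rw [← hab] at h2
    have := dist_triangle_right a b (f a)
    linarith

theorem EtaSeparated.countable {ε : ℝ} (hε : 0 < ε) {P : Set Plane}
    (hP : EtaSeparated ε P) : P.Countable := by
  have : P = ⋃ n : ℕ, P ∩ Metric.closedBall 0 n := by
    rw [← Set.inter_iUnion, Metric.iUnion_closedBall_nat, Set.inter_univ]
  rw [this]
  exact Set.countable_iUnion fun n => (hP.finite_inter_closedBall hε 0 n).countable

end

noncomputable section

open Set

/-! ### Delaunay cells cover the plane -/

theorem IsNet.exists_nearest {ε R : ℝ} {P : Set Plane} (hP : IsNet ε R P) (c : Plane) :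
    ∃ p ∈ P, dist p c < R ∧ ∀ q ∈ P, dist p c ≤ dist q c := by
  obtain ⟨p₀, hp₀, hd⟩ := hP.2.2 c
  obtain ⟨p, hp, hmin⟩ := (hP.2.1.finite_inter_closedBall hP.1 c R).exists_minimalFor
    (fun q => dist q c) _ ⟨p₀, hp₀, by rw [Metric.mem_closedBall, dist_comm]; exact hd.le⟩
  have hle : ∀ q ∈ P ∩ Metric.closedBall c R, dist p c ≤ dist q c := fun q hq => by
    by_contra! h
    exact absurd (hmin hq h.le) (not_le.2 h)
  have hpR : dist p c < R := by
    refine (hle p₀ ⟨hp₀, ?_⟩).trans_lt (by rwa [dist_comm])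
    rw [Metric.mem_closedBall, dist_comm]; exact hd.le
  refine ⟨p, hp.1, hpR, fun q hq => ?_⟩
  by_cases h : dist q c ≤ R
  · exact hle q ⟨hq, h⟩
  · linarith

/-- The points of `P` on the circle with centre `c` and squared radius `ρ`. -/
def cell (P : Set Plane) (c : Plane) (ρ : ℝ) : Set Plane := {p ∈ P | dist p c ^ 2 = ρ}

theorem cell_finite {ε R : ℝ} {P : Set Plane} (hP : IsNet ε R P) (c : Plane) (ρ : ℝ) :
    (cell P c ρ).Finite := by
  refine (hP.2.1.finite_inter_closedBall hP.1 c √ρ).subset ?_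
  rintro p ⟨hp, h⟩
  refine ⟨hp, ?_⟩
  rw [Metric.mem_closedBall, ← h, Real.sqrt_sq dist_nonneg]

theorem dist_sq_sub_move (s x c v : Plane) (e : ℝ) :
    dist s (c - e • v) ^ 2 - dist x (c - e • v) ^ 2 =
      dist s c ^ 2 - dist x c ^ 2 + 2 * e * (inner ℝ v s - inner ℝ v x) := by
  simp only [plane_dist_sq, PiLp.inner_apply, Fin.sum_univ_two]
  simp
  ring

/-- Every point of the plane lies in the convex hull of a Delaunay cell of a net. -/
theorem IsNet.exists_cell {ε R : ℝ} {P : Set Plane} (hP : IsNet ε R P) (x : Plane) :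
    ∃ (c : Plane) (ρ : ℝ), (∀ p ∈ P, ρ ≤ dist p c ^ 2) ∧ x ∈ convexHull ℝ (cell P c ρ) := by
  have hne : P.Nonempty := let ⟨p, hp, _⟩ := hP.2.2 x; ⟨p, hp⟩
  have hinf : ∀ c p, p ∈ P → (∀ q ∈ P, dist p c ≤ dist q c) → Metric.infDist c P = dist p c := by
    intro c p hp h
    refine le_antisymm ?_ ?_
    · rw [dist_comm]; exact Metric.infDist_le_dist_of_mem hp
    · rw [Metric.le_infDist hne]
      intro q hq
      rw [dist_comm c q]
      exact h q hq
  -- The cell is found by duality: a centre `c` maximizing this function is the centre of an empty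
  -- disk whose cell contains `x` in its hull.
  set F : Plane → ℝ := fun c => Metric.infDist c P ^ 2 - dist x c ^ 2 with hF
  have hFc : Continuous F := by
    have := Metric.continuous_infDist_pt P
    fun_prop
  have hR : 0 ≤ R := let ⟨p, _, h⟩ := hP.2.2 x; dist_nonneg.trans h.le
  obtain ⟨c, -, hmax⟩ := (isCompact_closedBall x R).exists_isMaxOn
    ⟨x, Metric.mem_closedBall_self hR⟩ hFc.continuousOn
  have hglob : ∀ c', F c' ≤ F c := by
    intro c'
    by_cases h : c' ∈ Metric.closedBall x R
    · exact hmax h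
    -- `F x` is nonnegative, whereas `F` is nonpositive at centres farther than `R` from `x`; so the
    -- maximum over the ball is global.
    · have h1 : 0 ≤ F c := by
        refine le_trans ?_ (hmax (Metric.mem_closedBall_self hR))
        have := sq_nonneg (Metric.infDist x P)
        simpa [hF] using this
      refine le_trans ?_ h1
      obtain ⟨p, hp, hpR, hmin⟩ := hP.exists_nearest c'
      rw [Metric.mem_closedBall, dist_comm] at h
      have := dist_nonneg (x := p) (y := c')
      simp only [hF, hinf c' p hp hmin]
      nlinarith
  obtain ⟨p₀, hp₀, hp₀R, hmin₀⟩ := hP.exists_nearest c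
  have hFe : F c = dist p₀ c ^ 2 - dist x c ^ 2 := by simp only [hF, hinf c p₀ hp₀ hmin₀]
  have hge : ∀ p ∈ P, dist p₀ c ^ 2 ≤ dist p c ^ 2 := fun p hp =>
    pow_le_pow_left₀ dist_nonneg (hmin₀ p hp) 2
  refine ⟨c, dist p₀ c ^ 2, hge, ?_⟩
  by_contra hx
  have hfin := cell_finite hP c (dist p₀ c ^ 2)
  -- If a line separates `x` from the cell, moving the centre a little away from the cell increases
  -- `F`: the cell points gain to first order, and the finitely many other nearby points start with
  -- a strict margin.
  obtain ⟨f, u, hfx, hfC⟩ := geometric_hahn_banach_point_closed (convex_convexHull ℝ _)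
    (hfin.isCompact_convexHull ℝ).isClosed hx
  obtain ⟨v, hv⟩ : ∃ v : Plane, ∀ y, f y = inner ℝ v y :=
    ⟨(InnerProductSpace.toDual ℝ Plane).symm f, fun y => by
      rw [InnerProductSpace.toDual_symm_apply]⟩
  have hQ := (hP.2.1.finite_inter_closedBall hP.1 c (R + 1)).subset
    (Set.sdiff_subset (t := cell P c (dist p₀ c ^ 2)))
  have ev : ∀ᶠ e in nhdsWithin (0 : ℝ) (Set.Ioi 0),
      ∀ p ∈ (P ∩ Metric.closedBall c (R + 1)) \ cell P c (dist p₀ c ^ 2),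
        F c < dist p (c - e • v) ^ 2 - dist x (c - e • v) ^ 2 := by
    rw [Filter.eventually_all_finite hQ]
    intro p hp
    apply Filter.Eventually.filter_mono nhdsWithin_le_nhds
    have h0 : F c < dist p c ^ 2 - dist x c ^ 2 + 2 * 0 * (inner ℝ v p - inner ℝ v x) := by
      have : dist p₀ c ^ 2 < dist p c ^ 2 :=
        lt_of_le_of_ne (hge p hp.1.1) fun h => hp.2 ⟨hp.1.1, h.symm⟩
      rw [hFe]; linarith
    simp only [dist_sq_sub_move]
    have hcont : Continuous fun e : ℝ =>
      dist p c ^ 2 - dist x c ^ 2 + 2 * e * (inner ℝ v p - inner ℝ v x) := by fun_prop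
    exact hcont.tendsto 0 |>.eventually (lt_mem_nhds h0)
  have ev2 : ∀ᶠ e in nhdsWithin (0 : ℝ) (Set.Ioi 0), e * ‖v‖ < 1 := by
    apply Filter.Eventually.filter_mono nhdsWithin_le_nhds
    have hcont : Continuous fun e : ℝ => e * ‖v‖ := by fun_prop
    exact hcont.tendsto 0 |>.eventually (gt_mem_nhds (by simp))
  obtain ⟨e, he, he2, he0⟩ := (ev.and (ev2.and self_mem_nhdsWithin)).exists
  have he0 : 0 < e := he0
  obtain ⟨p, hp, hpR, hmin⟩ := hP.exists_nearest (c - e • v)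
  have hle := hglob (c - e • v)
  have hval : F (c - e • v) = dist p (c - e • v) ^ 2 - dist x (c - e • v) ^ 2 := by
    simp only [hF, hinf _ p hp hmin]
  by_cases hpC : p ∈ cell P c (dist p₀ c ^ 2)
  · have h1 := hfC p (subset_convexHull ℝ _ hpC)
    rw [hv] at h1 hfx
    rw [hval, dist_sq_sub_move, hpC.2, ← hFe] at hle
    have : 0 < e * (inner ℝ v p - inner ℝ v x) := mul_pos he0 (by linarith)
    linarith
  · have hb : p ∈ Metric.closedBall c (R + 1) := by
      rw [Metric.mem_closedBall]
      have h1 := dist_triangle p (c - e • v) c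
      have h2 : dist (c - e • v) c = e * ‖v‖ := by
        rw [dist_eq_norm, sub_sub_cancel_left, norm_neg, norm_smul, Real.norm_of_nonneg he0.le]
      linarith
    have := he p ⟨⟨hp, hb⟩, hpC⟩
    rw [← hval] at this
    exact absurd hle (not_le.2 this)

theorem IsNet.convexHull_eq_univ {ε R : ℝ} {P : Set Plane} (hP : IsNet ε R P) :
    convexHull ℝ P = Set.univ := by
  refine Set.eq_univ_of_forall fun x => ?_
  obtain ⟨c, ρ, -, hx⟩ := hP.exists_cell x
  exact convexHull_mono (fun p hp => hp.1) hx

end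

noncomputable section

open Set

/-! ### Pulling triangulations of Delaunay cells -/

/-- Three points of a circle are affinely independent, so they cannot all lie on a level line of
`f`. -/
theorem card_le_two_of_cospherical_line {t : Finset Plane} {c : Plane} {ρ : ℝ}
    (hc : ∀ y ∈ t, dist y c ^ 2 = ρ) {f : Plane →ₗ[ℝ] ℝ} (hf : f ≠ 0) {b : ℝ}
    (hb : ∀ y ∈ t, f y = b) : t.card ≤ 2 := by
  by_contra! h
  obtain ⟨s, hst, hs⟩ := Finset.exists_subset_card_eq (show 3 ≤ t.card from h)
  have hi := (affineIndependent_finset_of_cospherical hs.le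
    fun y hy => hc y (hst hy)).card_le_finrank_succ
  rw [Fintype.card_coe, hs] at hi
  have hle : vectorSpan ℝ (Set.range ((↑) : s → Plane)) ≤ LinearMap.ker f := by
    rw [vectorSpan_def, Submodule.span_le]
    rintro _ ⟨_, ⟨⟨x, hx⟩, rfl⟩, _, ⟨⟨y, hy⟩, rfl⟩, rfl⟩
    simp [hb x (hst hx), hb y (hst hy)]
  have h1 := Submodule.finrank_mono hle
  have h2 := LinearMap.finrank_range_add_finrank_ker f
  rw [LinearMap.range_eq_top.2 (LinearMap.surjective hf), finrank_top, finrank_euclideanSpace_fin,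
    Module.finrank_self] at h2
  omega

/-- The common points lie on the radical axis of the two circles. -/
theorem card_le_two_of_mem_two_circles {t : Finset Plane} {c c' : Plane} {ρ ρ' : ℝ}
    (hc : ∀ y ∈ t, dist y c ^ 2 = ρ) (hc' : ∀ y ∈ t, dist y c' ^ 2 = ρ') (hne : c ≠ c') :
    t.card ≤ 2 := by
  refine card_le_two_of_cospherical_line hc (f := (innerSL ℝ (c - c')).toLinearMap)
    (b := (c 0 ^ 2 + c 1 ^ 2 - (c' 0 ^ 2 + c' 1 ^ 2) - ρ + ρ') / 2) ?_ ?_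
  · intro h
    have := congrArg (fun g : Plane →ₗ[ℝ] ℝ => g (c - c')) h
    simp only [ContinuousLinearMap.coe_coe, innerSL_apply_apply, LinearMap.zero_apply,
      inner_self_eq_zero, sub_eq_zero] at this
    exact hne this
  · intro y hy
    have h1 := hc y hy
    have h2 := hc' y hy
    rw [plane_dist_sq] at h1 h2
    simp [PiLp.inner_apply, Fin.sum_univ_two]
    linarith

/-- A finite subset of the plane lies in an affinely independent set carrying two representations
of a point: then the point lies in the hull of the common vertices. -/
theorem mem_convexHull_inter {t t' Z : Finset Plane} {w w' : Plane → ℝ} {x : Plane}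
    (hw : ∀ y ∈ t, 0 ≤ w y) (h1 : ∑ y ∈ t, w y = 1) (hx : ∑ y ∈ t, w y • y = x)
    (h1' : ∑ y ∈ t', w' y = 1) (hx' : ∑ y ∈ t', w' y • y = x)
    (hZ : AffineIndependent ℝ ((↑) : Z → Plane)) (htZ : ∀ y ∈ t, w y ≠ 0 → y ∈ Z)
    (htZ' : ∀ y ∈ t', w' y ≠ 0 → y ∈ Z) : x ∈ convexHull ℝ ((t : Set Plane) ∩ t') := by
  classical
  have aux : ∀ (s : Finset Plane) (v : Plane → ℝ), (∀ y ∈ s, v y ≠ 0 → y ∈ Z) →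
      ∑ y ∈ Z, (if y ∈ s then v y else 0) = ∑ y ∈ s, v y ∧
      ∑ y ∈ Z, (if y ∈ s then v y else 0) • y = ∑ y ∈ s, v y • y := by
    intro s v hs
    simp only [ite_smul, zero_smul]
    rw [Finset.sum_ite_mem, Finset.sum_ite_mem]
    constructor <;> refine Finset.sum_subset Finset.inter_subset_right fun y hy hyn => ?_
    · by_contra h
      exact hyn (Finset.mem_inter.2 ⟨hs y hy h, hy⟩)
    · by_cases h : v y = 0
      · rw [h, zero_smul]
      · exact absurd (Finset.mem_inter.2 ⟨hs y hy h, hy⟩) hyn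
  obtain ⟨a1, a2⟩ := aux t w htZ
  obtain ⟨b1, b2⟩ := aux t' w' htZ'
  have hu := weights_unique hZ (a1.trans h1) (b1.trans h1') (by rw [a2, b2, hx, hx'])
  refine mem_convexHull_of_weights hw h1 hx fun y hy hy0 => ⟨hy, ?_⟩
  by_contra hyt
  have := hu y (htZ y hy hy0)
  rw [if_pos hy, if_neg (by exact_mod_cast hyt)] at this
  exact hy0 this

/-- The simplices `t` in an empty Delaunay cell `C` that are spanned by the chosen vertex `m C`
and vertices on a supporting line of `C` missing `m C`. -/
def PullingFace (P : Set Plane) (m : Set Plane → Plane) (t : Finset Plane) : Prop :=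
  t.Nonempty ∧ ∃ (c : Plane) (ρ : ℝ), (∀ p ∈ P, ρ ≤ dist p c ^ 2) ∧ (t : Set Plane) ⊆ cell P c ρ ∧
    ∃ (f : Plane →ₗ[ℝ] ℝ) (b : ℝ), (∀ p ∈ cell P c ρ, b ≤ f p) ∧
      (∀ p ∈ t, p = m (cell P c ρ) ∨ f p = b) ∧ b < f (m (cell P c ρ))

theorem card_le_three_of_pulled {t : Finset Plane} {c : Plane} {ρ : ℝ}
    (hc : ∀ y ∈ t, dist y c ^ 2 = ρ) {f : Plane →ₗ[ℝ] ℝ} {b : ℝ} {m : Plane}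
    (hb : ∀ y ∈ t, y = m ∨ f y = b) (hm : b < f m) : t.card ≤ 3 := by
  classical
  have hsub : t ⊆ insert m (t.filter fun y => f y = b) := fun y hy => by
    rcases hb y hy with h | h
    · simp [h]
    · simp [hy, h]
  refine (Finset.card_le_card hsub).trans ((Finset.card_insert_le _ _).trans ?_)
  rcases (t.filter fun y => f y = b).eq_empty_or_nonempty with h | ⟨a, ha⟩
  · simp [h]
  · have hf : f ≠ 0 := by
      rintro rfl
      have := (Finset.mem_filter.1 ha).2
      simp at this hm
      linarith
    have := card_le_two_of_cospherical_line (t := t.filter fun y => f y = b)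
      (fun y hy => hc y (Finset.mem_filter.1 hy).1) hf fun y hy => (Finset.mem_filter.1 hy).2
    omega

/-- In a single cell, comparing the weights at the pulled vertex. -/
theorem pulled_weight_le {t t' : Finset Plane} {w w' : Plane → ℝ} {x m : Plane}
    (h1 : ∑ y ∈ t, w y = 1) (hx : ∑ y ∈ t, w y • y = x)
    (h1' : ∑ y ∈ t', w' y = 1) (hx' : ∑ y ∈ t', w' y • y = x)
    {f : Plane →ₗ[ℝ] ℝ} {b : ℝ} (ht : ∀ y ∈ t, y = m ∨ f y = b) (hm : b < f m)
    (hw' : ∀ y ∈ t', 0 ≤ w' y) (ht' : ∀ y ∈ t', b ≤ f y) [Decidable (m ∈ t)]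
    [Decidable (m ∈ t')] :
    (if m ∈ t' then w' m else 0) ≤ (if m ∈ t then w m else 0) ∧
    ((if m ∈ t' then w' m else 0) = (if m ∈ t then w m else 0) →
      ∀ y ∈ t', w' y ≠ 0 → y = m ∨ f y = b) := by
  classical
  -- Both sides are `f x - b`. On the left only the vertex `m` contributes; on the right the other
  -- vertices contribute nonnegative amounts.
  have e : ∑ y ∈ t, w y * (f y - b) = ∑ y ∈ t', w' y * (f y - b) := by
    have e1 := congrArg f (hx.trans hx'.symm)
    simp only [map_sum, map_smul, smul_eq_mul] at e1
    simp only [mul_sub, Finset.sum_sub_distrib, ← Finset.sum_mul, h1, h1', e1]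
  have e2 : ∑ y ∈ t, w y * (f y - b) = (if m ∈ t then w m else 0) * (f m - b) := by
    have : ∀ y ∈ t, w y * (f y - b) = if y = m then w m * (f m - b) else 0 := by
      intro y hy
      split_ifs with h
      · rw [h]
      · rw [(ht y hy).resolve_left h, sub_self, mul_zero]
    rw [Finset.sum_congr rfl this, Finset.sum_ite_eq' t m fun _ => w m * (f m - b)]
    split_ifs <;> simp
  have nn : ∀ y ∈ t', 0 ≤ w' y * (f y - b) := fun y hy =>
    mul_nonneg (hw' y hy) (sub_nonneg.2 (ht' y hy))
  have e3 : (if m ∈ t' then w' m else 0) * (f m - b) + ∑ y ∈ t'.erase m, w' y * (f y - b) =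
      ∑ y ∈ t', w' y * (f y - b) := by
    split_ifs with h
    · exact Finset.add_sum_erase t' (fun y => w' y * (f y - b)) h
    · rw [Finset.erase_eq_of_notMem h]; simp
  have nn' : ∀ y ∈ t'.erase m, 0 ≤ w' y * (f y - b) := fun y hy => nn y (Finset.mem_of_mem_erase hy)
  have hsum := Finset.sum_nonneg nn'
  have hpos : 0 < f m - b := sub_pos.2 hm
  refine ⟨?_, fun heq y hy hy0 => ?_⟩
  · by_contra! hlt
    have := mul_lt_mul_of_pos_right hlt hpos
    linarith
  · by_contra! hcon
    have hz : ∑ y ∈ t'.erase m, w' y * (f y - b) = 0 := by rw [heq] at e3; linarith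
    have := (Finset.sum_eq_zero_iff_of_nonneg nn').1 hz y (Finset.mem_erase.2 ⟨hcon.1, hy⟩)
    rcases mul_eq_zero.1 this with h | h
    · exact hy0 h
    · exact hcon.2 (by linarith)

/-- The vertices that carry a common point lie on both circles. Different centres leave at most two
such vertices; in a single cell the weights at the pulled vertex must agree, which puts all carriers
in one fan triangle. Either way the carriers are affinely independent, and uniqueness of weights
places the point in the common face. -/
theorem PullingFace.inter_subset {P : Set Plane} {m : Set Plane → Plane} {t t' : Finset Plane}
    (ht : PullingFace P m t) (ht' : PullingFace P m t') :
    convexHull ℝ (t : Set Plane) ∩ convexHull ℝ (t' : Set Plane) ⊆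
      convexHull ℝ ((t : Set Plane) ∩ t') := by
  classical
  rintro x ⟨hxt, hxt'⟩
  obtain ⟨-, c, ρ, hP, htC, f, b, hf, htf, hm⟩ := ht
  obtain ⟨-, c', ρ', hP', htC', f', b', hf', htf', hm'⟩ := ht'
  obtain ⟨w, hw, h1, hx⟩ := Finset.mem_convexHull'.1 hxt
  obtain ⟨w', hw', h1', hx'⟩ := Finset.mem_convexHull'.1 hxt'
  have hon : ∀ y ∈ t, w y ≠ 0 → dist y c' ^ 2 = ρ' := fun y hy hy0 =>
    dist_sq_eq_of_mem_both hw h1 hx hw' h1' hx' (fun y hy => (htC hy).2) (fun y hy => (htC' hy).2)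
      (fun y hy => hP' y (htC hy).1) (fun y hy => hP y (htC' hy).1) hy hy0
  have hon' : ∀ y ∈ t', w' y ≠ 0 → dist y c ^ 2 = ρ := fun y hy hy0 =>
    dist_sq_eq_of_mem_both hw' h1' hx' hw h1 hx (fun y hy => (htC' hy).2) (fun y hy => (htC hy).2)
      (fun y hy => hP y (htC' hy).1) (fun y hy => hP' y (htC hy).1) hy hy0
  set Z := t.filter (fun y => w y ≠ 0) ∪ t'.filter (fun y => w' y ≠ 0) with hZdef
  have htZ : ∀ y ∈ t, w y ≠ 0 → y ∈ Z := fun y hy h => by simp [hZdef, hy, h]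
  have htZ' : ∀ y ∈ t', w' y ≠ 0 → y ∈ Z := fun y hy h => by simp [hZdef, hy, h]
  have hZc : ∀ y ∈ Z, dist y c ^ 2 = ρ := by
    intro y hy
    rcases Finset.mem_union.1 hy with h | h
    · exact (htC (Finset.mem_filter.1 h).1).2
    · exact hon' y (Finset.mem_filter.1 h).1 (Finset.mem_filter.1 h).2
  have hZc' : ∀ y ∈ Z, dist y c' ^ 2 = ρ' := by
    intro y hy
    rcases Finset.mem_union.1 hy with h | h
    · exact hon y (Finset.mem_filter.1 h).1 (Finset.mem_filter.1 h).2
    · exact (htC' (Finset.mem_filter.1 h).1).2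
  suffices hcard : Z.card ≤ 3 from
    mem_convexHull_inter hw h1 hx h1' hx' (affineIndependent_finset_of_cospherical hcard hZc) htZ
      htZ'
  by_cases hcc : c = c'
  · subst hcc
    obtain ⟨y, hy, hy0⟩ : ∃ y ∈ t, w y ≠ 0 := by
      by_contra! h
      rw [Finset.sum_eq_zero h] at h1
      exact zero_ne_one h1
    have hρ : ρ = ρ' := (hZc y (htZ y hy hy0)).symm.trans (hZc' y (htZ y hy hy0))
    subst hρ
    have a := pulled_weight_le h1 hx h1' hx' htf hm hw' fun y hy => hf y (htC' hy)
    have a' := pulled_weight_le h1' hx' h1 hx htf' hm' hw fun y hy => hf' y (htC hy)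
    have hs := a.2 (le_antisymm a.1 a'.1)
    refine card_le_three_of_pulled hZc (m := m (cell P c ρ)) (f := f) (b := b) ?_ hm
    intro y hy
    rcases Finset.mem_union.1 hy with h | h
    · exact htf y (Finset.mem_filter.1 h).1
    · exact hs y (Finset.mem_filter.1 h).1 (Finset.mem_filter.1 h).2
  · exact (card_le_two_of_mem_two_circles hZc hZc' hcc).trans (by norm_num)

/-- The complex of pulling faces. -/
def pullingComplex (P : Set Plane) (m : Set Plane → Plane) : PlaneComplex where
  faces := {t | PullingFace P m t}
  isRelLowerSet_faces := by
    intro t ht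
    refine ⟨ht.1, fun s hst hs => ⟨hs, ?_⟩⟩
    obtain ⟨-, c, ρ, hP, htC, f, b, hf, htf, hm⟩ := ht
    exact ⟨c, ρ, hP, fun p hp => htC (hst hp), f, b, hf, fun p hp => htf p (hst hp), hm⟩
  indep := by
    rintro s ⟨-, c, ρ, hP, htC, f, b, hf, htf, hm⟩
    exact affineIndependent_finset_of_cospherical
      (card_le_three_of_pulled (fun y hy => (htC hy).2) htf hm) fun y hy => (htC hy).2
  inter_subset_convexHull := fun hs ht => PullingFace.inter_subset hs ht

/-- The fan from `m` covers the hull of a finite cocircular set. -/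
theorem exists_fan {C : Finset Plane} {c : Plane} {ρ : ℝ} (hC : ∀ y ∈ C, dist y c ^ 2 = ρ)
    {m x : Plane} (hm : m ∈ C) (hx : x ∈ convexHull ℝ (C : Set Plane)) :
    ∃ t : Finset Plane, t.Nonempty ∧ t ⊆ C ∧ x ∈ convexHull ℝ (t : Set Plane) ∧
      ∃ (f : Plane →ₗ[ℝ] ℝ) (b : ℝ), (∀ p ∈ C, b ≤ f p) ∧ (∀ p ∈ t, p = m ∨ f p = b) ∧ b < f m := by
  classical
  by_cases hxm : x = m
  -- With the zero functional and `b = -1` the supporting line is empty, and only `m` itself is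
  -- allowed as a vertex.
  · refine ⟨{m}, by simp, by simpa using hm, by simp [hxm], 0, -1, by simp, by simp, by simp⟩
  have tangent : ∀ q ∈ C, q ≠ m → x ∈ segment ℝ m q →
      ∃ t : Finset Plane, t.Nonempty ∧ t ⊆ C ∧ x ∈ convexHull ℝ (t : Set Plane) ∧
      ∃ (f : Plane →ₗ[ℝ] ℝ) (b : ℝ), (∀ p ∈ C, b ≤ f p) ∧ (∀ p ∈ t, p = m ∨ f p = b) ∧
        b < f m := by
    intro q hq hqm hxq
    -- The tangent to the circle at `q` supports `C` at `q` alone, so it serves for the segment from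
    -- `m` to `q`.
    have key : ∀ p ∈ C, 2 * (inner ℝ (c - q) p - inner ℝ (c - q) q) = dist p q ^ 2 := by
      intro p hp
      have h1 := hC p hp
      have h2 := hC q hq
      simp only [plane_dist_sq, PiLp.inner_apply, Fin.sum_univ_two] at *
      simp
      linarith
    refine ⟨{m, q}, by simp, ?_, ?_, (innerSL ℝ (c - q)).toLinearMap, inner ℝ (c - q) q, ?_, ?_, ?_⟩
    · intro y hy
      simp at hy
      rcases hy with rfl | rfl <;> assumption
    · rwa [Finset.coe_pair, convexHull_pair]
    · intro p hp
      have := key p hp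
      simp only [ContinuousLinearMap.coe_coe, innerSL_apply_apply]
      nlinarith [sq_nonneg (dist p q)]
    · intro p hp
      rcases Finset.mem_insert.1 hp with h | h
      · exact Or.inl h
      · right
        rw [Finset.mem_singleton.1 h, ContinuousLinearMap.coe_coe, innerSL_apply_apply]
    · have := key m hm
      have h2 : 0 < dist m q := dist_pos.2 (Ne.symm hqm)
      simp only [ContinuousLinearMap.coe_coe, innerSL_apply_apply]
      nlinarith
  by_cases hcard : C.card ≤ 2
  · have hex : ∃ q ∈ C, q ≠ m ∧ C = {m, q} := by
      have : (C.erase m).card ≤ 1 := by rw [Finset.card_erase_of_mem hm]; omega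
      rcases (C.erase m).eq_empty_or_nonempty with h | ⟨q, hq⟩
      · rw [Finset.erase_eq_empty_iff] at h
        rcases h with h | h
        · simp [h] at hm
        · rw [h] at hx; simp at hx; exact absurd hx hxm
      · refine ⟨q, Finset.mem_of_mem_erase hq, Finset.ne_of_mem_erase hq, ?_⟩
        have h2 : C.erase m = {q} := by
          refine Finset.eq_singleton_iff_unique_mem.2 ⟨hq, fun y hy => ?_⟩
          exact Finset.card_le_one.1 this y hy q hq
        rw [← Finset.insert_erase hm, h2]
    obtain ⟨q, hq, hqm, hCq⟩ := hex
    refine tangent q hq hqm ?_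
    rw [hCq, Finset.coe_pair, convexHull_pair] at hx
    exact hx
  push Not at hcard
  have hcpt := C.finite_toSet.isCompact_convexHull ℝ
  have hdist : 0 < ‖x - m‖ := norm_pos_iff.2 (sub_ne_zero.2 hxm)
  -- The ray from `m` through `x` is followed to its last point `y` in the hull; the opposite edge
  -- of the fan triangle is found on a supporting line at `y`.
  set A : Set ℝ := {s : ℝ | 1 ≤ s ∧ m + s • (x - m) ∈ convexHull ℝ (C : Set Plane)} with hA
  have hAcpt : IsCompact A := by
    refine Metric.isCompact_of_isClosed_isBounded ?_ ?_
    · refine IsClosed.inter isClosed_Ici (hcpt.isClosed.preimage (by fun_prop))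
    · obtain ⟨M, hM⟩ := hcpt.isBounded.subset_closedBall m
      refine (Metric.isBounded_closedBall (x := (0 : ℝ)) (r := M / ‖x - m‖)).subset ?_
      rintro s ⟨hs1, hs⟩
      have := hM hs
      rw [Metric.mem_closedBall, dist_eq_norm, add_sub_cancel_left, norm_smul] at this
      rw [Metric.mem_closedBall, dist_zero_right, le_div_iff₀ hdist]
      exact this
  obtain ⟨s, ⟨hs1, hsC⟩, hsmax⟩ := hAcpt.exists_isGreatest ⟨1, le_rfl, by simpa using hx⟩
  set y := m + s • (x - m) with hy
  have hs0 : 0 < s := by linarith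
  have hxy : x ∈ segment ℝ m y := by
    refine ⟨1 - s⁻¹, s⁻¹, ?_, by positivity, by ring, ?_⟩
    · have := inv_le_one_of_one_le₀ hs1; linarith
    · rw [hy, smul_add, smul_smul, inv_mul_cancel₀ hs0.ne', one_smul, sub_smul, one_smul]
      abel
  have hym : y ≠ m := by
    intro h
    rw [hy, add_eq_left, smul_eq_zero, sub_eq_zero] at h
    rcases h with h | h
    · exact hs0.ne' h
    · exact hxm h
  by_cases hyC : y ∈ C
  · exact tangent y hyC hym hxy
  have hbeyond : ∀ τ : ℝ, 1 < τ → m + τ • (y - m) ∉ convexHull ℝ (C : Set Plane) := by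
    intro τ hτ hmem
    have : τ * s ∈ A := by
      refine ⟨by nlinarith, ?_⟩
      rw [hy, add_sub_cancel_left, smul_smul] at hmem
      exact hmem
    have := hsmax this
    nlinarith
  have hyint : y ∉ interior (convexHull ℝ (C : Set Plane)) := by
    intro h
    have hcont : Continuous fun τ : ℝ => m + τ • (y - m) := by fun_prop
    have hmem : (fun τ : ℝ => m + τ • (y - m)) ⁻¹' interior (convexHull ℝ (C : Set Plane)) ∈
        nhds (1 : ℝ) := by
      refine hcont.continuousAt.preimage_mem_nhds ?_
      simpa using isOpen_interior.mem_nhds h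
    have := (Filter.Eventually.filter_mono nhdsWithin_le_nhds hmem).and
      (self_mem_nhdsWithin : Set.Ioi (1 : ℝ) ∈ nhdsWithin 1 (Set.Ioi 1))
    obtain ⟨τ, h1, h2⟩ := this.exists
    exact hbeyond τ h2 (interior_subset h1)
  have hintne : (interior (convexHull ℝ (C : Set Plane))).Nonempty := by
    obtain ⟨u, huC, hu⟩ := Finset.exists_subset_card_eq (show 3 ≤ C.card from hcard)
    have hind := affineIndependent_finset_of_cospherical hu.le fun y hy => hC y (huC hy)
    have htop := (hind.affineSpan_eq_top_iff_card_eq_finrank_add_one).2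
      (by rw [finrank_euclideanSpace_fin, Fintype.card_coe, hu])
    rw [Subtype.range_coe] at htop
    exact (interior_convexHull_nonempty_iff_affineSpan_eq_top.2 htop).mono
      (interior_mono (convexHull_mono (by exact_mod_cast huC)))
  obtain ⟨f, hf0, hf⟩ := geometric_hahn_banach_of_nonempty_interior_point
    (convex_convexHull ℝ (C : Set Plane)) hyint hintne
  have hfC : ∀ a ∈ C, f a ≤ f y := fun a ha => hf a (subset_convexHull ℝ _ ha)
  obtain ⟨w, hw, h1, hwy⟩ := Finset.mem_convexHull'.1 hsC
  have hcontact : ∀ a ∈ C, w a ≠ 0 → f a = f y := by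
    have e : ∑ a ∈ C, w a * (f y - f a) = 0 := by
      have := congrArg f hwy
      simp only [map_sum, map_smul, smul_eq_mul] at this
      simp only [mul_sub, Finset.sum_sub_distrib, ← Finset.sum_mul, h1, one_mul, this, sub_self]
    have nn : ∀ a ∈ C, 0 ≤ w a * (f y - f a) := fun a ha =>
      mul_nonneg (hw a ha) (sub_nonneg.2 (hfC a ha))
    intro a ha ha0
    have := (mul_eq_zero.1 ((Finset.sum_eq_zero_iff_of_nonneg nn).1 e a ha)).resolve_left ha0
    linarith
  set Z := C.filter fun a => f a = f y with hZ
  have hyZ : y ∈ convexHull ℝ (Z : Set Plane) :=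
    mem_convexHull_of_weights hw h1 hwy fun a ha ha0 => by
      simp [hZ, ha, hcontact a ha ha0]
  have hZcard : Z.card ≤ 2 := by
    refine card_le_two_of_cospherical_line (f := f.toLinearMap) (b := f y)
      (fun a ha => hC a (Finset.mem_filter.1 ha).1) ?_ fun a ha => (Finset.mem_filter.1 ha).2
    intro h
    exact hf0 (ContinuousLinearMap.coe_injective h)
  -- If the supporting line contained `m`, it would meet `C` in at most one further point `q`, with
  -- `y` strictly between `m` and `q`; the ray could then be continued inside the hull.
  have hfm : f m ≠ f y := by
    intro hmy
    have hmZ : m ∈ Z := by simp [hZ, hm, hmy]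
    have hpair : ∃ q ∈ C, Z ⊆ {m, q} := by
      have : (Z.erase m).card ≤ 1 := by rw [Finset.card_erase_of_mem hmZ]; omega
      rcases (Z.erase m).eq_empty_or_nonempty with h | ⟨q, hq⟩
      · refine ⟨m, hm, ?_⟩
        rw [Finset.erase_eq_empty_iff] at h
        rcases h with h | h <;> simp [h]
      · refine ⟨q, (Finset.mem_filter.1 (Finset.mem_of_mem_erase hq)).1, ?_⟩
        rw [← Finset.insert_erase hmZ]
        refine Finset.insert_subset_insert _ fun a ha => ?_
        exact Finset.mem_singleton.2 (Finset.card_le_one.1 this a ha q hq)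
    obtain ⟨q, hq, hZq⟩ := hpair
    have h2 : y ∈ segment ℝ m q := by
      rw [← convexHull_pair]
      refine convexHull_mono ?_ hyZ
      intro a ha
      simpa using hZq ha
    obtain ⟨α, β, hα, hβ, hαβ, hyq⟩ := h2
    have hβ0 : β ≠ 0 := by
      rintro rfl
      rw [zero_smul, add_zero, show α = 1 by linarith, one_smul] at hyq
      exact hym hyq.symm
    have hα0 : α ≠ 0 := by
      rintro rfl
      rw [zero_smul, zero_add, show β = 1 by linarith, one_smul] at hyq
      exact hyC (hyq ▸ hq)
    have hβpos : 0 < β := lt_of_le_of_ne hβ (Ne.symm hβ0)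
    have hβ1 : β < 1 := by
      have : 0 < α := lt_of_le_of_ne hα (Ne.symm hα0)
      linarith
    refine hbeyond β⁻¹ ((one_lt_inv₀ hβpos).2 hβ1) ?_
    have : m + β⁻¹ • (y - m) = q := by
      have h3 : y - m = β • (q - m) := by
        rw [← hyq, show α = 1 - β by linarith]
        simp only [sub_smul, smul_sub, one_smul]
        abel
      rw [h3, smul_smul, inv_mul_cancel₀ hβ0, one_smul, add_sub_cancel]
    rw [this]
    exact subset_convexHull ℝ _ hq
  refine ⟨insert m Z, by simp, ?_, ?_, -f.toLinearMap, -f y, ?_, ?_, ?_⟩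
  · exact Finset.insert_subset hm (Finset.filter_subset _ _)
  · have hc := convex_convexHull ℝ ((insert m Z : Finset Plane) : Set Plane)
    refine hc.segment_subset (subset_convexHull ℝ _ (by simp)) ?_ hxy
    exact convexHull_mono (by simp) hyZ
  · intro p hp
    simpa using hfC p hp
  · intro p hp
    rcases Finset.mem_insert.1 hp with h | h
    · exact Or.inl h
    · right; simp [(Finset.mem_filter.1 h).2]
  · simpa using lt_of_le_of_ne (hfC m hm) hfm

theorem pullingComplex_isDelaunay {ε R : ℝ} {P : Set Plane} (hP : IsNet ε R P)
    {m : Set Plane → Plane} (hm : ∀ C : Set Plane, C.Nonempty → m C ∈ C) :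
    IsDelaunayTriangulation (pullingComplex P m) P := by
  classical
  refine ⟨⟨?_, ?_⟩, ?_⟩
  · ext p
    constructor
    · rintro ⟨-, c, ρ, -, h, -⟩
      exact (h (by simp : p ∈ (({p} : Finset Plane) : Set Plane))).1
    · intro hp
      have hcell : cell P p 0 = {p} := by
        ext q
        simp only [cell, Set.mem_ofPred_eq, Set.mem_singleton_iff]
        constructor
        · rintro ⟨-, h⟩
          exact dist_eq_zero.1 (pow_eq_zero_iff two_ne_zero |>.1 h)
        · rintro rfl
          exact ⟨hp, by simp⟩
      -- A single point is a cell of radius zero centred at itself; with `b = -1` no second vertex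
      -- is possible.
      refine ⟨by simp, p, 0, fun q _ => by positivity, ?_, 0, -1, ?_, ?_, ?_⟩
      · rw [hcell]; simp
      · simp
      · intro q hq
        left
        have := hm (cell P p 0) (by rw [hcell]; simp)
        rw [hcell] at this ⊢
        rw [Finset.mem_singleton.1 hq, this]
      · simp
  · rw [hP.convexHull_eq_univ]
    refine Set.eq_univ_of_forall fun x => ?_
    obtain ⟨c, ρ, hemp, hx⟩ := hP.exists_cell x
    have hfin := cell_finite hP c ρ
    have hne : (cell P c ρ).Nonempty := convexHull_nonempty_iff.1 ⟨x, hx⟩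
    obtain ⟨t, htne, htC, hxt, f, b, h1, h2, h3⟩ := exists_fan (C := hfin.toFinset) (c := c) (ρ := ρ)
      (fun y hy => ((hfin.mem_toFinset).1 hy).2) ((hfin.mem_toFinset).2 (hm _ hne))
      (by rwa [hfin.coe_toFinset])
    refine Geometry.SimplicialComplex.mem_space_iff.2 ⟨t, ⟨htne, c, ρ, hemp, ?_, f, b, ?_, h2, h3⟩, hxt⟩
    · intro p hp
      exact (hfin.mem_toFinset).1 (htC hp)
    · intro p hp
      exact h1 p ((hfin.mem_toFinset).2 hp)
  · rintro t ⟨⟨-, c, ρ, hemp, htC, -⟩, hcard⟩ c' r hr x hx hxb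
    have hcc : c = c' := by
      by_contra hne
      have := card_le_two_of_mem_two_circles (t := t) (c := c) (c' := c') (ρ := ρ) (ρ' := r ^ 2)
        (fun y hy => (htC hy).2) (fun y hy => by rw [hr y hy]) hne
      omega
    subst hcc
    obtain ⟨p, hp⟩ : t.Nonempty := Finset.card_pos.1 (by omega)
    have h1 := hemp x hx
    rw [← (htC hp).2, hr p hp] at h1
    rw [Metric.mem_ball] at hxb
    have := dist_nonneg (x := x) (y := c)
    nlinarith

end

noncomputable section

open Set Filter Topology

/-! ### Arbitrary Delaunay triangulations of nets -/

theorem exists_circumcircle {t : Finset Plane} (hi : AffineIndependent ℝ ((↑) : t → Plane))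
    (hne : t.Nonempty) : ∃ (c : Plane) (r : ℝ), ∀ p ∈ t, dist p c = r := by
  have : Nonempty t := hne.to_subtype
  obtain ⟨s, ⟨-, hs⟩, -⟩ := hi.existsUnique_dist_eq
  exact ⟨s.center, s.radius, fun p hp => Metric.mem_sphere.1 (hs ⟨⟨p, hp⟩, rfl⟩)⟩

theorem IsDelaunayTriangulation.exists_circumcircle {ε R : ℝ} {P : Set Plane} {K : PlaneComplex}
    (hK : IsDelaunayTriangulation K P) (hP : IsNet ε R P) {t : Finset Plane}
    (ht : IsTriangle K t) :
    ∃ (c : Plane) (r : ℝ), (∀ p ∈ t, dist p c = r) ∧ (∀ x ∈ P, r ≤ dist x c) ∧ 0 ≤ r ∧ r < R := by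
  have hne : t.Nonempty := K.nonempty_of_mem_faces ht.1
  obtain ⟨c, r, h⟩ := _root_.exists_circumcircle (K.indep ht.1) hne
  have h2 := hK.2 t ht c r h
  have h3 : ∀ x ∈ P, r ≤ dist x c := fun x hx => not_lt.1 fun hlt => h2 x hx hlt
  obtain ⟨p, hp⟩ := hne
  obtain ⟨q, hq, hqd⟩ := hP.2.2 c
  refine ⟨c, r, h, h3, h p hp ▸ dist_nonneg, ?_⟩
  rw [dist_comm] at hqd
  exact (h3 q hq).trans_lt hqd

theorem IsDelaunayTriangulation.face_subset {P : Set Plane} {K : PlaneComplex}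
    (hK : IsDelaunayTriangulation K P) {t : Finset Plane} (ht : t ∈ K.faces) :
    (t : Set Plane) ⊆ P := by
  intro p hp
  rw [← hK.1.1]
  exact K.down_closed ht (by simpa using hp) (Finset.singleton_nonempty p)

theorem dist_le_of_mem_convexHull {t : Set Plane} {c x : Plane} {r : ℝ}
    (h : ∀ p ∈ t, dist p c ≤ r) (hx : x ∈ convexHull ℝ t) : dist x c ≤ r :=
  convexHull_min (t := Metric.closedBall c r) (fun p hp => h p hp) (convex_closedBall c r) hx

theorem IsDelaunayTriangulation.finite_triangles {ε R : ℝ} {P : Set Plane} {K : PlaneComplex}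
    (hK : IsDelaunayTriangulation K P) (hP : IsNet ε R P) (x : Plane) (ρ : ℝ) :
    {t : Finset Plane | IsTriangle K t ∧
      (convexHull ℝ (t : Set Plane) ∩ Metric.closedBall x ρ).Nonempty}.Finite := by
  have hfin := hP.2.1.finite_inter_closedBall hP.1 x (ρ + 2 * R)
  refine (Set.Finite.finite_subsets hfin).preimage (f := fun t : Finset Plane => (t : Set Plane))
    (Finset.coe_injective.injOn) |>.subset ?_
  rintro t ⟨ht, y, hyt, hyx⟩ p hp
  refine ⟨hK.face_subset ht.1 hp, ?_⟩
  obtain ⟨c, r, hc, -, -, hr⟩ := hK.exists_circumcircle hP ht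
  have h1 := dist_le_of_mem_convexHull (fun p hp => (hc p hp).le) hyt
  have h2 := hc p hp
  rw [Metric.mem_closedBall] at hyx ⊢
  have h3 := dist_triangle p c x
  have h4 := dist_triangle c y x
  rw [dist_comm c y] at h4
  linarith

/-- The triangles of a Delaunay triangulation of a net cover the plane. -/
theorem IsDelaunayTriangulation.exists_triangle_mem {ε R : ℝ} {P : Set Plane} {K : PlaneComplex}
    (hK : IsDelaunayTriangulation K P) (hP : IsNet ε R P) (x : Plane) :
    ∃ t, IsTriangle K t ∧ x ∈ convexHull ℝ (t : Set Plane) := by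
  classical
  set U : Set Plane := ⋃ t : {t : Finset Plane // IsTriangle K t},
    convexHull ℝ ((t : Finset Plane) : Set Plane) with hU
  suffices h : U = Set.univ by
    have := h ▸ Set.mem_univ x
    obtain ⟨t, ht⟩ := Set.mem_iUnion.1 this
    exact ⟨t, t.2, ht⟩
  -- The complement of `U` is open because triangles are locally finite, and null because only
  -- countably many points and segments are left to cover it. Hence it is empty.
  have hclosed : IsClosed U := by
    refine LocallyFinite.isClosed_iUnion ?_ fun t =>
      (t.1.finite_toSet.isCompact_convexHull ℝ).isClosed
    intro y
    refine ⟨Metric.closedBall y 1, Metric.closedBall_mem_nhds y one_pos, ?_⟩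
    refine ((hK.finite_triangles hP y 1).preimage Subtype.val_injective.injOn).subset ?_
    intro t ht
    exact ⟨t.2, ht⟩
  have hcount : {t : Finset Plane | t ∈ K.faces ∧ t.card ≤ 2}.Countable := by
    have h1 : Countable P := (hP.2.1.countable hP.1).to_subtype
    refine (Set.countable_range fun s : Finset P => s.map (Function.Embedding.subtype _)).mono ?_
    rintro t ⟨ht, -⟩
    refine ⟨t.subtype (· ∈ P), ?_⟩
    exact Finset.subtype_map_of_mem fun p hp => hK.face_subset ht hp
  have hnull : MeasureTheory.volume Uᶜ = 0 := by
    refine MeasureTheory.measure_mono_null (t := ⋃ t ∈ {t : Finset Plane | t ∈ K.faces ∧ t.card ≤ 2},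
      convexHull ℝ (t : Set Plane)) ?_ ?_
    · intro y hy
      have : y ∈ K.space := by rw [hK.1.2, hP.convexHull_eq_univ]; trivial
      obtain ⟨t, ht, hyt⟩ := Geometry.SimplicialComplex.mem_space_iff.1 this
      refine Set.mem_biUnion (show t ∈ {t : Finset Plane | t ∈ K.faces ∧ t.card ≤ 2} from ⟨ht, ?_⟩)
        hyt
      have h3 := face_card_le ht
      by_contra hcard
      exact hy (Set.mem_iUnion.2 ⟨⟨t, ht, by omega⟩, hyt⟩)
    · rw [MeasureTheory.measure_biUnion_null_iff hcount]
      rintro t ⟨ht, hcard⟩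
      refine MeasureTheory.measure_mono_null (convexHull_subset_affineSpan (t : Set Plane)) ?_
      refine MeasureTheory.Measure.addHaar_affineSubspace _ _ fun htop => ?_
      have hd : vectorSpan ℝ (t : Set Plane) = ⊤ := by
        rw [← direction_affineSpan, htop, AffineSubspace.direction_top]
      have hle : Module.finrank ℝ (vectorSpan ℝ (t : Set Plane)) + 1 ≤ t.card := by
        obtain ⟨n, hn⟩ : ∃ n, t.card = n + 1 :=
          ⟨t.card - 1, by have := Finset.card_pos.2 (K.nonempty_of_mem_faces ht); omega⟩
        have := finrank_vectorSpan_image_finset_le ℝ (id : Plane → Plane) t hn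
        rw [Finset.coe_image, Set.image_id] at this
        omega
      rw [hd, finrank_top, finrank_euclideanSpace_fin] at hle
      omega
  have := (hclosed.isOpen_compl.measure_eq_zero_iff MeasureTheory.volume).1 hnull
  rw [← compl_compl U, this, Set.compl_empty]

/-- Some triangle at `x` contains points arbitrarily close to `x` in the direction of `y`. -/
theorem IsDelaunayTriangulation.exists_triangle_towards {ε R : ℝ} {P : Set Plane}
    {K : PlaneComplex} (hK : IsDelaunayTriangulation K P) (hP : IsNet ε R P) (x y : Plane) :
    ∃ t, IsTriangle K t ∧ x ∈ convexHull ℝ (t : Set Plane) ∧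
      ∃ᶠ e in 𝓝[>] (0 : ℝ), x + e • (y - x) ∈ convexHull ℝ (t : Set Plane) := by
  have hlim : Tendsto (fun e : ℝ => x + e • (y - x)) (𝓝[>] 0) (𝓝 x) := by
    have : Continuous fun e : ℝ => x + e • (y - x) := by fun_prop
    simpa using (this.tendsto 0).mono_left nhdsWithin_le_nhds
  have hfin := hK.finite_triangles hP x 1
  suffices h : ∃ t ∈ {t : Finset Plane | IsTriangle K t ∧
      (convexHull ℝ (t : Set Plane) ∩ Metric.closedBall x 1).Nonempty},
      ∃ᶠ e in 𝓝[>] (0 : ℝ), x + e • (y - x) ∈ convexHull ℝ (t : Set Plane) by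
    obtain ⟨t, ⟨ht, -⟩, hf⟩ := h
    exact ⟨t, ht, (t.finite_toSet.isCompact_convexHull ℝ).isClosed.mem_of_frequently_of_tendsto
      hf hlim, hf⟩
  -- Pigeonhole: every point `x + e • (y - x)` near `x` lies in one of finitely many triangles, so
  -- some triangle occurs for arbitrarily small `e`.
  by_contra! hcon
  have h1 := (eventually_all_finite hfin).2 hcon
  have h2 := hlim.eventually (Metric.closedBall_mem_nhds x one_pos)
  obtain ⟨e, he1, he2⟩ := (h1.and h2).exists
  obtain ⟨t, ht, hmem⟩ := hK.exists_triangle_mem hP (x + e • (y - x))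
  exact he1 t ⟨ht, _, hmem, he2⟩ hmem

/-- A segment with a strictly empty circumscribed disk is an edge of every Delaunay
triangulation. -/
theorem IsDelaunayTriangulation.pair_mem {ε R : ℝ} {P : Set Plane} {K : PlaneComplex}
    (hK : IsDelaunayTriangulation K P) (hP : IsNet ε R P) {a b c : Plane} {ρ : ℝ}
    (ha : a ∈ P) (hb : b ∈ P) (hab : a ≠ b) (hac : dist a c ^ 2 = ρ) (hbc : dist b c ^ 2 = ρ)
    (hemp : ∀ p ∈ P, p ≠ a → p ≠ b → ρ < dist p c ^ 2) : ({a, b} : Finset Plane) ∈ K.faces := by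
  classical
  set x : Plane := (1 / 2 : ℝ) • a + (1 / 2 : ℝ) • b with hx
  obtain ⟨t, ht, hxt⟩ := hK.exists_triangle_mem hP x
  obtain ⟨c', r, hr, hr2, -, -⟩ := hK.exists_circumcircle hP ht
  obtain ⟨w, hw, h1, hwx⟩ := Finset.mem_convexHull'.1 hxt
  have hge : ∀ p ∈ P, ρ ≤ dist p c ^ 2 := by
    intro p hp
    by_cases h : p = a
    · rw [h, hac]
    by_cases h' : p = b
    · rw [h', hbc]
    exact (hemp p hp h h').le
  have hge' : ∀ p ∈ P, r ^ 2 ≤ dist p c' ^ 2 := by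
    intro p hp
    have : 0 ≤ r := by
      obtain ⟨q, hq⟩ := K.nonempty_of_mem_faces ht.1
      rw [← hr q hq]; exact dist_nonneg
    exact pow_le_pow_left₀ this (hr2 p hp) 2
  -- The midpoint lies in two simplices inscribed in empty disks, so its carriers in `t` lie on the
  -- circle through `a` and `b`, where `P` has no other points.
  have hsupp : ∀ y ∈ t, w y ≠ 0 → y ∈ ({a, b} : Finset Plane) := by
    intro y hy hy0
    have := dist_sq_eq_of_mem_both (s' := {a, b}) (w' := fun _ => 1 / 2) (c := c') (ρ := r ^ 2)
      (c' := c) (ρ' := ρ) hw h1 hwx (by intros; norm_num)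
      (by rw [Finset.sum_pair hab]; norm_num) (by rw [Finset.sum_pair hab])
      (fun y hy => by rw [hr y hy]) (fun y hy => by
        rcases Finset.mem_insert.1 hy with h | h
        · rw [h, hac]
        · rw [Finset.mem_singleton.1 h, hbc])
      (fun y hy => hge y (hK.face_subset ht.1 hy)) (fun y hy => by
        rcases Finset.mem_insert.1 hy with h | h
        · rw [h]; exact hge' a ha
        · rw [Finset.mem_singleton.1 h]; exact hge' b hb) hy hy0
    by_contra hn
    simp only [Finset.mem_insert, Finset.mem_singleton, not_or] at hn
    have := hemp y (hK.face_subset ht.1 hy) hn.1 hn.2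
    linarith
  have hmem : ∀ z ∈ ({a, b} : Finset Plane), z ∈ t := by
    have hz : ∀ z z' : Plane, z ≠ z' → x = (1 / 2 : ℝ) • z + (1 / 2 : ℝ) • z' →
        (∀ y ∈ t, w y ≠ 0 → y = z ∨ y = z') → z ∈ t := by
      intro z z' hzz hxz hs
      by_contra hzt
      have : x ∈ convexHull ℝ ({z'} : Set Plane) := by
        refine mem_convexHull_of_weights hw h1 hwx fun y hy hy0 => ?_
        rcases hs y hy hy0 with h | h
        · exact absurd (h ▸ hy) hzt
        · exact h
      rw [convexHull_singleton, Set.mem_singleton_iff, hxz] at this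
      apply hzz
      have h2 : (1 / 2 : ℝ) • z = (1 / 2 : ℝ) • z' := by
        have h3 : z' = (1 / 2 : ℝ) • z' + (1 / 2 : ℝ) • z' := by
          rw [← add_smul]; norm_num
        conv_rhs at this => rw [h3]
        exact add_right_cancel this
      exact smul_right_injective _ (by norm_num : (1 / 2 : ℝ) ≠ 0) h2
    intro z hzm
    rcases Finset.mem_insert.1 hzm with h | h
    · rw [h]
      exact hz a b hab hx fun y hy hy0 => by simpa using hsupp y hy hy0
    · rw [Finset.mem_singleton.1 h]
      exact hz b a hab.symm (by rw [hx, add_comm]) fun y hy hy0 => by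
        have := hsupp y hy hy0
        simp at this
        exact this.symm
  exact K.down_closed ht.1 hmem ⟨a, by simp⟩

/-! ### Short segments: Delaunay edges and stability -/

theorem dist_midpoint_sq (p a b : Plane) :
    dist p ((1 / 2 : ℝ) • a + (1 / 2 : ℝ) • b) ^ 2 =
      (dist p a ^ 2 + dist p b ^ 2) / 2 - dist a b ^ 2 / 4 := by
  simp only [plane_dist_sq]
  simp
  ring

/-- A pair at distance less than `√2` times the separation spans an edge of every Delaunay
triangulation. -/
theorem IsDelaunayTriangulation.pair_mem_of_dist_lt {ε R : ℝ} {P : Set Plane} {K : PlaneComplex}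
    (hK : IsDelaunayTriangulation K P) (hP : IsNet ε R P) {a b : Plane}
    (ha : a ∈ P) (hb : b ∈ P) (hab : a ≠ b) (hd : dist a b ^ 2 < 2 * ε ^ 2) :
    ({a, b} : Finset Plane) ∈ K.faces := by
  refine hK.pair_mem hP (c := (1 / 2 : ℝ) • a + (1 / 2 : ℝ) • b) (ρ := dist a b ^ 2 / 4)
    ha hb hab ?_ ?_ ?_
  · rw [dist_midpoint_sq, dist_self]; ring
  · rw [dist_midpoint_sq, dist_self, dist_comm b a]; ring
  · intro p hp hpa hpb
    rw [dist_midpoint_sq]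
    have h1 := pow_le_pow_left₀ hP.1.le (hP.2.1 p hp a ha hpa) 2
    have h2 := pow_le_pow_left₀ hP.1.le (hP.2.1 p hp b hb hpb) 2
    linarith

/-- Short segments of a Gromov set are stable. -/
theorem isStable_of_dist_lt {δ : ℝ} (hδ : 0 < δ) {S : Set Plane} (hS : IsGromov δ S) {a b : Plane}
    (ha : a ∈ S) (hb : b ∈ S) (hab : a ≠ b) (hd : dist a b < (√2 - 1 / 10) * δ) :
    IsStable (1 / 100 * δ) S a b := by
  refine ⟨ha, hb, fun ι hι hmove => ?_⟩
  have hnet := hS.isNet hδ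
  -- Distances between two moved points change by less than `2δ/100`, distances to a fixed point by
  -- less than `δ/100`.
  have hP : IsNet (98 / 100 * δ) (101 / 100 * δ) (Set.range ι) := by
    refine ⟨by positivity, ?_, ?_⟩
    · rintro _ ⟨s, rfl⟩ _ ⟨s', rfl⟩ hne
      have hne' : (s : Plane) ≠ s' := fun h => hne (by rw [Subtype.ext h])
      have h1 := hnet.2.1 s s.2 s' s'.2 hne'
      have h2 := hmove s
      have h3 := hmove s'
      have h4 := dist_triangle4 (s : Plane) (ι s) (ι s') s'
      rw [dist_comm (s : Plane) (ι s)] at h4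
      linarith
    · intro x
      obtain ⟨s, hs, hxs⟩ := hnet.2.2 x
      refine ⟨ι ⟨s, hs⟩, ⟨_, rfl⟩, ?_⟩
      have h2 := hmove ⟨s, hs⟩
      have h3 := dist_triangle_right x (ι ⟨s, hs⟩) s
      simp only at h2
      linarith
  have hne : ι ⟨a, ha⟩ ≠ ι ⟨b, hb⟩ := fun h => hab (by simpa using hι.injective h)
  refine ⟨⟨_, rfl⟩, ⟨_, rfl⟩, hne, fun K hK => ⟨hne, _,
    hK.pair_mem_of_dist_lt hP ⟨_, rfl⟩ ⟨_, rfl⟩ hne ?_, by simp⟩⟩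
  have h1 := hmove ⟨a, ha⟩
  have h2 := hmove ⟨b, hb⟩
  have h3 := dist_triangle4 (ι ⟨a, ha⟩) a b (ι ⟨b, hb⟩)
  rw [dist_comm b] at h3
  simp only at h1 h2
  have h4 : dist (ι ⟨a, ha⟩) (ι ⟨b, hb⟩) < (√2 - 8 / 100) * δ := by linarith
  have h5 := dist_nonneg (x := ι ⟨a, ha⟩) (y := ι ⟨b, hb⟩)
  have h6 := pow_lt_pow_left₀ h4 h5 two_ne_zero
  have hs : √2 ^ 2 = 2 := Real.sq_sqrt (by norm_num)
  have hs0 := Real.sqrt_nonneg 2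
  have hs1 : 7 / 5 ≤ √2 := Real.le_sqrt_of_sq_le (by norm_num)
  -- Losing 2% of the separation lowers the threshold `√2` by `2√2/100`, which is less than `8/100`.
  have h7 : (√2 - 8 / 100) ^ 2 ≤ 2 * (98 / 100) ^ 2 := by nlinarith
  have h8 := mul_le_mul_of_nonneg_right h7 (sq_nonneg δ)
  rw [mul_pow] at h6
  linarith [mul_pow (98 / 100) δ 2]

end

noncomputable section

open Set Filter Topology

/-! ### Geometry of one triangle -/

/-- In a triangle whose circumradius is at most the side `uq`, the sine of the angle at `w` is at
least `1/2`. -/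
theorem le_dist_of_cocircular {u w q c : Plane} {R : ℝ} (hu : dist u c = R) (hw : dist w c = R)
    (hq : dist q c = R) (hR : R ≤ dist u q) (hwq : w ≠ q) (huq : u ≠ q) (σ τ : ℝ) :
    |σ| * dist u w / 2 ≤ dist (w + σ • (u - w)) (w + τ • (q - w)) := by
  have h1 : dist u c ^ 2 = R ^ 2 := by rw [hu]
  have h2 : dist w c ^ 2 = R ^ 2 := by rw [hw]
  have h3 : dist q c ^ 2 = R ^ 2 := by rw [hq]
  have hR0 : 0 ≤ R := hu ▸ dist_nonneg
  have h4 : R ^ 2 ≤ dist u q ^ 2 := pow_le_pow_left₀ hR0 hR 2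
  have hRpos : 0 < R := by
    rcases hR0.lt_or_eq with h | h
    · exact h
    · rw [← h, dist_eq_zero] at hu hq
      exact absurd (hu.trans hq.symm) huq
  have h5 : 0 < dist w q ^ 2 := pow_pos (dist_pos.2 hwq) 2
  refine abs_le_of_sq_le_sq' ?_ dist_nonneg |>.2
  rw [div_pow, mul_pow, sq_abs]
  simp only [plane_dist_sq] at *
  simp only [PiLp.add_apply, PiLp.smul_apply, PiLp.sub_apply, smul_eq_mul] at *
  obtain ⟨e0, he0⟩ : ∃ e0, e0 = u 0 - w 0 := ⟨_, rfl⟩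
  obtain ⟨e1, he1⟩ : ∃ e1, e1 = u 1 - w 1 := ⟨_, rfl⟩
  obtain ⟨f0, hf0⟩ : ∃ f0, f0 = q 0 - w 0 := ⟨_, rfl⟩
  obtain ⟨f1, hf1⟩ : ∃ f1, f1 = q 1 - w 1 := ⟨_, rfl⟩
  obtain ⟨o0, ho0⟩ : ∃ o0, o0 = c 0 - w 0 := ⟨_, rfl⟩
  obtain ⟨o1, ho1⟩ : ∃ o1, o1 = c 1 - w 1 := ⟨_, rfl⟩
  rw [show u 0 - c 0 = e0 - o0 by rw [he0, ho0]; ring,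
    show u 1 - c 1 = e1 - o1 by rw [he1, ho1]; ring] at h1
  rw [show w 0 - c 0 = - o0 by rw [ho0]; ring, show w 1 - c 1 = - o1 by rw [ho1]; ring] at h2
  rw [show q 0 - c 0 = f0 - o0 by rw [hf0, ho0]; ring,
    show q 1 - c 1 = f1 - o1 by rw [hf1, ho1]; ring] at h3
  rw [show u 0 - q 0 = e0 - f0 by rw [he0, hf0]; ring,
    show u 1 - q 1 = e1 - f1 by rw [he1, hf1]; ring] at h4
  rw [show w 0 - q 0 = - f0 by rw [hf0]; ring, show w 1 - q 1 = - f1 by rw [hf1]; ring] at h5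
  rw [← he0, ← he1, ← hf0, ← hf1]
  have a1 : 2 * (o0 * e0 + o1 * e1) = e0 ^ 2 + e1 ^ 2 := by linear_combination h2 - h1
  have a2 : 2 * (o0 * f0 + o1 * f1) = f0 ^ 2 + f1 ^ 2 := by linear_combination h2 - h3
  have b0 : 2 * (e0 * f1 - e1 * f0) * o0 = (e0 ^ 2 + e1 ^ 2) * f1 - (f0 ^ 2 + f1 ^ 2) * e1 := by
    linear_combination f1 * a1 - e1 * a2
  have b1 : 2 * (e0 * f1 - e1 * f0) * o1 = (f0 ^ 2 + f1 ^ 2) * e0 - (e0 ^ 2 + e1 ^ 2) * f0 := by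
    linear_combination e0 * a2 - f0 * a1
  -- The formula area `= abc / 4R`, squared; `b0` and `b1` give the circumcentre by Cramer's rule.
  have hdet : 4 * (e0 * f1 - e1 * f0) ^ 2 * R ^ 2 =
      (e0 ^ 2 + e1 ^ 2) * (f0 ^ 2 + f1 ^ 2) * ((e0 - f0) ^ 2 + (e1 - f1) ^ 2) := by
    calc 4 * (e0 * f1 - e1 * f0) ^ 2 * R ^ 2
        = (2 * (e0 * f1 - e1 * f0) * o0) ^ 2 + (2 * (e0 * f1 - e1 * f0) * o1) ^ 2 := by
          rw [← h2]; ring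
      _ = _ := by rw [b0, b1]; ring
  have hR2 : 0 < R ^ 2 := pow_pos hRpos 2
  have hge : (e0 ^ 2 + e1 ^ 2) * (f0 ^ 2 + f1 ^ 2) ≤ 4 * (e0 * f1 - e1 * f0) ^ 2 := by
    refine le_of_mul_le_mul_right ?_ hR2
    rw [hdet]
    exact mul_le_mul_of_nonneg_left h4 (by positivity)
  have hF : 0 < f0 ^ 2 + f1 ^ 2 := by linarith
  refine le_of_mul_le_mul_right ?_ hF
  have hl : (σ * (e0 * f1 - e1 * f0)) ^ 2 ≤
      ((w 0 + σ * e0 - (w 0 + τ * f0)) ^ 2 + (w 1 + σ * e1 - (w 1 + τ * f1)) ^ 2) *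
        (f0 ^ 2 + f1 ^ 2) := by
    linarith [sq_nonneg ((σ * e0 - τ * f0) * f0 + (σ * e1 - τ * f1) * f1)]
  refine le_trans ?_ hl
  have := mul_le_mul_of_nonneg_left hge (sq_nonneg σ)
  rw [show e0 ^ 2 + e1 ^ 2 = e0 ^ 2 + e1 ^ 2 from rfl]
  linarith

/-- A point within `δ` of the circumcentre and at distance at least `δ` from `q` is at distance at
least `δ` from the points of the ray `vq` lying `δ` beyond `q`. -/
theorem le_dist_ray {v q c y : Plane} {δ s : ℝ} (hδ : 0 < δ) (hc : dist v c = dist q c)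
    (hyc : dist y c ≤ δ) (hvq : δ ≤ dist q v) (hyq : δ ≤ dist y q) (hs : δ ≤ (s - 1) * dist q v) :
    δ ≤ dist y (v + s • (q - v)) := by
  set b := dist q v with hb
  have hb0 : 0 < b := hδ.trans_le hvq
  have h1 : dist v c ^ 2 = dist q c ^ 2 := by rw [hc]
  have h2 : dist y c ^ 2 ≤ δ ^ 2 := pow_le_pow_left₀ dist_nonneg hyc 2
  have h3 : δ ^ 2 ≤ dist y q ^ 2 := pow_le_pow_left₀ hδ.le hyq 2
  have hb2 : b ^ 2 = (q 0 - v 0) ^ 2 + (q 1 - v 1) ^ 2 := by rw [hb, plane_dist_sq]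
  refine abs_le_of_sq_le_sq' ?_ dist_nonneg |>.2
  rw [plane_dist_sq, plane_dist_sq] at h1
  rw [plane_dist_sq] at h2 h3 ⊢
  simp only [PiLp.add_apply, PiLp.smul_apply, PiLp.sub_apply, smul_eq_mul]
  have hcs : ((y 0 - c 0) * (q 0 - v 0) + (y 1 - c 1) * (q 1 - v 1)) ≤ δ * b := by
    refine abs_le_of_sq_le_sq' ?_ (by positivity) |>.2
    rw [mul_pow, hb2]
    refine le_trans ?_ (mul_le_mul_of_nonneg_right h2 (by positivity))
    linarith [sq_nonneg ((y 0 - c 0) * (q 1 - v 1) - (y 1 - c 1) * (q 0 - v 0))]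
  have hcq : 2 * ((c 0 - q 0) * (q 0 - v 0) + (c 1 - q 1) * (q 1 - v 1)) = - b ^ 2 := by
    rw [hb2]; linear_combination h1
  -- The circumcentre projects to the midpoint of `vq`, so `y - q` has component at most `δ - b / 2
  -- ≤ δ / 2` along the ray. Going at least `δ` beyond `q` therefore does not bring the point closer
  -- to `y` than `q` is.
  have hin : 2 * ((y 0 - q 0) * (q 0 - v 0) + (y 1 - q 1) * (q 1 - v 1)) ≤ δ * b := by
    nlinarith
  have hs1 : 0 < s - 1 := by
    by_contra! h
    nlinarith
  have hkey : 0 ≤ (s - 1) * ((s - 1) * b ^ 2 -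
      2 * ((y 0 - q 0) * (q 0 - v 0) + (y 1 - q 1) * (q 1 - v 1))) := by
    refine mul_nonneg hs1.le ?_
    nlinarith
  rw [hb2] at hkey
  linarith

/-- The circumcentre is the origin, the opposite side is the chord between `(k, t)` and `(k, -t)`,
and `(δ, 0)` is the blocker. A cap point `(a, b)` far from the end of the chord exists only if `2 *
δ * k ≤ r ^ 2`, which says exactly that the blocker is `δ`-far from the ends, and it is then closer
than `δ` to the blocker. -/
theorem cap_covered {k t a b r δ : ℝ} (hδ : 0 < δ) (hr : 0 < r) (hrδ : r < δ) (ht : 0 < t)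
    (hkt : k ^ 2 + t ^ 2 = r ^ 2) (hk : -r < 2 * k) (hak : k ≤ a) (hb : 0 ≤ b)
    (hab : a ^ 2 + b ^ 2 ≤ r ^ 2) (hp : δ ^ 2 ≤ (a - k) ^ 2 + (b - t) ^ 2) :
    2 * δ * k ≤ r ^ 2 ∧ (a - δ) ^ 2 + b ^ 2 < δ ^ 2 := by
  have hr2 : r ^ 2 < δ ^ 2 := pow_lt_pow_left₀ hrδ hr.le two_ne_zero
  have ha_r : a ≤ r := abs_le_of_sq_le_sq' (by linarith [sq_nonneg b]) hr.le |>.2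
  constructor
  · by_contra! hcon
    have hk0 : 0 < k := by
      by_contra! h
      linarith [sq_nonneg r, mul_nonneg hδ.le (neg_nonneg.2 h)]
    have hka2 : k ^ 2 ≤ a ^ 2 := pow_le_pow_left₀ hk0.le hak 2
    have hbt : b ≤ t := abs_le_of_sq_le_sq' (by linarith) ht.le |>.2
    have e1 : 0 ≤ (a - k) * (r - a) := mul_nonneg (by linarith) (by linarith)
    have hkr : k ≤ r := hak.trans ha_r
    have e2 : 0 ≤ (r - a) * (r - k) := mul_nonneg (by linarith) (by linarith)
    have e3 : 0 ≤ b * (2 * t - b) := mul_nonneg hb (by linarith)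
    have e4 : δ ^ 2 - 2 * r ^ 2 + 2 * k * r ≤ 0 := by linarith
    have e5 : δ * (δ ^ 2 - 2 * r ^ 2 + 2 * k * r) ≤ 0 := mul_nonpos_of_nonneg_of_nonpos hδ.le e4
    have e6 : r * (2 * δ * k) > r * r ^ 2 := mul_lt_mul_of_pos_left hcon hr
    have e7 : 0 < (δ - r) * (δ ^ 2 + δ * r - r ^ 2) :=
      mul_pos (by linarith) (by linarith [mul_pos hδ hr])
    linarith
  · by_contra! hcon
    have hcon' : 2 * δ * a ≤ a ^ 2 + b ^ 2 := by linarith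
    have hp' : 2 * (k * a + t * b) < a ^ 2 + b ^ 2 := by linarith
    -- For `0 ≤ a`, both `(a, b)` and `(k, t)` make angles of at least 60° with the axis, the latter
    -- also at most 120°. So the angle between them is at most 60°, and two points of a disk of
    -- radius `r` in that position are too close.
    rcases le_or_gt 0 a with ha | ha
    · obtain ⟨ρ, hρ0, hρ⟩ : ∃ ρ : ℝ, 0 ≤ ρ ∧ ρ ^ 2 = a ^ 2 + b ^ 2 :=
        ⟨√(a ^ 2 + b ^ 2), Real.sqrt_nonneg _, Real.sq_sqrt (by positivity)⟩
      rw [← hρ] at hcon' hp' hab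
      have hρr : ρ ≤ r := abs_le_of_sq_le_sq' hab hr.le |>.2
      have haρ : 2 * a ≤ ρ := by
        refine le_of_mul_le_mul_left ?_ hδ
        linarith [mul_nonneg hρ0 (sub_nonneg.2 (hρr.trans hrδ.le))]
      have hkr : 2 * k ≤ r := by linarith
      have ht2 : 3 * r ^ 2 / 4 ≤ t ^ 2 := by
        linarith [mul_nonneg (sub_nonneg.2 hkr) (by linarith : 0 ≤ r + 2 * k)]
      have hb2 : 3 * ρ ^ 2 / 4 ≤ b ^ 2 := by
        linarith [mul_nonneg (sub_nonneg.2 haρ) (by linarith : 0 ≤ ρ + 2 * a)]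
      have htb : 3 * (r * ρ) / 4 ≤ t * b := by
        refine abs_le_of_sq_le_sq' ?_ (by positivity) |>.2
        have := mul_le_mul ht2 hb2 (by positivity) (by positivity)
        rw [mul_pow]
        linarith
      have hka : -(r * ρ) / 4 ≤ k * a := by
        have h1 : 0 ≤ (2 * k + r) * a := mul_nonneg (by linarith) ha
        have h2 : 0 ≤ r * (ρ - 2 * a) := mul_nonneg hr.le (by linarith)
        linarith
      linarith [mul_nonneg hρ0 (sub_nonneg.2 hρr)]
    · have hk0 : k < 0 := by linarith
      have ht2 : 3 * r ^ 2 / 4 ≤ t ^ 2 := by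
        linarith [mul_nonneg (by linarith : 0 ≤ r - 2 * k) (by linarith : 0 ≤ r + 2 * k)]
      have hbt : b ≤ 2 * t := by
        refine abs_le_of_sq_le_sq' ?_ (by positivity) |>.2
        linarith [sq_nonneg a, sq_nonneg r]
      have h1 : 0 ≤ b * (2 * t - b) := mul_nonneg hb (by linarith)
      have h2 : 0 ≤ (a - k) * (-a) := mul_nonneg (by linarith) (by linarith)
      linarith [sq_nonneg a]

/-- Coordinates adapted to a triangle `vpq` with circumcentre `c`: `pq` is a vertical chord, `v`
lies to its left, and `z` is at distance `δ` to the right of `c`. -/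
theorem exists_frame {v p q c : Plane} {r δ : ℝ} (hv : dist v c = r) (hp : dist p c = r)
    (hq : dist q c = r) (hvp : v ≠ p) (hvq : v ≠ q) (hpq : p ≠ q) :
    ∃ (A B : Plane →ₗ[ℝ] ℝ) (z : Plane),
      (∀ X Y, dist X Y ^ 2 = (A X - A Y) ^ 2 + (B X - B Y) ^ 2) ∧ A p = A q ∧
      B p - B c = B c - B q ∧ 0 < B p - B c ∧ A v < A p ∧ A z = A c + δ ∧ B z = B c := by
  classical
  obtain ⟨t, ht⟩ : ∃ t, t = dist p q := ⟨_, rfl⟩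
  have ht0 : 0 < t := ht ▸ dist_pos.2 hpq
  have ht2 : t ^ 2 = (p 0 - q 0) ^ 2 + (p 1 - q 1) ^ 2 := by rw [ht, plane_dist_sq]
  obtain ⟨e0, he0⟩ : ∃ e0, e0 = (p 0 - q 0) / t := ⟨_, rfl⟩
  obtain ⟨e1, he1⟩ : ∃ e1, e1 = (p 1 - q 1) / t := ⟨_, rfl⟩
  have he : e0 ^ 2 + e1 ^ 2 = 1 := by
    rw [he0, he1, div_pow, div_pow, ← add_div, ← ht2, div_self (by positivity)]
  have hp0 : p 0 - q 0 = t * e0 := by rw [he0]; field_simp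
  have hp1 : p 1 - q 1 = t * e1 := by rw [he1]; field_simp
  let L : ℝ → ℝ → Plane →ₗ[ℝ] ℝ := fun x y =>
    x • (LinearMap.proj (R := ℝ) (0 : Fin 2) ∘ₗ (WithLp.linearEquiv 2 ℝ (Fin 2 → ℝ)).toLinearMap) +
    y • (LinearMap.proj (R := ℝ) (1 : Fin 2) ∘ₗ (WithLp.linearEquiv 2 ℝ (Fin 2 → ℝ)).toLinearMap)
  have hL : ∀ x y (X : Plane), L x y X = x * X 0 + y * X 1 := by
    intro x y X
    simp [L]
  have hcirc : dist p c ^ 2 = dist q c ^ 2 := by rw [hp, hq]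
  have hBc : 2 * (e0 * (p 0 - c 0) + e1 * (p 1 - c 1)) = t := by
    rw [plane_dist_sq, plane_dist_sq] at hcirc
    refine mul_left_cancel₀ ht0.ne' ?_
    have : t * (2 * (e0 * (p 0 - c 0) + e1 * (p 1 - c 1))) =
        2 * ((t * e0) * (p 0 - c 0) + (t * e1) * (p 1 - c 1)) := by ring
    rw [this, ← hp0, ← hp1]
    linear_combination hcirc - ht2
  obtain ⟨g, hg⟩ : ∃ g, g = -e1 * (p 0 - v 0) + e0 * (p 1 - v 1) := ⟨_, rfl⟩
  have hgne : g ≠ 0 := by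
    intro h0
    have hf : L (-e1) e0 ≠ 0 := by
      intro h
      have := congrArg (fun f : Plane →ₗ[ℝ] ℝ => f !₂[-e1, e0]) h
      simp only [hL, LinearMap.zero_apply] at this
      simp at this
      nlinarith
    have := card_le_two_of_cospherical_line (t := {v, p, q}) (c := c) (ρ := r ^ 2)
      (f := L (-e1) e0) (b := L (-e1) e0 p) (by simp [hv, hp, hq]) hf (by
        intro y hy
        simp only [Finset.mem_insert, Finset.mem_singleton] at hy
        rcases hy with rfl | rfl | rfl
        · rw [hL, hL]; linarith
        · rfl
        · rw [hL, hL]; linear_combination e1 * hp0 - e0 * hp1)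
    rw [Finset.card_eq_three.2 ⟨v, p, q, hvp, hvq, hpq, rfl⟩] at this
    omega
  -- The sign `σ` orients the normal of `pq` away from `v`.
  obtain ⟨σ, hσ, hσg⟩ : ∃ σ : ℝ, σ ^ 2 = 1 ∧ 0 < σ * g := by
    rcases lt_or_gt_of_ne hgne with h | h
    · exact ⟨-1, by norm_num, by linarith⟩
    · exact ⟨1, by norm_num, by linarith⟩
  refine ⟨L (-(σ * e1)) (σ * e0), L e0 e1, c + δ • !₂[-(σ * e1), σ * e0], ?_, ?_, ?_, ?_, ?_, ?_, ?_⟩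
  · intro X Y
    rw [plane_dist_sq, hL, hL, hL, hL]
    have : (-(σ * e1) * X 0 + σ * e0 * X 1 - (-(σ * e1) * Y 0 + σ * e0 * Y 1)) ^ 2 =
        σ ^ 2 * (-e1 * (X 0 - Y 0) + e0 * (X 1 - Y 1)) ^ 2 := by ring
    rw [this, hσ]
    linear_combination (-((X 0 - Y 0) ^ 2 + (X 1 - Y 1) ^ 2)) * he
  · rw [hL, hL]; linear_combination (-σ * e1) * hp0 + (σ * e0) * hp1
  · rw [hL, hL, hL]
    linear_combination hBc - e0 * hp0 - e1 * hp1 - t * he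
  · rw [hL, hL]; linarith
  · rw [hL, hL]; rw [hg] at hσg; linarith
  · simp only [hL]
    simp
    linear_combination δ * σ ^ 2 * he + δ * hσ
  · simp only [hL]
    simp
    ring

end

noncomputable section

open Set Filter Topology

/-- The product of two sides of a triangle is the height between them times the diameter of its
circumcircle. Hence the height `k - x` is at least `δ ^ 2 / (2 * r)`, which exceeds both `δ / 2` and
`r / 2`. -/
theorem chord_height {k t x y r δ : ℝ} (hδ : 0 < δ) (hr : 0 < r) (hrδ : r < δ)
    (hkt : k ^ 2 + t ^ 2 = r ^ 2) (hxy : x ^ 2 + y ^ 2 = r ^ 2) (hxk : x < k)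
    (hp : δ ^ 2 ≤ (x - k) ^ 2 + (y - t) ^ 2) (hq : δ ^ 2 ≤ (x - k) ^ 2 + (y + t) ^ 2) :
    δ < 2 * (k - x) ∧ -r < 2 * k := by
  have hprod : ((x - k) ^ 2 + (y - t) ^ 2) * ((x - k) ^ 2 + (y + t) ^ 2) =
      (2 * r * (k - x)) ^ 2 := by
    have e1 : (x - k) ^ 2 + (y - t) ^ 2 = 2 * r ^ 2 - 2 * (k * x + t * y) := by
      linear_combination hkt + hxy
    have e2 : (x - k) ^ 2 + (y + t) ^ 2 = 2 * r ^ 2 - 2 * (k * x - t * y) := by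
      linear_combination hkt + hxy
    rw [e1, e2]
    have ht2 : t ^ 2 = r ^ 2 - k ^ 2 := by linarith
    have hy2 : y ^ 2 = r ^ 2 - x ^ 2 := by linarith
    have : (2 * r ^ 2 - 2 * (k * x + t * y)) * (2 * r ^ 2 - 2 * (k * x - t * y)) =
        4 * ((r ^ 2 - k * x) ^ 2 - t ^ 2 * y ^ 2) := by ring
    rw [this, ht2, hy2]
    ring
  have h1 : (δ ^ 2) ^ 2 ≤ (2 * r * (k - x)) ^ 2 := by
    rw [← hprod, pow_two (δ ^ 2)]
    exact mul_le_mul hp hq (by positivity) (by positivity)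
  have h2 : δ ^ 2 ≤ 2 * r * (k - x) :=
    abs_le_of_sq_le_sq' h1 (mul_nonneg (by linarith) (by linarith)) |>.2
  have hxr : -r ≤ x := abs_le_of_sq_le_sq' (by linarith [sq_nonneg y]) hr.le |>.1
  constructor
  · by_contra! h
    have h3 := mul_le_mul_of_nonneg_left h hr.le
    have h4 := mul_lt_mul_of_pos_right hrδ hδ
    linarith
  · by_contra! h
    have h3 : 0 ≤ r * (x + r) := mul_nonneg hr.le (by linarith)
    have h4 : 0 ≤ r * (-r - 2 * k) := mul_nonneg hr.le (by linarith)
    have h5 := pow_lt_pow_left₀ hrδ hr.le two_ne_zero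
    linarith

/-- The right-hand side is `b` times the distance of the blocker `(δ, 0)` from the line through `v`
and `q`. The bound keeps the `δ/2`-disk around the blocker inside the cone at `v`. -/
theorem blocker_depth {k t x y r δ b b' : ℝ} (hδ : 0 < δ) (hr : 0 < r) (hrδ : r < δ) (ht : 0 < t)
    (hkt : k ^ 2 + t ^ 2 = r ^ 2) (hxy : x ^ 2 + y ^ 2 = r ^ 2) (hxk : x < k) (hx0 : x < 0)
    (hb : b ^ 2 = (x - k) ^ 2 + (y + t) ^ 2) (hb' : b' ^ 2 = (x - k) ^ 2 + (y - t) ^ 2)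
    (hδb : δ ≤ b) (hδb' : δ ≤ b') (hk : 2 * δ * k ≤ r ^ 2) :
    b * δ / 2 < t * (δ - x) + y * (δ - k) := by
  have hb0 : 0 < b := hδ.trans_le hδb
  have hb0' : 0 < b' := hδ.trans_le hδb'
  have ht2 : t ^ 2 = r ^ 2 - k ^ 2 := by linarith
  have hy2 : y ^ 2 = r ^ 2 - x ^ 2 := by linarith
  have hprod : b * b' = 2 * r * (k - x) := by
    have : (b * b') ^ 2 = (2 * r * (k - x)) ^ 2 := by
      rw [mul_pow, hb, hb']
      have e1 : (x - k) ^ 2 + (y - t) ^ 2 = 2 * r ^ 2 - 2 * (k * x + t * y) := by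
        linear_combination hkt + hxy
      have e2 : (x - k) ^ 2 + (y + t) ^ 2 = 2 * r ^ 2 - 2 * (k * x - t * y) := by
        linear_combination hkt + hxy
      rw [e1, e2]
      have : (2 * r ^ 2 - 2 * (k * x - t * y)) * (2 * r ^ 2 - 2 * (k * x + t * y)) =
          4 * ((r ^ 2 - k * x) ^ 2 - t ^ 2 * y ^ 2) := by ring
      rw [this, ht2, hy2]
      ring
    exact (pow_left_inj₀ (by positivity) (mul_nonneg (by linarith) (by linarith)) two_ne_zero).1 this
  have hbr : b ≤ 2 * r := by
    refine abs_le_of_sq_le_sq' ?_ (by positivity) |>.2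
    rw [hb]
    linarith [sq_nonneg (x + k), sq_nonneg (y - t)]
  have hh1 : b ≤ 2 * (k - x) := by
    refine le_of_mul_le_mul_left ?_ hr
    have := mul_le_mul_of_nonneg_left (hrδ.le.trans hδb') hb0.le
    linarith
  have hh2 : k - x ≤ b := by
    refine abs_le_of_sq_le_sq' ?_ hb0.le |>.2
    rw [hb]
    linarith [sq_nonneg (y + t)]
  have hr2 : r ^ 2 < δ ^ 2 := pow_lt_pow_left₀ hrδ hr.le two_ne_zero
  have hkδ : k < δ := by
    by_contra! h
    have := mul_le_mul_of_nonneg_left h hδ.le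
    linarith [sq_nonneg δ]
  have hNpos : 0 < t * (δ - x) + y * (δ - k) := by
    have h1 : (y * (δ - k)) ^ 2 < (t * (δ - x)) ^ 2 := by
      rw [mul_pow, mul_pow, ht2, hy2]
      have : (r ^ 2 - k ^ 2) * (δ - x) ^ 2 - (r ^ 2 - x ^ 2) * (δ - k) ^ 2 =
          (k - x) * (2 * δ * r ^ 2 - (r ^ 2 + δ ^ 2) * (k + x) + 2 * δ * k * x) := by ring
      have hbr : 0 < 2 * δ * r ^ 2 - (r ^ 2 + δ ^ 2) * (k + x) + 2 * δ * k * x := by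
        refine pos_of_mul_pos_right (a := 2 * δ) ?_ (by positivity)
        have g1 : 0 ≤ (r ^ 2 - 2 * δ * k) * (r ^ 2 + δ ^ 2 - 2 * δ * x) :=
          mul_nonneg (by linarith) (by
            linarith [sq_nonneg r, sq_nonneg δ, mul_pos hδ (neg_pos.2 hx0)])
        have g2 : 0 ≤ r ^ 2 * (δ ^ 2 - r ^ 2) := mul_nonneg (sq_nonneg r) (by linarith)
        have g3 : 0 < δ ^ 2 * r ^ 2 := by positivity
        have g4 : 0 < δ ^ 3 * (-x) := mul_pos (by positivity) (by linarith)
        linarith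
      have := mul_pos (sub_pos.2 hxk) hbr
      linarith
    have h2 := abs_lt_of_sq_lt_sq' h1 (mul_nonneg ht.le (by linarith))
    linarith [h2.1]
  -- Lagrange's identity for the vectors from `q` to the blocker and from `v` to `q`: cross product
  -- squared plus inner product squared. The inner product is at most `b * δ / 2` in absolute value,
  -- so the cross product is large.
  have hG : (t * (δ - x) + y * (δ - k)) ^ 2 + (δ * (k - x) - b ^ 2 / 2) ^ 2 =
      b ^ 2 * ((δ - k) ^ 2 + t ^ 2) := by
    have e : δ * (k - x) - b ^ 2 / 2 = (δ - k) * (k - x) - t * (t + y) := by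
      rw [hb]; linear_combination (hkt - hxy) / 2
    rw [e, hb]
    ring
  have hz : δ ^ 2 ≤ (δ - k) ^ 2 + t ^ 2 := by linarith
  have hGb : (δ * (k - x) - b ^ 2 / 2) ^ 2 ≤ (b * δ / 2) ^ 2 := by
    refine sq_le_sq' ?_ ?_
    · have := mul_le_mul_of_nonneg_left hh1 hδ.le
      have := mul_le_mul_of_nonneg_left hbr hb0.le
      have := mul_le_mul_of_nonneg_left hrδ.le hb0.le
      linarith
    · have := mul_le_mul_of_nonneg_left hh2 hδ.le
      have := mul_le_mul_of_nonneg_left hδb hb0.le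
      linarith
  have hfin : (b * δ / 2) ^ 2 < (t * (δ - x) + y * (δ - k)) ^ 2 := by
    have := mul_le_mul_of_nonneg_left hz (sq_nonneg b)
    have : 0 < (b * δ) ^ 2 := by positivity
    linarith
  exact abs_lt_of_sq_lt_sq' hfin hNpos.le |>.2

/-- Here `vpq` is the already shrunken triangle, so the old triangle is `α + β ≤ 10` in the cone at
`v`. The first group of properties lets the blocker coexist with the other base points, its
`δ/2`-disk lying inside the old triangle; the last one is what it is made for. `Z` is empty when the
ends of the chord already cover the cap. -/
theorem exists_blocker {δ r : ℝ} {v p q c : Plane} (hδ : 0 < δ) (hrδ : r < δ) (hv : dist v c = r)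
    (hp : dist p c = r) (hq : dist q c = r) (hvp : δ ≤ dist v p) (hvq : δ ≤ dist v q)
    (hpq : δ ≤ dist p q) :
    ∃ Z : Set Plane, Z.Subsingleton ∧
      (∀ z ∈ Z, r < dist z c ∧ dist z v < 2 * δ ∧ δ ≤ dist z v ∧
        (∀ s : ℝ, (s = 1 ∨ δ ≤ (s - 1) * dist p v) → δ ≤ dist z (v + s • (p - v))) ∧
        (∀ s : ℝ, (s = 1 ∨ δ ≤ (s - 1) * dist q v) → δ ≤ dist z (v + s • (q - v))) ∧
        (∀ Y, dist Y z < δ / 2 → ∃ α β : ℝ, 0 < α ∧ 0 < β ∧ α + β < 10 ∧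
          Y = v + α • (p - v) + β • (q - v)) ∧
        (∀ α β : ℝ, 10 ≤ α + β → δ ≤ dist (v + α • (p - v) + β • (q - v)) z)) ∧
      (∀ (α β : ℝ) (Y : Plane), 0 ≤ α → 0 ≤ β → Y = v + α • (p - v) + β • (q - v) → dist Y c ≤ r →
        δ ≤ dist Y v → δ ≤ dist Y p → δ ≤ dist Y q → ¬ ∀ z ∈ Z, δ ≤ dist Y z) := by
  have nvp : v ≠ p := dist_pos.1 (hδ.trans_le hvp)
  have nvq : v ≠ q := dist_pos.1 (hδ.trans_le hvq)
  have npq : p ≠ q := dist_pos.1 (hδ.trans_le hpq)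
  have hr0 : 0 < r := by
    have h := dist_triangle_right v p c
    linarith
  obtain ⟨A, B, z, hAB, hApq, hBpq, hBp, hAv, hAz, hBz⟩ := exists_frame (δ := δ) hv hp hq nvp nvq npq
  obtain ⟨k, hk⟩ : ∃ k, k = A p - A c := ⟨_, rfl⟩
  obtain ⟨t, ht⟩ : ∃ t, t = B p - B c := ⟨_, rfl⟩
  obtain ⟨x, hx⟩ : ∃ x, x = A v - A c := ⟨_, rfl⟩
  obtain ⟨y, hy⟩ : ∃ y, y = B v - B c := ⟨_, rfl⟩
  have Ap : A p = A c + k := by linarith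
  have Aq : A q = A c + k := by linarith
  have Av : A v = A c + x := by linarith
  have Bp : B p = B c + t := by linarith
  have Bq : B q = B c - t := by linarith
  have Bv : B v = B c + y := by linarith
  have ht0 : 0 < t := by linarith
  have hxk : x < k := by linarith
  have hkt : k ^ 2 + t ^ 2 = r ^ 2 := by
    have := hAB p c; rw [hp, Ap, Bp] at this; linarith
  have hxy : x ^ 2 + y ^ 2 = r ^ 2 := by
    have := hAB v c; rw [hv, Av, Bv] at this; linarith
  have hb' : dist p v ^ 2 = (x - k) ^ 2 + (y - t) ^ 2 := by
    rw [hAB, Ap, Bp, Av, Bv]; ring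
  have hb : dist q v ^ 2 = (x - k) ^ 2 + (y + t) ^ 2 := by
    rw [hAB, Aq, Bq, Av, Bv]; ring
  have hδb' : δ ≤ dist p v := by rwa [dist_comm]
  have hδb : δ ≤ dist q v := by rwa [dist_comm]
  obtain ⟨hh, hkr⟩ := chord_height hδ hr0 hrδ hkt hxy hxk
    (hb' ▸ pow_le_pow_left₀ hδ.le hδb' 2) (hb ▸ pow_le_pow_left₀ hδ.le hδb 2)
  -- Up to the side lengths, the numerators are the signed distances of `Y` from the sides at `v`,
  -- the quantities bounded in `blocker_depth`.
  have hcoord : ∀ Y, ∃ α β : ℝ, 2 * t * (k - x) * α = t * (A Y - A v) + (B Y - B v) * (k - x) +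
      y * (A Y - A v) ∧ 2 * t * (k - x) * β = t * (A Y - A v) - (B Y - B v) * (k - x) -
      y * (A Y - A v) ∧ (k - x) * (α + β) = A Y - A v ∧ Y = v + α • (p - v) + β • (q - v) := by
    intro Y
    have hne : k - x ≠ 0 := by linarith
    refine ⟨(t * (A Y - A v) + (B Y - B v) * (k - x) + y * (A Y - A v)) / (2 * t * (k - x)),
      (t * (A Y - A v) - (B Y - B v) * (k - x) - y * (A Y - A v)) / (2 * t * (k - x)), ?_, ?_, ?_, ?_⟩
    · field_simp
    · field_simp
    · field_simp; ring
    · rw [← dist_eq_zero, ← pow_eq_zero_iff two_ne_zero, hAB]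
      simp only [map_add, map_smul, map_sub, smul_eq_mul]
      rw [Ap, Aq, Av, Bp, Bq, Bv]
      field_simp
      ring
  have hzc : dist z c ^ 2 = δ ^ 2 := by rw [hAB, hAz, hBz]; ring
  have hzc' : dist z c = δ := (pow_left_inj₀ dist_nonneg hδ.le two_ne_zero).1 hzc
  have hcover : ∀ (α β : ℝ) (Y : Plane), 0 ≤ α → 0 ≤ β → Y = v + α • (p - v) + β • (q - v) →
      dist Y c ≤ r → δ ≤ dist Y v → δ ≤ dist Y p → δ ≤ dist Y q →
      2 * δ * k ≤ r ^ 2 ∧ dist Y z < δ := by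
    intro α β Y hα hβ hY hYc hYv hYp hYq
    have hA : A Y - A c = x + (α + β) * (k - x) := by
      rw [hY]; simp only [map_add, map_smul, map_sub, smul_eq_mul]; rw [Ap, Aq, Av]; ring
    have hB : B Y - B c = y + α * (t - y) + β * (-t - y) := by
      rw [hY]; simp only [map_add, map_smul, map_sub, smul_eq_mul]; rw [Bp, Bq, Bv]; ring
    obtain ⟨a, ha⟩ : ∃ a, a = A Y - A c := ⟨_, rfl⟩
    obtain ⟨b, hb⟩ : ∃ b, b = B Y - B c := ⟨_, rfl⟩
    have AY : A Y = A c + a := by linarith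
    have BY : B Y = B c + b := by linarith
    rw [← ha] at hA
    rw [← hb] at hB
    have d0 := pow_le_pow_left₀ dist_nonneg hYc 2
    have d1 := pow_le_pow_left₀ hδ.le hYv 2
    have d2 := pow_le_pow_left₀ hδ.le hYp 2
    have d3 := pow_le_pow_left₀ hδ.le hYq 2
    rw [hAB, AY, BY] at d0 d1 d2 d3
    rw [Av, Bv] at d1
    rw [Ap, Bp] at d2
    rw [Aq, Bq] at d3
    have hab : a ^ 2 + b ^ 2 ≤ r ^ 2 := by linarith
    -- Otherwise `Y` lies in the triangle, and the weighted mean of its squared distances to the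
    -- vertices is at most `r ^ 2 < δ ^ 2`; so some vertex would be too close.
    have hka : k ≤ a := by
      by_contra! h
      have hσ : α + β ≤ 1 := by
        by_contra! h'
        have := mul_lt_mul_of_pos_right h' (by linarith : 0 < k - x)
        linarith
      have g1 := mul_le_mul_of_nonneg_left d1 (by linarith : 0 ≤ 1 - α - β)
      have g2 := mul_le_mul_of_nonneg_left d2 hα
      have g3 := mul_le_mul_of_nonneg_left d3 hβ
      have hr2 : r ^ 2 < δ ^ 2 := pow_lt_pow_left₀ hrδ hr0.le two_ne_zero
      have id1 : (1 - α - β) * (A c + a - (A c + x)) ^ 2 + α * (A c + a - (A c + k)) ^ 2 +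
          β * (A c + a - (A c + k)) ^ 2 =
          (1 - α - β) * x ^ 2 + (α + β) * k ^ 2 - a ^ 2 + 2 * a * (a - (x + (α + β) * (k - x))) := by
        ring
      have id2 : (1 - α - β) * (B c + b - (B c + y)) ^ 2 + α * (B c + b - (B c + t)) ^ 2 +
          β * (B c + b - (B c - t)) ^ 2 =
          (1 - α - β) * y ^ 2 + (α + β) * t ^ 2 - b ^ 2 +
            2 * b * (b - (y + α * (t - y) + β * (-t - y))) := by
        ring
      rw [← hA, sub_self, mul_zero] at id1
      rw [← hB, sub_self, mul_zero] at id2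
      have id3 : (1 - α - β) * x ^ 2 + (α + β) * k ^ 2 + ((1 - α - β) * y ^ 2 + (α + β) * t ^ 2) =
          r ^ 2 := by linear_combination (1 - α - β) * hxy + (α + β) * hkt
      linarith [sq_nonneg a, sq_nonneg b]
    have hcap : 2 * δ * k ≤ r ^ 2 ∧ (a - δ) ^ 2 + |b| ^ 2 < δ ^ 2 := by
      refine cap_covered hδ hr0 hrδ ht0 hkt hkr hka (abs_nonneg b) (by rwa [sq_abs]) ?_
      rcases abs_cases b with ⟨h, -⟩ | ⟨h, -⟩
      · rw [h]; linarith
      · rw [h]; linarith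
    refine ⟨hcap.1, ?_⟩
    refine abs_lt_of_sq_lt_sq' ?_ hδ.le |>.2
    rw [hAB, AY, BY, hAz, hBz]
    rw [sq_abs] at hcap
    linarith [hcap.2]
  by_cases hval : 2 * δ * k ≤ r ^ 2
  · have hr2 : r ^ 2 < δ ^ 2 := pow_lt_pow_left₀ hrδ hr0.le two_ne_zero
    have h2k : 2 * k < δ := by
      by_contra! h
      have := mul_le_mul_of_nonneg_left h hδ.le
      linarith
    have hx0 : x < 0 := by linarith
    have hdp := blocker_depth hδ hr0 hrδ ht0 hkt hxy hxk hx0 hb hb' hδb hδb' hval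
    have hdq := blocker_depth (y := -y) hδ hr0 hrδ ht0 hkt (by linarith) hxk hx0
      (b := dist p v) (b' := dist q v) (by linarith) (by linarith) hδb' hδb hval
    have hzp : δ ≤ dist z p := by
      refine abs_le_of_sq_le_sq' ?_ dist_nonneg |>.2
      rw [hAB, hAz, hBz, Ap, Bp]; linarith
    have hzq : δ ≤ dist z q := by
      refine abs_le_of_sq_le_sq' ?_ dist_nonneg |>.2
      rw [hAB, hAz, hBz, Aq, Bq]; linarith
    refine ⟨{z}, Set.subsingleton_singleton, ?_, ?_⟩
    · intro z' hz'
      rw [Set.mem_singleton_iff.1 hz']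
      refine ⟨by rwa [hzc'], ?_, ?_, ?_, ?_, ?_, ?_⟩
      · have := dist_triangle_right z v c
        linarith
      · refine abs_le_of_sq_le_sq' ?_ dist_nonneg |>.2
        rw [hAB, hAz, hBz, Av, Bv]
        linarith [mul_pos hδ (neg_pos.2 hx0), sq_nonneg r]
      · rintro s (rfl | hs)
        · simpa using hzp
        · exact le_dist_ray hδ (hv.trans hp.symm) hzc'.le hδb' hzp hs
      · rintro s (rfl | hs)
        · simpa using hzq
        · exact le_dist_ray hδ (hv.trans hq.symm) hzc'.le hδb hzq hs
      · intro Y hY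
        obtain ⟨α, β, hα, hβ, hσ, hYe⟩ := hcoord Y
        have hY2 : (A Y - A z) ^ 2 + (B Y - B z) ^ 2 < (δ / 2) ^ 2 := by
          rw [← hAB]; exact pow_lt_pow_left₀ hY dist_nonneg two_ne_zero
        obtain ⟨a, ha⟩ : ∃ a, a = A Y - A z := ⟨_, rfl⟩
        obtain ⟨b, hbb⟩ : ∃ b, b = B Y - B z := ⟨_, rfl⟩
        rw [← ha, ← hbb] at hY2
        have AY : A Y = A c + δ + a := by linarith
        have BY : B Y = B c + b := by linarith
        have hpos : 0 < 2 * t * (k - x) := mul_pos (by linarith) (by linarith)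
        have cs : ∀ (d e f : ℝ), 0 ≤ d → d ^ 2 = e ^ 2 + f ^ 2 → -(d * δ / 2) ≤ a * e + b * f := by
          intro d e f hd hdef
          refine abs_le_of_sq_le_sq' ?_ (by positivity) |>.1
          have h1 := mul_le_mul_of_nonneg_left hY2.le (sq_nonneg d)
          have h2 := sq_nonneg (a * f - b * e)
          have h3 : d ^ 2 * (a ^ 2 + b ^ 2) = (e ^ 2 + f ^ 2) * (a ^ 2 + b ^ 2) := by rw [hdef]
          linarith
        refine ⟨α, β, ?_, ?_, ?_, hYe⟩
        · refine pos_of_mul_pos_right (a := 2 * t * (k - x)) ?_ hpos.le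
          rw [hα, AY, BY, Av, Bv]
          have := cs (dist q v) (t + y) (k - x) dist_nonneg (by rw [hb]; ring)
          linarith
        · refine pos_of_mul_pos_right (a := 2 * t * (k - x)) ?_ hpos.le
          rw [hβ, AY, BY, Av, Bv]
          have := cs (dist p v) (t - y) (-(k - x)) dist_nonneg (by rw [hb']; ring)
          linarith
        · have ha2 : a ≤ δ / 2 := abs_le_of_sq_le_sq' (by linarith [sq_nonneg b]) (by linarith) |>.2
          refine lt_of_mul_lt_mul_left ?_ (by linarith : 0 ≤ k - x)
          rw [hσ, AY, Av]
          linarith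
      · intro α β hαβ
        refine abs_le_of_sq_le_sq' ?_ dist_nonneg |>.2
        rw [hAB]
        have hge : δ ≤ A (v + α • (p - v) + β • (q - v)) - A z := by
          simp only [map_add, map_smul, map_sub, smul_eq_mul]
          rw [Ap, Aq, Av, hAz]
          have := mul_le_mul_of_nonneg_right hαβ (by linarith : 0 ≤ k - x)
          linarith
        have := pow_le_pow_left₀ hδ.le hge 2
        linarith [sq_nonneg (B (v + α • (p - v) + β • (q - v)) - B z)]
    · intro α β Y hα hβ hY hYc hYv hYp hYq hcon
      exact absurd (hcon z rfl) (not_le.2 (hcover α β Y hα hβ hY hYc hYv hYp hYq).2)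
  · refine ⟨∅, Set.subsingleton_empty, fun z hz => absurd hz (Set.notMem_empty z), ?_⟩
    intro α β Y hα hβ hY hYc hYv hYp hYq _
    exact hval (hcover α β Y hα hβ hY hYc hYv hYp hYq).1

end

noncomputable section

open Set Filter Topology

/-! ### Barycentric coordinates in a triangle -/

theorem exists_third {t : Finset Plane} (ht : t.card = 3) {a b : Plane} (ha : a ∈ t) (hb : b ∈ t)
    (hab : a ≠ b) : ∃ q, q ∈ t ∧ a ≠ q ∧ b ≠ q ∧ t = {a, b, q} := by
  classical
  have hb' : b ∈ t.erase a := Finset.mem_erase.2 ⟨hab.symm, hb⟩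
  have h1 : ((t.erase a).erase b).card = 1 := by
    rw [Finset.card_erase_of_mem hb', Finset.card_erase_of_mem ha, ht]
  obtain ⟨q, hq⟩ := Finset.card_eq_one.1 h1
  have hqm : q ∈ (t.erase a).erase b := by rw [hq]; simp
  simp only [Finset.mem_erase] at hqm
  refine ⟨q, hqm.2.2, hqm.2.1.symm, hqm.1.symm, ?_⟩
  rw [← Finset.insert_erase ha, ← Finset.insert_erase hb', hq]

theorem exists_other_two {t : Finset Plane} (ht : t.card = 3) {a : Plane} (ha : a ∈ t) :
    ∃ b q, b ∈ t ∧ q ∈ t ∧ a ≠ b ∧ a ≠ q ∧ b ≠ q ∧ t = {a, b, q} := by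
  classical
  obtain ⟨b, hb⟩ : (t.erase a).Nonempty := by
    rw [← Finset.card_pos, Finset.card_erase_of_mem ha, ht]; norm_num
  rw [Finset.mem_erase] at hb
  obtain ⟨q, hq, h1, h2, h3⟩ := exists_third ht ha hb.2 hb.1.symm
  exact ⟨b, q, hb.2, hq, hb.1.symm, h1, h2, h3⟩

theorem exists_weights_triple {v w q : Plane} (hvw : v ≠ w) (hvq : v ≠ q) (hwq : w ≠ q) (a b : ℝ) :
    ∃ g : Plane → ℝ, g v = 1 - a - b ∧ g w = a ∧ g q = b ∧
      ∑ y ∈ ({v, w, q} : Finset Plane), g y = 1 ∧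
      ∑ y ∈ ({v, w, q} : Finset Plane), g y • y = v + a • (w - v) + b • (q - v) := by
  classical
  refine ⟨fun y => if y = v then 1 - a - b else if y = w then a else b, ?_, ?_, ?_, ?_, ?_⟩
  · simp
  · simp [hvw.symm]
  · simp [hvq.symm, hwq.symm]
  · rw [Finset.sum_insert (by simp [hvw, hvq]), Finset.sum_pair hwq]
    simp [hvw.symm, hvq.symm, hwq.symm]
  · rw [Finset.sum_insert (by simp [hvw, hvq]), Finset.sum_pair hwq]
    simp only [if_true, hvw.symm, hvq.symm, hwq.symm, if_false]
    module

theorem mem_convexHull_triple {v w q Y : Plane} (hvw : v ≠ w) (hvq : v ≠ q) (hwq : w ≠ q) :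
    Y ∈ convexHull ℝ ((({v, w, q} : Finset Plane)) : Set Plane) ↔
      ∃ a b : ℝ, 0 ≤ a ∧ 0 ≤ b ∧ a + b ≤ 1 ∧ Y = v + a • (w - v) + b • (q - v) := by
  classical
  rw [Finset.mem_convexHull']
  constructor
  · rintro ⟨g, h0, h1, h2⟩
    rw [Finset.sum_insert (by simp [hvw, hvq]), Finset.sum_pair hwq] at h1 h2
    refine ⟨g w, g q, h0 w (by simp), h0 q (by simp), ?_, ?_⟩
    · linarith [h0 v (by simp)]
    · rw [← h2, show g v = 1 - g w - g q by linarith]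
      module
  · rintro ⟨a, b, ha, hb, hab, rfl⟩
    obtain ⟨g, gv, gw, gq, h1, h2⟩ := exists_weights_triple hvw hvq hwq a b
    refine ⟨g, ?_, h1, h2⟩
    intro y hy
    simp only [Finset.mem_insert, Finset.mem_singleton] at hy
    rcases hy with rfl | rfl | rfl
    · linarith
    · linarith
    · linarith

theorem carrier_triple {K : PlaneComplex} {v w q : Plane} (hvw : v ≠ w) (hvq : v ≠ q) (hwq : w ≠ q)
    (ht : ({v, w, q} : Finset Plane) ∈ K.faces) {t' : Finset Plane} (ht' : t' ∈ K.faces)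
    {a b : ℝ} (ha : 0 ≤ a) (hb : 0 ≤ b) (hab : a + b ≤ 1)
    (hY : v + a • (w - v) + b • (q - v) ∈ convexHull ℝ (t' : Set Plane)) :
    (a + b < 1 → v ∈ t') ∧ (0 < a → w ∈ t') ∧ (0 < b → q ∈ t') := by
  classical
  obtain ⟨g, gv, gw, gq, h1, h2⟩ := exists_weights_triple hvw hvq hwq a b
  have h0 : ∀ y ∈ ({v, w, q} : Finset Plane), 0 ≤ g y := by
    intro y hy
    simp only [Finset.mem_insert, Finset.mem_singleton] at hy
    rcases hy with rfl | rfl | rfl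
    · linarith
    · linarith
    · linarith
  refine ⟨fun h => ?_, fun h => ?_, fun h => ?_⟩
  · exact carrier_subset ht ht' h1 h0 h2 hY (by simp) (by rw [gv]; linarith)
  · exact carrier_subset ht ht' h1 h0 h2 hY (by simp) (by rw [gw]; linarith)
  · exact carrier_subset ht ht' h1 h0 h2 hY (by simp) (by rw [gq]; linarith)

theorem carrier_pair {K : PlaneComplex} {u w : Plane} (huw : u ≠ w)
    (he : ({u, w} : Finset Plane) ∈ K.faces) {t' : Finset Plane} (ht' : t' ∈ K.faces)
    {s : ℝ} (hs0 : 0 < s) (hs1 : s < 1)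
    (hY : u + s • (w - u) ∈ convexHull ℝ (t' : Set Plane)) : u ∈ t' ∧ w ∈ t' := by
  classical
  have h1 : ∑ y ∈ ({u, w} : Finset Plane), (if y = u then 1 - s else s) = 1 := by
    rw [Finset.sum_pair huw]; simp [huw.symm]
  have h2 : ∑ y ∈ ({u, w} : Finset Plane), (if y = u then 1 - s else s) • y = u + s • (w - u) := by
    rw [Finset.sum_pair huw]
    simp only [if_true, huw.symm, if_false]
    module
  have h0 : ∀ y ∈ ({u, w} : Finset Plane), 0 ≤ (if y = u then 1 - s else s) := by
    intro y _
    split_ifs <;> linarith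
  constructor
  · exact carrier_subset he ht' h1 h0 h2 hY (by simp) (by simp; linarith)
  · exact carrier_subset he ht' h1 h0 h2 hY (by simp) (by simp [huw.symm]; linarith)

/-- Side lengths and circumdisk of a triangle of a Delaunay triangulation of a Gromov set. -/
theorem triangle_data {ε : ℝ} {S : Set Plane} {K : PlaneComplex}
    (hK : IsDelaunayTriangulation K S) (hS : IsNet ε ε S) {t : Finset Plane} (ht : IsTriangle K t) :
    (∀ a ∈ t, ∀ b ∈ t, a ≠ b → ε ≤ dist a b) ∧
    ∃ (C : Plane) (R : ℝ), (∀ p ∈ t, dist p C = R) ∧ (∀ x ∈ S, R ≤ dist x C) ∧ R < ε ∧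
      (∀ a ∈ t, ∀ b ∈ t, a ≠ b → R ≤ dist a b) := by
  have h1 : ∀ a ∈ t, ∀ b ∈ t, a ≠ b → ε ≤ dist a b := fun a ha b hb hab =>
    hS.2.1 a (hK.face_subset ht.1 ha) b (hK.face_subset ht.1 hb) hab
  obtain ⟨C, R, hC, hR, -, hlt⟩ := hK.exists_circumcircle hS ht
  exact ⟨h1, C, R, hC, hR, hlt, fun a ha b hb hab => hlt.le.trans (h1 a ha b hb hab)⟩

/-- The height of a triangle is at least half the adjacent sides. -/
theorem le_dist_line {ε : ℝ} {S : Set Plane} {K : PlaneComplex}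
    (hK : IsDelaunayTriangulation K S) (hS : IsNet ε ε S) {t : Finset Plane} (ht : IsTriangle K t)
    {u w q : Plane} (hu : u ∈ t) (hw : w ∈ t) (hq : q ∈ t) (huq : u ≠ q) (hwq : w ≠ q) (σ τ : ℝ) :
    |σ| * dist u w / 2 ≤ dist (w + σ • (u - w)) (w + τ • (q - w)) := by
  obtain ⟨-, C, R, hC, -, -, hR⟩ := triangle_data hK hS ht
  exact le_dist_of_cocircular (hC u hu) (hC w hw) (hC q hq) (hR u hu q hq huq) hwq huq σ τ

/-- Every point lies in the cone of some triangle at a given vertex. -/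
theorem exists_cone {ε : ℝ} {S : Set Plane} {K : PlaneComplex}
    (hK : IsDelaunayTriangulation K S) (hS : IsNet ε ε S) {v : Plane} (hv : v ∈ S) (Y : Plane) :
    ∃ t, IsTriangle K t ∧ ∃ w q, v ∈ t ∧ w ∈ t ∧ q ∈ t ∧ v ≠ w ∧ v ≠ q ∧ w ≠ q ∧ t = {v, w, q} ∧
      ∃ a b : ℝ, 0 ≤ a ∧ 0 ≤ b ∧ Y = v + a • (w - v) + b • (q - v) := by
  obtain ⟨t₀, ht₀, hvt₀, hf⟩ := hK.exists_triangle_towards hS v Y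
  have hv0 : v ∈ t₀ :=
    (K.vertex_mem_convexHull_iff (by rw [hK.1.1]; exact hv) ht₀.1).1 hvt₀
  obtain ⟨w, q, hw, hq, hvw, hvq, hwq, rfl⟩ := exists_other_two ht₀.2 hv0
  obtain ⟨e, hmem, he⟩ := (hf.and_eventually self_mem_nhdsWithin).exists
  have he : 0 < e := he
  obtain ⟨a, b, ha, hb, -, hab⟩ := (mem_convexHull_triple hvw hvq hwq).1 hmem
  refine ⟨_, ht₀, w, q, hv0, hw, hq, hvw, hvq, hwq, rfl, a / e, b / e, by positivity, by positivity,
    ?_⟩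
  have h1 : e • (Y - v) = a • (w - v) + b • (q - v) := by
    rw [add_assoc] at hab; exact add_left_cancel hab
  have h2 : Y - v = e⁻¹ • (a • (w - v) + b • (q - v)) := by
    rw [← h1, smul_smul, inv_mul_cancel₀ he.ne', one_smul]
  rw [eq_add_of_sub_eq' h2, smul_add, smul_smul, smul_smul, add_assoc, div_eq_inv_mul,
    div_eq_inv_mul]

/-- A triangle that meets a small disk around a vertex contains that vertex. -/
theorem mem_of_dist_vertex {ε : ℝ} {S : Set Plane} {K : PlaneComplex}
    (hK : IsDelaunayTriangulation K S) (hS : IsNet ε ε S) {v Y : Plane} (hv : v ∈ S)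
    (hY : dist v Y < ε / 2) {t : Finset Plane} (ht : IsTriangle K t)
    (hYt : Y ∈ convexHull ℝ (t : Set Plane)) : v ∈ t := by
  obtain ⟨_, ht₀, w, q, hv0, hw, hq, hvw, hvq, hwq, rfl, a, b, ha, hb, hYe⟩ := exists_cone hK hS hv Y
  -- Beyond the opposite side, `Y` would be at least a height away from `v`, hence at least half of
  -- a side.
  have hlt : a + b < 1 := by
    by_contra! hge
    have := le_dist_line hK hS ht₀ hv0 hw hq hvq hwq (a + b) b
    have e1 : dist (w + (a + b) • (v - w)) (w + b • (q - w)) = dist v Y := by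
      rw [dist_eq_norm, dist_eq_norm, hYe]
      congr 1
      module
    rw [e1, abs_of_nonneg (by positivity)] at this
    have h2 := hS.2.1 v hv w (hK.face_subset ht₀.1 hw) hvw
    have h3 := mul_le_mul hge h2 hS.1.le (by positivity)
    linarith
  exact (carrier_triple hvw hvq hwq ht₀.1 ht.1 ha hb hlt.le (hYe ▸ hYt)).1 hlt

/-- A triangle that meets a small disk around an inner point of an edge contains that edge. -/
theorem mem_of_dist_edge {ε ρ : ℝ} {S : Set Plane} {K : PlaneComplex}
    (hK : IsDelaunayTriangulation K S) (hS : IsNet ε ε S) {u w Y : Plane} (huw : u ≠ w)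
    (he : ({u, w} : Finset Plane) ∈ K.faces) {s : ℝ} (hs0 : 0 < s) (hs1 : s < 1)
    (h0 : ρ ≤ s * dist u w) (h1 : ρ ≤ (1 - s) * dist u w)
    (hY : dist (u + s • (w - u)) Y < ρ / 2) {t : Finset Plane} (ht : IsTriangle K t)
    (hYt : Y ∈ convexHull ℝ (t : Set Plane)) : u ∈ t ∧ w ∈ t := by
  obtain ⟨t₀, ht₀, hvt₀, hf⟩ := hK.exists_triangle_towards hS (u + s • (w - u)) Y
  obtain ⟨hu0, hw0⟩ := carrier_pair huw he ht₀.1 hs0 hs1 hvt₀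
  obtain ⟨q, hq, huq, hwq, rfl⟩ := exists_third ht₀.2 hu0 hw0 huw
  obtain ⟨e, hmem, he0⟩ := (hf.and_eventually self_mem_nhdsWithin).exists
  have he0 : 0 < e := he0
  obtain ⟨a, b, ha, hb, -, hab⟩ := (mem_convexHull_triple huw huq hwq).1 hmem
  have hYe : Y = u + (s + (a - s) / e) • (w - u) + (b / e) • (q - u) := by
    have h1 : e • (Y - (u + s • (w - u))) = (a - s) • (w - u) + b • (q - u) := by
      have := sub_eq_of_eq_add' (by rw [hab, add_assoc] :
        u + s • (w - u) + e • (Y - (u + s • (w - u))) = u + (a • (w - u) + b • (q - u)))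
      have h2 : e • (Y - (u + s • (w - u))) =
          u + (a • (w - u) + b • (q - u)) - (u + s • (w - u)) := by
        rw [← this]; abel_nf
      rw [h2]; module
    have h2 : Y - (u + s • (w - u)) = e⁻¹ • ((a - s) • (w - u) + b • (q - u)) := by
      rw [← h1, smul_smul, inv_mul_cancel₀ he0.ne', one_smul]
    rw [eq_add_of_sub_eq' h2, smul_add, smul_smul, smul_smul, div_eq_inv_mul,
      div_eq_inv_mul]
    module
  have hb' : 0 ≤ b / e := by positivity
  generalize s + (a - s) / e = a at *
  generalize b / e = b at *
  -- If `Y` were across the side `uq`, the point of the edge would be at least half its distance to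
  -- `u` away from `Y`, the sine of the angle at `u` being at least `1/2`. The side `wq` is treated
  -- in the same way below.
  have hapos : 0 < a := by
    by_contra! hle
    have := le_dist_line hK hS ht₀ hw0 hu0 hq hwq huq (s - a) b
    have e1 : dist (u + (s - a) • (w - u)) (u + b • (q - u)) = dist (u + s • (w - u)) Y := by
      rw [dist_eq_norm, dist_eq_norm, hYe]
      congr 1
      module
    rw [e1, abs_of_nonneg (by linarith), dist_comm w u] at this
    have h3 := mul_le_mul_of_nonneg_right (by linarith : s ≤ s - a) (dist_nonneg (x := u) (y := w))
    linarith
  have hlt : a + b < 1 := by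
    by_contra! hge
    have := le_dist_line hK hS ht₀ hu0 hw0 hq huq hwq ((1 - s) - (1 - a - b)) b
    have e1 : dist (w + ((1 - s) - (1 - a - b)) • (u - w)) (w + b • (q - w)) =
        dist (u + s • (w - u)) Y := by
      rw [dist_eq_norm, dist_eq_norm, hYe]
      congr 1
      module
    rw [e1, abs_of_nonneg (by linarith)] at this
    have h3 := mul_le_mul_of_nonneg_right (by linarith : 1 - s ≤ (1 - s) - (1 - a - b))
      (dist_nonneg (x := u) (y := w))
    linarith
  have := carrier_triple huw huq hwq ht₀.1 ht.1 hapos.le hb' hlt.le (hYe ▸ hYt)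
  exact ⟨this.1 hlt, this.2.1 hapos⟩

end

noncomputable section

open Set Filter Topology

/-! ### Subdivision parameters of an edge -/

/-- The parameters in `[0, 1]` of the subdivision points of an edge of length `L`: the end points,
the points at one tenth from them, and an equal subdivision of the rest in pieces of length about
`δ`. -/
def edgeParam (δ L : ℝ) : Set ℝ :=
  {s | s = 0 ∨ s = 1 ∨ ∃ j : ℕ, j ≤ ⌊4 / 5 * L / δ⌋₊ ∧ s = 1 / 10 + 4 / 5 * (j / ⌊4 / 5 * L / δ⌋₊)}

/-- The middle part has length at least `8 * δ`, so it is cut into `n ≥ 8` pieces, and rounding down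
stretches `δ` by a factor at most `(n + 1) / n ≤ 9 / 8`. -/
theorem edgeParam_gap {δ L : ℝ} (hδ : 0 < δ) (hL : 10 * δ ≤ L) :
    0 < (⌊4 / 5 * L / δ⌋₊ : ℝ) ∧ δ ≤ 4 / 5 / ⌊4 / 5 * L / δ⌋₊ * L ∧
      4 / 5 / ⌊4 / 5 * L / δ⌋₊ * L ≤ 9 / 8 * δ := by
  have h8 : 8 ≤ ⌊4 / 5 * L / δ⌋₊ := by
    rw [Nat.le_floor_iff' (by norm_num), le_div_iff₀ hδ]
    push_cast; linarith
  have h8' : (8 : ℝ) ≤ ⌊4 / 5 * L / δ⌋₊ := by exact_mod_cast h8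
  have hLpos : 0 < L := by linarith
  have h1 := Nat.floor_le (show 0 ≤ 4 / 5 * L / δ by positivity)
  have h2 := Nat.lt_floor_add_one (4 / 5 * L / δ)
  rw [le_div_iff₀ hδ] at h1
  rw [div_lt_iff₀ hδ] at h2
  generalize (⌊4 / 5 * L / δ⌋₊ : ℝ) = n at *
  have hn : 0 < n := by linarith
  refine ⟨hn, ?_, ?_⟩
  · rw [div_mul_eq_mul_div, le_div_iff₀ hn]; linarith
  · rw [div_mul_eq_mul_div, div_le_iff₀ hn]
    have := mul_le_mul_of_nonneg_right h8' hδ.le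
    linarith

theorem zero_mem_edgeParam (δ L : ℝ) : (0 : ℝ) ∈ edgeParam δ L := Or.inl rfl

theorem one_mem_edgeParam (δ L : ℝ) : (1 : ℝ) ∈ edgeParam δ L := Or.inr (Or.inl rfl)

theorem tenth_mem_edgeParam (δ L : ℝ) : (1 / 10 : ℝ) ∈ edgeParam δ L :=
  Or.inr (Or.inr ⟨0, Nat.zero_le _, by simp⟩)

theorem one_sub_mem_edgeParam {δ L : ℝ} (hδ : 0 < δ) (hL : 10 * δ ≤ L) {s : ℝ}
    (hs : s ∈ edgeParam δ L) : 1 - s ∈ edgeParam δ L := by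
  have hn := (edgeParam_gap hδ hL).1
  rcases hs with rfl | rfl | ⟨j, hj, rfl⟩
  · right; left; ring
  · left; ring
  · right; right
    refine ⟨⌊4 / 5 * L / δ⌋₊ - j, Nat.sub_le _ _, ?_⟩
    rw [Nat.cast_sub hj]
    generalize (⌊4 / 5 * L / δ⌋₊ : ℝ) = n at hn ⊢
    field_simp
    ring

theorem edgeParam_mem_Icc {δ L : ℝ} {s : ℝ} (hs : s ∈ edgeParam δ L) : 0 ≤ s ∧ s ≤ 1 := by
  rcases hs with rfl | rfl | ⟨j, hj, rfl⟩
  · simp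
  · simp
  · have h1 : (j : ℝ) / ⌊4 / 5 * L / δ⌋₊ ≤ 1 := div_le_one_of_le₀ (by exact_mod_cast hj) (by positivity)
    have h2 : 0 ≤ (j : ℝ) / ⌊4 / 5 * L / δ⌋₊ := by positivity
    constructor <;> linarith

/-- These are the alternatives under which `le_dist_ray` and `IsBlocker.le_dist_adjacent` apply. -/
theorem edgeParam_cases {δ L : ℝ} (hδ : 0 < δ) (hL : 10 * δ ≤ L) {s : ℝ}
    (hs : s ∈ edgeParam δ L) : s = 0 ∨ s = 1 / 10 ∨ δ ≤ (s - 1 / 10) * L := by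
  obtain ⟨hn, hg, -⟩ := edgeParam_gap hδ hL
  rcases hs with rfl | rfl | ⟨j, hj, rfl⟩
  · exact Or.inl rfl
  · right; right; linarith
  · right
    rcases Nat.eq_zero_or_pos j with rfl | hj0
    · left; simp
    · right
      have : (1 : ℝ) ≤ j := by exact_mod_cast hj0
      have h2 := mul_le_mul_of_nonneg_right this (hδ.le.trans hg)
      have e : (1 / 10 + 4 / 5 * ((j : ℝ) / ⌊4 / 5 * L / δ⌋₊) - 1 / 10) * L =
          j * (4 / 5 / ⌊4 / 5 * L / δ⌋₊ * L) := by ring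
      rw [e]
      linarith

theorem edgeParam_separated {δ L : ℝ} (hδ : 0 < δ) (hL : 10 * δ ≤ L) {s s' : ℝ}
    (hs : s ∈ edgeParam δ L) (hs' : s' ∈ edgeParam δ L) (hne : s ≠ s') : δ ≤ |s - s'| * L := by
  obtain ⟨hn, hg, -⟩ := edgeParam_gap hδ hL
  have h1 : ∀ {s}, s ∈ edgeParam δ L → s ≠ 0 → δ ≤ |s - 0| * L := by
    intro s hs h0
    rw [sub_zero, abs_of_nonneg (edgeParam_mem_Icc hs).1]
    rcases edgeParam_cases hδ hL hs with h | h | h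
    · exact absurd h h0
    · rw [h]; linarith
    · linarith
  have h2 : ∀ {s}, s ∈ edgeParam δ L → s ≠ 1 → δ ≤ |s - 1| * L := by
    intro s hs h0
    have := h1 (one_sub_mem_edgeParam hδ hL hs) (by intro h; exact h0 (by linarith))
    rwa [sub_zero, abs_sub_comm] at this
  rcases hs with rfl | rfl | ⟨j, hj, rfl⟩
  · rw [abs_sub_comm]; exact h1 hs' hne.symm
  · rw [abs_sub_comm]; exact h2 hs' hne.symm
  · have hs : 1 / 10 + 4 / 5 * ((j : ℝ) / ⌊4 / 5 * L / δ⌋₊) ∈ edgeParam δ L := Or.inr (Or.inr ⟨j, hj, rfl⟩)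
    rcases hs' with rfl | rfl | ⟨j', hj', rfl⟩
    · exact h1 hs hne
    · exact h2 hs hne
    · have hjj : (j : ℤ) - j' ≠ 0 := by
        intro h
        apply hne
        have : j = j' := by omega
        rw [this]
      have hc : (1 : ℝ) ≤ |(j : ℝ) - j'| := by
        have := Int.one_le_abs hjj
        exact_mod_cast this
      have h3 := mul_le_mul_of_nonneg_right hc (hδ.le.trans hg)
      have e : |1 / 10 + 4 / 5 * ((j : ℝ) / ⌊4 / 5 * L / δ⌋₊) -
          (1 / 10 + 4 / 5 * ((j' : ℝ) / ⌊4 / 5 * L / δ⌋₊))| =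
          |(j : ℝ) - j'| * (4 / 5 / ⌊4 / 5 * L / δ⌋₊) := by
        rw [← abs_of_nonneg (show 0 ≤ 4 / 5 / (⌊4 / 5 * L / δ⌋₊ : ℝ) by positivity), ← abs_mul]
        congr 1
        ring
      rw [e, mul_assoc]
      linarith

/-- Two consecutive parameters around a given one. -/
theorem exists_edgeParam_around {δ L : ℝ} (hδ : 0 < δ) (hL : 10 * δ ≤ L) {s : ℝ} (h0 : 0 ≤ s)
    (h1 : s ≤ 1) : ∃ s₁ ∈ edgeParam δ L, ∃ s₂ ∈ edgeParam δ L, s₁ ≤ s ∧ s ≤ s₂ ∧ s₁ < s₂ ∧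
      (s₁ = 0 ∧ s₂ = 1 / 10 ∨ s₁ = 9 / 10 ∧ s₂ = 1 ∨
        1 / 10 ≤ s₁ ∧ s₂ ≤ 9 / 10 ∧ (s₂ - s₁) * L ≤ 9 / 8 * δ) := by
  obtain ⟨hn, hg, hg2⟩ := edgeParam_gap hδ hL
  have h9 : (9 / 10 : ℝ) ∈ edgeParam δ L := by
    have := one_sub_mem_edgeParam hδ hL (tenth_mem_edgeParam δ L)
    norm_num at this; exact this
  rcases lt_or_ge s (1 / 10) with hs | hs
  · exact ⟨0, zero_mem_edgeParam δ L, 1 / 10, tenth_mem_edgeParam δ L, h0, hs.le, by norm_num,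
      Or.inl ⟨rfl, rfl⟩⟩
  rcases le_or_gt (9 / 10) s with hs' | hs'
  · exact ⟨9 / 10, h9, 1, one_mem_edgeParam δ L, hs', h1, by norm_num, Or.inr (Or.inl ⟨rfl, rfl⟩)⟩
  obtain ⟨n, hndef⟩ : ∃ n, n = ⌊4 / 5 * L / δ⌋₊ := ⟨_, rfl⟩
  rw [← hndef] at hn hg hg2
  -- The position of `s` counted in middle pieces; its integer part is the index of the piece.
  obtain ⟨x, hx⟩ : ∃ x, x = (s - 1 / 10) * (5 / 4) * n := ⟨_, rfl⟩
  have hx0 : 0 ≤ x := by rw [hx]; exact mul_nonneg (mul_nonneg (by linarith) (by norm_num)) hn.le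
  have hxn : x < n := by
    rw [hx]
    calc _ < 1 * (n : ℝ) := mul_lt_mul_of_pos_right (by linarith) hn
      _ = n := one_mul _
  have hfl := Nat.floor_le hx0
  have hfl2 := Nat.lt_floor_add_one x
  have hj : ⌊x⌋₊ < n := (Nat.floor_lt hx0).2 hxn
  have hs_eq : s = 1 / 10 + 4 / 5 * (x / n) := by rw [hx]; field_simp; ring
  refine ⟨1 / 10 + 4 / 5 * ((⌊x⌋₊ : ℕ) / n), Or.inr (Or.inr ⟨⌊x⌋₊, ?_, ?_⟩),
    1 / 10 + 4 / 5 * (((⌊x⌋₊ + 1 : ℕ) : ℝ) / n), Or.inr (Or.inr ⟨⌊x⌋₊ + 1, ?_, ?_⟩),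
    ?_, ?_, ?_, Or.inr (Or.inr ⟨?_, ?_, ?_⟩)⟩
  · rw [← hndef]; exact hj.le
  · rw [← hndef]
  · rw [← hndef]; exact hj
  · rw [← hndef]
  · rw [hs_eq]; gcongr
  · conv_lhs => rw [hs_eq]
    push_cast; gcongr
  · push_cast; gcongr; linarith
  · have : (0 : ℝ) ≤ (⌊x⌋₊ : ℕ) / n := by positivity
    linarith
  · have : ((⌊x⌋₊ + 1 : ℕ) : ℝ) / n ≤ 1 := div_le_one_of_le₀ (by exact_mod_cast hj) hn.le
    linarith
  · refine le_trans (le_of_eq ?_) hg2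
    push_cast; ring

/-! ### The base set -/

theorem exists_triangle_of_edge {ε : ℝ} {S : Set Plane} {K : PlaneComplex}
    (hK : IsDelaunayTriangulation K S) (hS : IsNet ε ε S) {u w : Plane} (huw : u ≠ w)
    (he : ({u, w} : Finset Plane) ∈ K.faces) : ∃ t, IsTriangle K t ∧ u ∈ t ∧ w ∈ t := by
  obtain ⟨t, ht, hx⟩ := hK.exists_triangle_mem hS (u + (1 / 2 : ℝ) • (w - u))
  exact ⟨t, ht, carrier_pair huw he ht.1 (by norm_num) (by norm_num) hx⟩

/-! ### Shrinking at a vertex, and blockers -/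

/-- The homothety of ratio `1/10` centred at `v`. -/
def shrink (v X : Plane) : Plane := v + (1 / 10 : ℝ) • (X - v)

theorem dist_shrink (v X Y : Plane) : dist (shrink v X) (shrink v Y) = dist X Y / 10 := by
  rw [dist_eq_norm, dist_eq_norm, shrink, shrink, add_sub_add_left_eq_sub, ← smul_sub,
    sub_sub_sub_cancel_right, norm_smul]
  norm_num
  ring

theorem shrink_self (v : Plane) : shrink v v = v := by simp [shrink]

theorem shrink_sub (v X : Plane) : shrink v X - v = (1 / 10 : ℝ) • (X - v) := by simp [shrink]

theorem dist_shrink_left (v X : Plane) : dist (shrink v X) v = dist X v / 10 := by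
  rw [← dist_shrink v X v, shrink_self]

/-- The set `Z` has at most one point, chosen so that separation from `Z` and from the star of `v`
keeps points out of the shrunken circumdisk of the triangle `t`. -/
structure IsBlocker (δ : ℝ) (v : Plane) (t : Finset Plane) (Z : Set Plane) : Prop where
  subsingleton : Z.Subsingleton
  notMem_disk : ∀ z ∈ Z, ∀ (C : Plane) (R : ℝ), (∀ p ∈ t, dist p C = R) →
    R / 10 < dist z (shrink v C)
  dist_lt : ∀ z ∈ Z, dist z v < 2 * δ
  le_dist_adjacent : ∀ z ∈ Z, ∀ w ∈ t, w ≠ v → ∀ s : ℝ,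
    (s = 0 ∨ s = 1 / 10 ∨ δ ≤ (s - 1 / 10) * dist v w) → δ ≤ dist z (v + s • (w - v))
  le_dist_opposite : ∀ z ∈ Z, ∀ a ∈ t, ∀ b ∈ t, a ≠ v → b ≠ v → a ≠ b → ∀ s : ℝ,
    δ ≤ dist (a + s • (b - a)) z
  interior : ∀ z ∈ Z, ∀ Y, dist Y z < δ / 2 → ∃ g : Plane → ℝ, (∀ y ∈ t, 0 < g y) ∧
    ∑ y ∈ t, g y = 1 ∧ ∑ y ∈ t, g y • y = Y
  cover : ∀ (C : Plane) (R : ℝ), (∀ p ∈ t, dist p C = R) → ∀ w ∈ t, ∀ q ∈ t, w ≠ v → q ≠ v →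
    w ≠ q → ∀ a b : ℝ, 0 ≤ a → 0 ≤ b →
    dist (v + a • (w - v) + b • (q - v)) (shrink v C) ≤ R / 10 →
    (∀ p ∈ t, δ ≤ dist (v + a • (w - v) + b • (q - v)) (shrink v p)) →
    ¬ ∀ z ∈ Z, δ ≤ dist (v + a • (w - v) + b • (q - v)) z

theorem exists_isBlocker {δ : ℝ} (hδ : 0 < δ) {S : Set Plane} {K : PlaneComplex}
    (hK : IsDelaunayTriangulation K S) (hS : IsNet (10 * δ) (10 * δ) S) {t : Finset Plane}
    (ht : IsTriangle K t) {v : Plane} (hv : v ∈ t) : ∃ Z, IsBlocker δ v t Z := by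
  classical
  obtain ⟨hd, C, R, hC, -, hR, -⟩ := triangle_data hK hS ht
  obtain ⟨w, q, hw, hq, hvw, hvq, hwq, htri⟩ := exists_other_two ht.2 hv
  have huniq : ∀ (C' : Plane) (R' : ℝ), (∀ p ∈ t, dist p C' = R') → C' = C ∧ R' = R := by
    intro C' R' h
    have : C' = C := by
      by_contra hne
      have := card_le_two_of_mem_two_circles (t := t) (c := C') (c' := C) (ρ := R' ^ 2)
        (ρ' := R ^ 2) (fun y hy => by rw [h y hy]) (fun y hy => by rw [hC y hy]) hne
      have := ht.2
      omega
    refine ⟨this, ?_⟩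
    rw [← h v hv, ← hC v hv, this]
  obtain ⟨Z, hZ1, hZ2, hZ3⟩ := exists_blocker (δ := δ) (r := R / 10) (v := v) (p := shrink v w)
    (q := shrink v q) (c := shrink v C) hδ (by linarith)
    (by rw [dist_comm, dist_shrink_left, dist_comm, hC v hv])
    (by rw [dist_shrink, hC w hw]) (by rw [dist_shrink, hC q hq])
    (by rw [dist_comm, dist_shrink_left]; linarith [hd w hw v hv hvw.symm])
    (by rw [dist_comm, dist_shrink_left]; linarith [hd q hq v hv hvq.symm])
    (by rw [dist_shrink]; linarith [hd w hw q hq hwq])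
  simp only [shrink_sub, smul_smul, dist_shrink_left] at hZ2 hZ3
  have hmem : ∀ x ∈ t, x ≠ v → x = w ∨ x = q := by
    intro x hx hxv
    rw [htri] at hx
    simpa [hxv] using hx
  refine ⟨Z, hZ1, ?_, fun z hz => (hZ2 z hz).2.1, ?_, ?_, ?_, ?_⟩
  · intro z hz C' R' h
    obtain ⟨rfl, rfl⟩ := huniq C' R' h
    exact (hZ2 z hz).1
  · intro z hz x hx hxv s hs
    obtain ⟨-, -, h0, h1, h2, -, -⟩ := hZ2 z hz
    rcases hs with rfl | hs
    · simpa using h0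
    -- Parameter `s` on the old side is parameter `10 * s` on the shrunken one.
    have hs' : 10 * s = 1 ∨ δ ≤ (10 * s - 1) * (dist x v / 10) := by
      rcases hs with rfl | hs
      · left; norm_num
      · right; rw [dist_comm] at hs; linarith
    rcases hmem x hx hxv with rfl | rfl
    · have := h1 (10 * s) hs'
      rwa [show 10 * s * (1 / 10) = s by ring] at this
    · have := h2 (10 * s) hs'
      rwa [show 10 * s * (1 / 10) = s by ring] at this
  · intro z hz a ha b hb hav hbv hab s
    obtain ⟨-, -, -, -, -, -, h⟩ := hZ2 z hz
    rcases hmem a ha hav with rfl | rfl <;> rcases hmem b hb hbv with rfl | rfl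
    · exact absurd rfl hab
    · have := h (10 * (1 - s)) (10 * s) (by linarith)
      convert this using 2
      module
    · have := h (10 * s) (10 * (1 - s)) (by linarith)
      convert this using 2
      module
    · exact absurd rfl hab
  · intro z hz Y hY
    obtain ⟨-, -, -, -, -, h, -⟩ := hZ2 z hz
    obtain ⟨α, β, hα, hβ, hαβ, hYe⟩ := h Y hY
    obtain ⟨g, gv, gw, gq, h1, h2⟩ := exists_weights_triple hvw hvq hwq (α * (1 / 10)) (β * (1 / 10))
    rw [← htri] at h1 h2
    refine ⟨g, ?_, h1, by rw [h2, hYe]⟩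
    intro y hy
    by_cases hyv : y = v
    · rw [hyv, gv]; linarith
    · rcases hmem y hy hyv with rfl | rfl
      · rw [gw]; positivity
      · rw [gq]; positivity
  · intro C' R' h w' hw' q' hq' hw'v hq'v hwq' a b ha hb hdist hfar
    obtain ⟨rfl, rfl⟩ := huniq C' R' h
    have hfv := hfar v hv
    rw [shrink_self] at hfv
    rcases hmem w' hw' hw'v with rfl | rfl <;> rcases hmem q' hq' hq'v with rfl | rfl
    · exact absurd rfl hwq'
    · refine hZ3 (10 * a) (10 * b) _ (by positivity) (by positivity) ?_ hdist hfv (hfar _ hw')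
        (hfar _ hq')
      module
    · refine hZ3 (10 * b) (10 * a) _ (by positivity) (by positivity) ?_ hdist hfv (hfar _ hq')
        (hfar _ hw')
      module
    · exact absurd rfl hwq'

open Classical in
/-- A chosen blocker for the vertex `v` of the triangle `t`. -/
def blocker (δ : ℝ) (v : Plane) (t : Finset Plane) : Set Plane :=
  if h : ∃ Z, IsBlocker δ v t Z then h.choose else ∅

theorem isBlocker_blocker {δ : ℝ} (hδ : 0 < δ) {S : Set Plane} {K : PlaneComplex}
    (hK : IsDelaunayTriangulation K S) (hS : IsNet (10 * δ) (10 * δ) S) {t : Finset Plane}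
    (ht : IsTriangle K t) {v : Plane} (hv : v ∈ t) : IsBlocker δ v t (blocker δ v t) := by
  have h := exists_isBlocker hδ hK hS ht hv
  rw [blocker, dif_pos h]
  exact h.choose_spec

/-! ### Separation of the base set, in one triangle and globally -/

/-- The subdivision points of the edges of `t` and the blockers in `t`. -/
def localBase (δ : ℝ) (t : Finset Plane) : Set Plane :=
  {x | (∃ u ∈ t, ∃ w ∈ t, u ≠ w ∧ ∃ s ∈ edgeParam δ (dist u w), x = u + s • (w - u)) ∨
    ∃ v ∈ t, x ∈ blocker δ v t}

/-- The points prescribed for the refined set. -/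
def baseSet (δ : ℝ) (K : PlaneComplex) : Set Plane := ⋃ t ∈ {t | IsTriangle K t}, localBase δ t

theorem localBase_separated {δ : ℝ} (hδ : 0 < δ) {S : Set Plane} {K : PlaneComplex}
    (hK : IsDelaunayTriangulation K S) (hS : IsNet (10 * δ) (10 * δ) S) {t : Finset Plane}
    (ht : IsTriangle K t) : EtaSeparated δ (localBase δ t) := by
  obtain ⟨hd, C, R, hC, -, hR, hRd⟩ := triangle_data hK hS ht
  have flip : ∀ {u w x : Plane}, u ∈ t → w ∈ t → u ≠ w →
      (∃ s ∈ edgeParam δ (dist u w), x = u + s • (w - u)) →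
      ∃ s ∈ edgeParam δ (dist w u), x = w + s • (u - w) := by
    rintro u w x hu hw huw ⟨s, hs, rfl⟩
    refine ⟨1 - s, ?_, by module⟩
    rw [dist_comm]
    exact one_sub_mem_edgeParam hδ (hd u hu w hw huw) hs
  have same : ∀ {u w : Plane}, u ∈ t → w ∈ t → u ≠ w → ∀ s ∈ edgeParam δ (dist u w),
      ∀ s' ∈ edgeParam δ (dist u w), u + s • (w - u) ≠ u + s' • (w - u) →
      δ ≤ dist (u + s • (w - u)) (u + s' • (w - u)) := by
    intro u w hu hw huw s hs s' hs' hne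
    have h1 := edgeParam_separated hδ (hd u hu w hw huw) hs hs' (by rintro rfl; exact hne rfl)
    rwa [dist_add_left, dist_eq_norm, ← sub_smul, norm_smul, Real.norm_eq_abs, ← dist_eq_norm,
      dist_comm w u]
  -- On two sides at `v`: two points at one tenth are a shrunken side apart; one at one tenth and
  -- one farther out are handled by `le_dist_ray` in the shrunken circle; if both are farther out,
  -- they are at least `2 * δ` from `v` and the sine of the angle is at least `1/2`.
  have adj : ∀ {v w q : Plane}, v ∈ t → w ∈ t → q ∈ t → v ≠ w → v ≠ q → w ≠ q →
      ∀ s ∈ edgeParam δ (dist v w), ∀ s' ∈ edgeParam δ (dist v q), s' = 0 ∨ s' = 1 / 10 ∨ 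
      δ ≤ (s' - 1 / 10) * dist v q → s ≠ 0 → s' ≠ 0 → (s = 1 / 10 ∨ δ ≤ (s - 1 / 10) * dist v w) →
      (s = 1 / 10 ∨ s' ≠ 1 / 10) →
      δ ≤ dist (v + s • (w - v)) (v + s' • (q - v)) := by
    intro v w q hv hw hq hvw hvq hwq s hs s' hs' hcs' hs0 hs0' hcs hss
    have h1 := hd v hv w hw hvw
    have h2 := hd v hv q hq hvq
    rcases hcs with rfl | hcs
    · rcases hcs'.resolve_left hs0' with rfl | hcs'
      · rw [← shrink, ← shrink, dist_shrink]
        linarith [hd w hw q hq hwq]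
      · have := le_dist_ray (v := v) (q := shrink v q) (c := shrink v C) (y := shrink v w) (δ := δ)
          (s := 10 * s') hδ
          (by rw [dist_comm, dist_shrink_left, dist_shrink, hC q hq, dist_comm, hC v hv])
          (by rw [dist_shrink, hC w hw]; linarith)
          (by rw [dist_shrink_left, dist_comm]; linarith)
          (by rw [dist_shrink]; linarith [hd w hw q hq hwq])
          (by rw [dist_shrink_left, dist_comm]; linarith)
        rwa [shrink_sub, smul_smul, show 10 * s' * (1 / 10) = s' by ring] at this
    · have := le_dist_line hK hS ht hw hv hq hwq hvq s s'
      rw [abs_of_nonneg (edgeParam_mem_Icc hs).1, dist_comm w v] at this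
      refine le_trans ?_ this
      linarith
  have adj' : ∀ {v w q : Plane}, v ∈ t → w ∈ t → q ∈ t → v ≠ w → v ≠ q → w ≠ q →
      ∀ s ∈ edgeParam δ (dist v w), ∀ s' ∈ edgeParam δ (dist v q),
      v + s • (w - v) ≠ v + s' • (q - v) → δ ≤ dist (v + s • (w - v)) (v + s' • (q - v)) := by
    intro v w q hv hw hq hvw hvq hwq s hs s' hs' hne
    have c1 := edgeParam_cases hδ (hd v hv w hw hvw) hs
    have c2 := edgeParam_cases hδ (hd v hv q hq hvq) hs'
    by_cases hs0 : s = 0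
    · rw [hs0, zero_smul] at hne ⊢
      have := same hv hq hvq 0 (zero_mem_edgeParam _ _) s' hs'
      rw [zero_smul] at this
      exact this hne
    by_cases hs0' : s' = 0
    · rw [hs0', zero_smul] at hne ⊢
      have := same hv hw hvw s hs 0 (zero_mem_edgeParam _ _)
      rw [zero_smul] at this
      exact this hne
    by_cases hss : s = 1 / 10 ∨ s' ≠ 1 / 10
    · exact adj hv hw hq hvw hvq hwq s hs s' hs' c2 hs0 hs0' (c1.resolve_left hs0) hss
    · push Not at hss
      rw [dist_comm]
      exact adj hv hq hw hvq hvw hwq.symm s' hs' s hs c1 hs0' hs0 (c2.resolve_left hs0')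
        (Or.inl hss.2)
  have blockEdge : ∀ v ∈ t, ∀ z ∈ blocker δ v t, ∀ u ∈ t, ∀ w ∈ t, u ≠ w →
      ∀ s ∈ edgeParam δ (dist u w), δ ≤ dist z (u + s • (w - u)) := by
    intro v hv z hz u hu w hw huw s hs
    have hb := isBlocker_blocker hδ hK hS ht hv
    by_cases huv : u = v
    · subst huv
      exact hb.le_dist_adjacent z hz w hw huw.symm s (edgeParam_cases hδ (hd u hu w hw huw) hs)
    by_cases hwv : w = v
    · subst hwv
      obtain ⟨s', hs', e⟩ := flip hu hw huw ⟨s, hs, rfl⟩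
      rw [e]
      exact hb.le_dist_adjacent z hz u hu huw s' (edgeParam_cases hδ (hd w hw u hu huw.symm) hs')
    · rw [dist_comm]
      exact hb.le_dist_opposite z hz u hu w hw huv hwv huw s
  rintro x hx x' hx' hne
  rcases hx with ⟨u, hu, w, hw, huw, hs⟩ | ⟨v, hv, hz⟩
  · rcases hx' with ⟨u', hu', w', hw', huw', hs'⟩ | ⟨v', hv', hz'⟩
    · obtain ⟨q, hq, huq, hwq, htri⟩ := exists_third ht.2 hu hw huw
      have key : ∀ {u w q : Plane}, u ∈ t → w ∈ t → q ∈ t → u ≠ w → u ≠ q → w ≠ q →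
          (∃ s ∈ edgeParam δ (dist u w), x = u + s • (w - u)) →
          (∃ s ∈ edgeParam δ (dist u q), x' = u + s • (q - u)) → δ ≤ dist x x' := by
        rintro u w q hu hw hq huw huq hwq ⟨s, h1, rfl⟩ ⟨s', h2, rfl⟩
        exact adj' hu hw hq huw huq hwq s h1 s' h2 hne
      have key2 : ∀ {u w : Plane}, u ∈ t → w ∈ t → u ≠ w →
          (∃ s ∈ edgeParam δ (dist u w), x = u + s • (w - u)) →
          (∃ s ∈ edgeParam δ (dist u w), x' = u + s • (w - u)) → δ ≤ dist x x' := by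
        rintro u w hu hw huw ⟨s, h1, rfl⟩ ⟨s', h2, rfl⟩
        exact same hu hw huw s h1 s' h2 hne
      have hu'' := hu'
      have hw'' := hw'
      rw [htri] at hu'' hw''
      simp only [Finset.mem_insert, Finset.mem_singleton] at hu'' hw''
      rcases hu'' with rfl | rfl | rfl <;> rcases hw'' with rfl | rfl | rfl
      · exact absurd rfl huw'
      · exact key2 hu hw huw hs hs'
      · exact key hu hw hq huw huq hwq hs hs'
      · exact key2 hu hw huw hs (flip hu' hw' huw' hs')
      · exact absurd rfl huw'
      · exact key hw hu hq huw.symm hwq huq (flip hu hw huw hs) hs'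
      · exact key hu hw hq huw huq hwq hs (flip hu' hw' huw' hs')
      · exact key hw hu hq huw.symm hwq huq (flip hu hw huw hs) (flip hu' hw' huw' hs')
      · exact absurd rfl huw'
    · obtain ⟨s, hs, rfl⟩ := hs
      rw [dist_comm]
      exact blockEdge v' hv' x' hz' u hu w hw huw s hs
  · rcases hx' with ⟨u', hu', w', hw', huw', s, hs, rfl⟩ | ⟨v', hv', hz'⟩
    · exact blockEdge v hv x hz u' hu' w' hw' huw' s hs
    · by_cases hvv : v = v'
      · subst hvv
        exact absurd ((isBlocker_blocker hδ hK hS ht hv).subsingleton hz hz') hne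
      -- Blockers of different vertices stay within `2 * δ` of vertices that are `10 * δ` apart.
      · have h1 := (isBlocker_blocker hδ hK hS ht hv).dist_lt x hz
        have h2 := (isBlocker_blocker hδ hK hS ht hv').dist_lt x' hz'
        have h3 := hd v hv v' hv' hvv
        have h4 := dist_triangle4 v x x' v'
        rw [dist_comm v x] at h4
        linarith

/-- The `δ/2`-disk around a base point stays in the star of the vertex, edge or triangle that the
point belongs to. This reduces separation to a single triangle. -/
theorem mem_localBase_of_near {δ : ℝ} (hδ : 0 < δ) {S : Set Plane} {K : PlaneComplex}
    (hK : IsDelaunayTriangulation K S) (hS : IsNet (10 * δ) (10 * δ) S) {x Y : Plane}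
    (hx : x ∈ baseSet δ K) (hY : dist x Y < δ / 2) {t : Finset Plane} (ht : IsTriangle K t)
    (hYt : Y ∈ convexHull ℝ (t : Set Plane)) : x ∈ localBase δ t := by
  classical
  have vertex : ∀ v ∈ S, dist v Y < δ / 2 → v ∈ localBase δ t := by
    intro v hv hvY
    have hvt := mem_of_dist_vertex hK hS hv (by linarith) ht hYt
    obtain ⟨w, -, hw, -, hvw, -⟩ := exists_other_two ht.2 hvt
    exact Or.inl ⟨v, hvt, w, hw, hvw, 0, zero_mem_edgeParam _ _, by simp⟩
  obtain ⟨t₀, ht₀, hx0⟩ := Set.mem_iUnion₂.1 hx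
  have ht₀ : IsTriangle K t₀ := ht₀
  rcases hx0 with ⟨u, hu, w, hw, huw, s, hs, rfl⟩ | ⟨v, hv, hz⟩
  · have hL := (triangle_data hK hS ht₀).1 u hu w hw huw
    by_cases hs0 : s = 0
    · rw [hs0, zero_smul, add_zero] at hY ⊢
      exact vertex u (hK.face_subset ht₀.1 hu) hY
    by_cases hs1 : s = 1
    · rw [hs1, one_smul, add_sub_cancel] at hY ⊢
      exact vertex w (hK.face_subset ht₀.1 hw) hY
    have hI := edgeParam_mem_Icc hs
    have h0 := edgeParam_separated hδ hL hs (zero_mem_edgeParam _ _) hs0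
    have h1 := edgeParam_separated hδ hL (one_mem_edgeParam _ _) hs (Ne.symm hs1)
    rw [sub_zero, abs_of_nonneg hI.1] at h0
    rw [abs_of_nonneg (by linarith [hI.2])] at h1
    have he : ({u, w} : Finset Plane) ∈ K.faces :=
      K.down_closed ht₀.1 (by intro y hy; simp at hy; rcases hy with rfl | rfl <;> assumption)
        ⟨u, by simp⟩
    obtain ⟨hut, hwt⟩ := mem_of_dist_edge hK hS huw he (lt_of_le_of_ne hI.1 (Ne.symm hs0))
      (lt_of_le_of_ne hI.2 hs1) h0 h1 hY ht hYt
    exact Or.inl ⟨u, hut, w, hwt, huw, s, hs, rfl⟩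
  · obtain ⟨g, hg, h1, h2⟩ := (isBlocker_blocker hδ hK hS ht₀ hv).interior x hz Y
      (by rwa [dist_comm])
    have hsub : t₀ ⊆ t := fun y hy =>
      carrier_subset ht₀.1 ht.1 h1 (fun y hy => (hg y hy).le) h2 hYt hy (hg y hy).ne'
    have : t₀ = t := Finset.eq_of_subset_of_card_le hsub (by rw [ht.2, ht₀.2])
    subst this
    exact Or.inr ⟨v, hv, hz⟩

/-- Two base points closer than `δ` are both near their midpoint, hence both belong to a triangle
containing it, where `localBase_separated` applies. -/
theorem baseSet_separated {δ : ℝ} (hδ : 0 < δ) {S : Set Plane} {K : PlaneComplex}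
    (hK : IsDelaunayTriangulation K S) (hS : IsNet (10 * δ) (10 * δ) S) :
    EtaSeparated δ (baseSet δ K) := by
  intro x hx x' hx' hne
  by_contra! hlt
  obtain ⟨t, ht, hY⟩ := hK.exists_triangle_mem hS (midpoint ℝ x x')
  have h1 : dist x (midpoint ℝ x x') < δ / 2 := by
    rw [dist_left_midpoint]; norm_num; linarith
  have h2 : dist x' (midpoint ℝ x x') < δ / 2 := by
    rw [dist_comm, dist_midpoint_right]; norm_num; linarith
  have := localBase_separated hδ hK hS ht x (mem_localBase_of_near hδ hK hS hx h1 ht hY) x'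
    (mem_localBase_of_near hδ hK hS hx' h2 ht hY) hne
  linarith

end

noncomputable section

open Set Filter Topology

/-! ### The star of an old vertex in the refined triangulation -/

theorem exists_coords {v p q c : Plane} {r : ℝ} (hv : dist v c = r) (hp : dist p c = r)
    (hq : dist q c = r) (hvp : v ≠ p) (hvq : v ≠ q) (hpq : p ≠ q) (Y : Plane) :
    ∃ α β : ℝ, Y = v + α • (p - v) + β • (q - v) := by
  obtain ⟨A, B, -, hAB, hApq, hBpq, hBp, hAv, -, -⟩ := exists_frame (δ := 0) hv hp hq hvp hvq hpq
  have hT : B p - B q ≠ 0 := by linarith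
  have hh : A q - A v ≠ 0 := by linarith
  refine ⟨(B Y - B v - (A Y - A v) / (A q - A v) * (B q - B v)) / (B p - B q),
    (A Y - A v) / (A q - A v) -
      (B Y - B v - (A Y - A v) / (A q - A v) * (B q - B v)) / (B p - B q), ?_⟩
  rw [← dist_eq_zero, ← pow_eq_zero_iff two_ne_zero, hAB]
  simp only [map_add, map_smul, map_sub, smul_eq_mul, hApq]
  field_simp
  ring

/-- A point on the circle of a triangle, beyond the side `pq` as seen from `v`, lies in the cone
at `v`. -/
theorem nonneg_coord_of_beyond {v p q c : Plane} {r : ℝ} (hv : dist v c = r) (hp : dist p c = r)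
    (hq : dist q c = r) (hvp : v ≠ p) (hvq : v ≠ q) (hpq : p ≠ q) {α β : ℝ}
    (hY : dist (v + α • (p - v) + β • (q - v)) c = r) (hαβ : 1 < α + β) : 0 ≤ β := by
  classical
  by_contra! hβ
  have hα : 0 < α := by linarith
  obtain ⟨g, gv, gp, gq, h1, h2⟩ := exists_weights_triple hvp hvq hpq α β
  -- As all points are on the circle, the weighted sum of squared distances to `Y` vanishes; the
  -- same identity centred at `p` would then make the squared distance from `Y` to `p` negative.
  have e1 := sum_mul_dist_sq h1 h2 c
  have e2 := sum_mul_dist_sq h1 h2 p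
  rw [Finset.sum_insert (by simp [hvp, hvq]), Finset.sum_pair hpq] at e1 e2
  rw [Finset.sum_insert (by simp [hvp, hvq]), Finset.sum_pair hpq, gv, gp, gq] at e1 e2
  rw [hv, hp, hq, hY] at e1
  rw [dist_self] at e2
  have p1 : 0 < dist v p ^ 2 := pow_pos (dist_pos.2 hvp) 2
  have p2 : 0 ≤ dist q p ^ 2 := sq_nonneg _
  have m1 : 0 < (α + β - 1) * dist v p ^ 2 := mul_pos (by linarith) p1
  have m2 : 0 ≤ -β * dist q p ^ 2 := mul_nonneg (by linarith) p2
  have p3 := sq_nonneg (dist (v + α • (p - v) + β • (q - v)) p)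
  linarith

section Refinement

variable {δ : ℝ} {S S' : Set Plane} {K : PlaneComplex}

theorem shrink_mem_baseSet {t : Finset Plane} (ht : IsTriangle K t) {v : Plane} (hv : v ∈ t)
    {p : Plane} (hp : p ∈ t) : shrink v p ∈ baseSet δ K := by
  refine Set.mem_biUnion (show t ∈ {t | IsTriangle K t} from ht) (Or.inl ?_)
  by_cases h : p = v
  · obtain ⟨w, -, hw, -, hvw, -⟩ := exists_other_two ht.2 hv
    refine ⟨v, hv, w, hw, hvw, 0, zero_mem_edgeParam _ _, ?_⟩
    rw [h, shrink_self]; simp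
  · exact ⟨v, hv, p, hp, Ne.symm h, 1 / 10, tenth_mem_edgeParam _ _, rfl⟩

/-- A point of `S'` that is no shrunken vertex is `δ`-far from the shrunken vertices and, being in
the disk, differs from the blocker and is `δ`-far from it too. `IsBlocker.cover` excludes this. -/
theorem mem_star_of_mem_cone (hδ : 0 < δ) (hK : IsDelaunayTriangulation K S)
    (hS : IsNet (10 * δ) (10 * δ) S) (hS' : EtaSeparated δ S') (hB : baseSet δ K ⊆ S')
    {t : Finset Plane} (ht : IsTriangle K t) {v w q C : Plane} {R : ℝ} (hC : ∀ p ∈ t, dist p C = R)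
    (hv : v ∈ t) (hw : w ∈ t) (hq : q ∈ t) (hvw : v ≠ w) (hvq : v ≠ q) (hwq : w ≠ q) {a b : ℝ}
    (ha : 0 ≤ a) (hb : 0 ≤ b) (hmem : v + a • (w - v) + b • (q - v) ∈ S')
    (hd : dist (v + a • (w - v) + b • (q - v)) (shrink v C) ≤ R / 10) :
    ∃ p ∈ t, v + a • (w - v) + b • (q - v) = shrink v p := by
  by_contra! hne
  have hbl := isBlocker_blocker hδ hK hS ht hv
  refine hbl.cover C R hC w hw q hq hvw.symm hvq.symm hwq a b ha hb hd ?_ ?_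
  · exact fun p hp => hS' _ hmem _ (hB (shrink_mem_baseSet ht hv hp)) (hne p hp)
  · intro z hz
    refine hS' _ hmem _ (hB (Set.mem_biUnion (show t ∈ {t | IsTriangle K t} from ht)
      (Or.inr ⟨v, hv, hz⟩))) ?_
    intro h
    rw [h] at hd
    exact absurd hd (not_le.2 (hbl.notMem_disk z hz C R hC))

/-- The points of the refined set in a shrunken circumdisk at `v` are shrunken vertices on its
boundary. -/
theorem mem_star_of_mem_disk (hδ : 0 < δ) (hK : IsDelaunayTriangulation K S)
    (hS : IsNet (10 * δ) (10 * δ) S) (hS' : EtaSeparated δ S') (hB : baseSet δ K ⊆ S')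
    {t : Finset Plane} (ht : IsTriangle K t) {v C : Plane} {R : ℝ} (hC : ∀ p ∈ t, dist p C = R)
    (hv : v ∈ t) {Y : Plane} (hY : Y ∈ S') (hd : dist Y (shrink v C) ≤ R / 10) :
    ∃ p ∈ S, Y = shrink v p ∧ dist p C = R := by
  classical
  have hemp : ∀ x ∈ S, R ≤ dist x C := by
    intro x hx
    exact not_lt.1 fun h => hK.2 t ht C R hC x hx h
  have hvS := hK.face_subset ht.1 hv
  obtain ⟨t₁, ht₁, w, q, hv1, hw, hq, hvw, hvq, hwq, htri, a, b, ha, hb, hYe⟩ :=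
    exists_cone hK hS hvS Y
  obtain ⟨-, C₁, R₁, hC₁, -, -, -⟩ := triangle_data hK hS ht₁
  have hR₁ : 0 ≤ R₁ := hC₁ v hv1 ▸ dist_nonneg
  have hR : 0 ≤ R := hC v hv ▸ dist_nonneg
  obtain ⟨X, hX⟩ : ∃ X, X = v + (10 * a) • (w - v) + (10 * b) • (q - v) := ⟨_, rfl⟩
  have hYX : Y = shrink v X := by
    rw [hYe, hX, shrink]
    module
  have hd1 : dist X C ≤ R := by
    rw [hYX, dist_shrink] at hd; linarith
  have hd2 : dist Y (shrink v C₁) ≤ R₁ / 10 := by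
    rw [hYX, dist_shrink]
    -- `Y` may lie in the cone of another triangle at `v`. The power with respect to the circle of
    -- `t` minus that with respect to the circle of `t₁` is affine, zero at `v` and nonnegative at
    -- `w` and `q`, hence nonnegative on the cone. So the disk of `t` is inside that of `t₁` there.
    suffices h : dist X C₁ ≤ R₁ by linarith
    refine abs_le_of_sq_le_sq' ?_ hR₁ |>.2
    obtain ⟨g, gv, gw, gq, h1, h2⟩ := exists_weights_triple hvw hvq hwq (10 * a) (10 * b)
    rw [← hX] at h2
    have e1 := sum_mul_dist_sq h1 h2 C
    have e2 := sum_mul_dist_sq h1 h2 C₁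
    rw [Finset.sum_insert (by simp [hvw, hvq]), Finset.sum_pair hwq, gv, gw, gq] at e1 e2
    rw [hC₁ v hv1, hC₁ w hw, hC₁ q hq] at e2
    rw [hC v hv] at e1
    have f1 := pow_le_pow_left₀ hR (hemp w (hK.face_subset ht₁.1 hw)) 2
    have f2 := pow_le_pow_left₀ hR (hemp q (hK.face_subset ht₁.1 hq)) 2
    have f3 := pow_le_pow_left₀ dist_nonneg hd1 2
    have f4 := mul_le_mul_of_nonneg_left f1 (by positivity : 0 ≤ 10 * a)
    have f5 := mul_le_mul_of_nonneg_left f2 (by positivity : 0 ≤ 10 * b)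
    linarith
  rw [hYe] at hY hd2
  obtain ⟨p, hp, hYp⟩ := mem_star_of_mem_cone hδ hK hS hS' hB ht₁ hC₁ hv1 hw hq hvw hvq hwq ha hb
    hY hd2
  rw [← hYe] at hYp
  have hpS := hK.face_subset ht₁.1 hp
  refine ⟨p, hpS, hYp, le_antisymm ?_ (hemp p hpS)⟩
  rw [hYp, dist_shrink] at hd
  linarith

/-- The shrunken triangles at old vertices are triangles of the refined triangulation. -/
theorem star_mem_pullingComplex [DecidableEq Plane] (hδ : 0 < δ)
    (hK : IsDelaunayTriangulation K S)
    (hS : IsNet (10 * δ) (10 * δ) S) (hS' : EtaSeparated δ S') (hB : baseSet δ K ⊆ S')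
    {m : Set Plane → Plane} (hm : ∀ C : Set Plane, C.Nonempty → m C ∈ C)
    (hmS : ∀ C : Set Plane, (C ∩ S).Nonempty → m C ∈ S)
    {t : Finset Plane} (ht : IsTriangle K t) {v : Plane} (hv : v ∈ t) :
    t.image (shrink v) ∈ (pullingComplex S' m).faces := by
  obtain ⟨hd, C, R, hC, hemp, hR, -⟩ := triangle_data hK hS ht
  have hR0 : 0 ≤ R := hC v hv ▸ dist_nonneg
  obtain ⟨w, q, hw, hq, hvw, hvq, hwq, htri⟩ := exists_other_two ht.2 hv
  have hdisk := fun {Y} hY hdY => mem_star_of_mem_disk (Y := Y) hδ hK hS hS' hB ht hC hv hY hdY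
  have hvS : v ∈ S := hK.face_subset ht.1 hv
  have hdv : dist v (shrink v C) = R / 10 := by
    rw [dist_comm, dist_shrink_left, dist_comm, hC v hv]
  have hdp : ∀ p ∈ t, dist (shrink v p) (shrink v C) = R / 10 := fun p hp => by
    rw [dist_shrink, hC p hp]
  have hmemS' : ∀ p ∈ t, shrink v p ∈ S' := fun p hp => hB (shrink_mem_baseSet ht hv hp)
  have hvcell : v ∈ cell S' (shrink v C) ((R / 10) ^ 2) :=
    ⟨by simpa [shrink_self] using hmemS' v hv, by rw [hdv]⟩
  have hle : ∀ Y ∈ cell S' (shrink v C) ((R / 10) ^ 2), dist Y (shrink v C) = R / 10 := fun Y hY =>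
    (pow_left_inj₀ dist_nonneg (by positivity) two_ne_zero).1 hY.2
  -- The pulled vertex is old, and the shrunken circle is too small to carry an old vertex besides
  -- `v`.
  have hmv : m (cell S' (shrink v C) ((R / 10) ^ 2)) = v := by
    have h1 := hm _ ⟨v, hvcell⟩
    have h2 := hmS _ ⟨v, hvcell, hvS⟩
    obtain ⟨p, hp, hmp, hpC⟩ := hdisk h1.1 (hle _ h1).le
    by_contra hne
    have h3 := hS.2.1 _ h2 v hvS hne
    rw [hmp, dist_shrink_left] at h3
    have h4 := dist_triangle_right p v C
    rw [hpC, hC v hv] at h4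
    linarith
  have nvw : v ≠ shrink v w := by
    intro h
    have := dist_shrink_left v w
    rw [← h, dist_self] at this
    exact hvw.symm (dist_eq_zero.1 (by linarith))
  have nvq : v ≠ shrink v q := by
    intro h
    have := dist_shrink_left v q
    rw [← h, dist_self] at this
    exact hvq.symm (dist_eq_zero.1 (by linarith))
  have nwq : shrink v w ≠ shrink v q := by
    intro h
    have := dist_shrink v w q
    rw [h, dist_self] at this
    exact hwq (dist_eq_zero.1 (by linarith))
  obtain ⟨A, B, -, -, hApq, -, -, hAv, -, -⟩ := exists_frame (δ := δ) hdv (hdp w hw) (hdp q hq) nvw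
    nvq nwq
  refine ⟨⟨shrink v v, Finset.mem_image_of_mem _ hv⟩, shrink v C, (R / 10) ^ 2, ?_, ?_, -A,
    -A (shrink v w), ?_, ?_, ?_⟩
  · intro Y hY
    refine pow_le_pow_left₀ (by positivity) ?_ 2
    by_contra! hlt
    obtain ⟨p, -, rfl, hpC⟩ := hdisk hY hlt.le
    rw [dist_shrink, hpC] at hlt
    exact lt_irrefl _ hlt
  · intro Y hY
    obtain ⟨p, hp, rfl⟩ := Finset.mem_image.1 (Finset.mem_coe.1 hY)
    exact ⟨hmemS' p hp, by rw [hdp p hp]⟩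
  · intro Y hY
    simp only [LinearMap.neg_apply, neg_le_neg_iff]
    by_contra! hlt
    -- A cell point beyond the line of the opposite side would lie in the cone at `v`, hence be a
    -- shrunken vertex of `t`, and none of these is beyond that line.
    obtain ⟨α, β, hYe⟩ := exists_coords hdv (hdp w hw) (hdp q hq) nvw nvq nwq Y
    have hA : A Y = A v + (α + β) * (A (shrink v w) - A v) := by
      rw [hYe]
      simp only [map_add, map_smul, map_sub, smul_eq_mul, ← hApq]
      ring
    have hσ : 1 < α + β := by
      by_contra! h
      have := mul_le_mul_of_nonneg_right h (by linarith : 0 ≤ A (shrink v w) - A v)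
      linarith
    have hYd := hle Y hY
    have hβ : 0 ≤ β := nonneg_coord_of_beyond hdv (hdp w hw) (hdp q hq) nvw nvq nwq (hYe ▸ hYd) hσ
    have hα : 0 ≤ α := nonneg_coord_of_beyond hdv (hdp q hq) (hdp w hw) nvq nvw nwq.symm
      (α := β) (β := α) (by rw [hYe, add_right_comm] at hYd; exact hYd) (by linarith)
    rw [shrink_sub, shrink_sub, smul_smul, smul_smul] at hYe
    have hYS := hY.1
    have hYd' := hYd.le
    rw [hYe] at hYS hYd'
    obtain ⟨p, hp, hYp⟩ := mem_star_of_mem_cone hδ hK hS hS' hB ht hC hv hw hq hvw hvq hwq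
      (by positivity) (by positivity) hYS hYd'
    rw [← hYe] at hYp
    rw [htri] at hp
    simp only [Finset.mem_insert, Finset.mem_singleton] at hp
    rcases hp with rfl | rfl | rfl
    · rw [hYp, shrink_self] at hlt; linarith
    · rw [hYp] at hlt; linarith
    · rw [hYp] at hlt; linarith
  · intro Y hY
    obtain ⟨p, hp, rfl⟩ := Finset.mem_image.1 hY
    rw [hmv]
    rw [htri] at hp
    simp only [Finset.mem_insert, Finset.mem_singleton] at hp
    rcases hp with rfl | rfl | rfl
    · left; exact shrink_self _
    · right; rfl
    · right; simp [hApq]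
  · rw [hmv]
    simpa using hAv

end Refinement

end

noncomputable section

open Set Filter Topology

/-! ### The subdivision -/

section Refinement

variable {δ : ℝ} {S S' : Set Plane} {K K' : PlaneComplex}

theorem edge_length (hK : IsDelaunayTriangulation K S)
    (hS : IsNet (10 * δ) (10 * δ) S) {u w : Plane} (huw : u ≠ w)
    (he : ({u, w} : Finset Plane) ∈ K.faces) : 10 * δ ≤ dist u w ∧ dist u w < 20 * δ := by
  obtain ⟨t, ht, hu, hw⟩ := exists_triangle_of_edge hK hS huw he
  obtain ⟨hd, C, R, hC, -, hR, -⟩ := triangle_data hK hS ht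
  refine ⟨hd u hu w hw huw, ?_⟩
  have := dist_triangle_right u w C
  rw [hC u hu, hC w hw] at this
  linarith

theorem dist_edge_points (u w : Plane) (s s' : ℝ) :
    dist (u + s • (w - u)) (u + s' • (w - u)) = |s - s'| * dist u w := by
  rw [dist_add_left, dist_eq_norm, ← sub_smul, norm_smul, Real.norm_eq_abs, ← dist_eq_norm,
    dist_comm w u]

theorem edgePoint_mem (hK : IsDelaunayTriangulation K S)
    (hS : IsNet (10 * δ) (10 * δ) S) (hB : baseSet δ K ⊆ S') {u w : Plane} (huw : u ≠ w)
    (he : ({u, w} : Finset Plane) ∈ K.faces) {s : ℝ} (hs : s ∈ edgeParam δ (dist u w)) :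
    u + s • (w - u) ∈ S' := by
  obtain ⟨t, ht, hu, hw⟩ := exists_triangle_of_edge hK hS huw he
  exact hB (Set.mem_biUnion (show t ∈ {t | IsTriangle K t} from ht)
    (Or.inl ⟨u, hu, w, hw, huw, s, hs, rfl⟩))

/-- The data of a refined Delaunay triangulation whose stars at the old vertices are shrunken
copies of the old stars. -/
structure IsRefinement (δ : ℝ) (S S' : Set Plane) (K K' : PlaneComplex) : Prop where
  pos : 0 < δ
  isNet : IsNet (10 * δ) (10 * δ) S
  isGromov : IsGromov δ S'
  delaunay : IsDelaunayTriangulation K S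
  delaunay' : IsDelaunayTriangulation K' S'
  base_subset : baseSet δ K ⊆ S'
  star_mem : ∀ t, IsTriangle K t → ∀ v ∈ t, ∃ t' ∈ K'.faces,
    (t' : Set Plane) = shrink v '' (t : Set Plane)

theorem exists_isRefinement (hδ : 0 < δ) (hK : IsDelaunayTriangulation K S)
    (hS : IsNet (10 * δ) (10 * δ) S) : ∃ S' K', IsRefinement δ S S' K K' := by
  classical
  obtain ⟨S', hB, hG⟩ := exists_isGromov_superset (baseSet_separated hδ hK hS)
  -- Cells are pulled from an old vertex whenever they contain one, so that the shrunken stars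
  -- survive.
  let m : Set Plane → Plane := fun C =>
    if h : (C ∩ S).Nonempty then h.some else if h : C.Nonempty then h.some else 0
  have hm : ∀ C : Set Plane, C.Nonempty → m C ∈ C := by
    intro C hC
    by_cases h : (C ∩ S).Nonempty
    · simp only [m, dif_pos h]; exact h.some_mem.1
    · simp only [m, dif_neg h, dif_pos hC]; exact hC.some_mem
  have hmS : ∀ C : Set Plane, (C ∩ S).Nonempty → m C ∈ S := by
    intro C h
    simp only [m, dif_pos h]; exact h.some_mem.2
  refine ⟨S', pullingComplex S' m, hδ, hS, hG, hK, pullingComplex_isDelaunay (hG.isNet hδ) hm, hB,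
    fun t ht v hv => ⟨t.image (shrink v),
      star_mem_pullingComplex hδ hK hS hG.prop hB hm hmS ht hv, by simp⟩⟩

/-- End pieces are sides of shrunken triangles; middle pieces are shorter than `√2 * δ`. -/
theorem IsRefinement.piece_mem (h : IsRefinement δ S S' K K') {u w : Plane} (huw : u ≠ w)
    (he : ({u, w} : Finset Plane) ∈ K.faces) {s₁ s₂ : ℝ} (hs₁ : s₁ ∈ edgeParam δ (dist u w))
    (hs₂ : s₂ ∈ edgeParam δ (dist u w)) (hlt : s₁ < s₂)
    (hcase : s₁ = 0 ∧ s₂ = 1 / 10 ∨ s₁ = 9 / 10 ∧ s₂ = 1 ∨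
      1 / 10 ≤ s₁ ∧ s₂ ≤ 9 / 10 ∧ (s₂ - s₁) * dist u w ≤ 9 / 8 * δ) :
    ({u + s₁ • (w - u), u + s₂ • (w - u)} : Finset Plane) ∈ K'.faces := by
  classical
  obtain ⟨t, ht, hu, hw⟩ := exists_triangle_of_edge h.delaunay h.isNet huw he
  have star : ∀ v ∈ t, ∀ x ∈ t, ({v, shrink v x} : Finset Plane) ∈ K'.faces := by
    intro v hv x hx
    obtain ⟨t', ht', hset⟩ := h.star_mem t ht v hv
    refine K'.down_closed ht' ?_ ⟨v, by simp⟩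
    intro y hy
    rw [← Finset.mem_coe, hset]
    simp only [Finset.mem_insert, Finset.mem_singleton] at hy
    rcases hy with rfl | rfl
    · exact ⟨y, hv, shrink_self y⟩
    · exact ⟨x, hx, rfl⟩
  have hpos : 0 < dist u w := dist_pos.2 huw
  rcases hcase with ⟨rfl, rfl⟩ | ⟨rfl, rfl⟩ | ⟨-, -, hd⟩
  · rw [zero_smul, add_zero]
    exact star u hu w hw
  · rw [one_smul, add_sub_cancel, show u + (9 / 10 : ℝ) • (w - u) = shrink w u by
      rw [shrink]; module, Finset.pair_comm]
    exact star w hw u hu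
  · have hdist : dist (u + s₁ • (w - u)) (u + s₂ • (w - u)) = (s₂ - s₁) * dist u w := by
      rw [dist_edge_points, abs_sub_comm, abs_of_pos (by linarith)]
    refine h.delaunay'.pair_mem_of_dist_lt (h.isGromov.isNet h.pos)
      (edgePoint_mem h.delaunay h.isNet h.base_subset huw he hs₁)
      (edgePoint_mem h.delaunay h.isNet h.base_subset huw he hs₂) ?_ ?_
    · rw [← dist_pos, hdist]
      exact mul_pos (by linarith) hpos
    · have h2 := pow_le_pow_left₀ dist_nonneg (hdist.trans_le hd) 2
      have := pow_pos h.pos 2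
      linarith [mul_pow (9 / 8) δ 2]

theorem IsRefinement.exists_piece (h : IsRefinement δ S S' K K') {u w : Plane} (huw : u ≠ w)
    (he : ({u, w} : Finset Plane) ∈ K.faces) {s : ℝ} (h0 : 0 ≤ s) (h1 : s ≤ 1) :
    ∃ s₁ s₂ : ℝ, s₁ < s₂ ∧ ({u + s₁ • (w - u), u + s₂ • (w - u)} : Finset Plane) ∈ K'.faces ∧
      s₁ ≤ s ∧ s ≤ s₂ ∧ (s₁ = 0 ∧ s₂ = 1 / 10 ∨ s₁ = 9 / 10 ∧ s₂ = 1 ∨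
        1 / 10 ≤ s₁ ∧ s₂ ≤ 9 / 10 ∧ (s₂ - s₁) * dist u w ≤ 9 / 8 * δ) := by
  obtain ⟨s₁, hs₁, s₂, hs₂, h1s, hs2, hlt, hcase⟩ :=
    exists_edgeParam_around h.pos (edge_length h.delaunay h.isNet huw he).1 h0 h1
  exact ⟨s₁, s₂, hlt, h.piece_mem huw he hs₁ hs₂ hlt hcase, h1s, hs2, hcase⟩

theorem mem_convexHull_pair_of_between {u w : Plane} {s₁ s s₂ : ℝ} (h1 : s₁ ≤ s) (h2 : s ≤ s₂) :
    u + s • (w - u) ∈ convexHull ℝ (({u + s₁ • (w - u), u + s₂ • (w - u)} : Finset Plane) :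
      Set Plane) := by
  classical
  rw [Finset.coe_pair, convexHull_pair]
  rcases (h1.trans h2).eq_or_lt with heq | hlt
  · have : s = s₁ := by linarith
    rw [this]
    exact left_mem_segment ℝ _ _
  · have hpos : 0 < s₂ - s₁ := by linarith
    refine ⟨(s₂ - s) / (s₂ - s₁), (s - s₁) / (s₂ - s₁), div_nonneg (by linarith) hpos.le,
      div_nonneg (by linarith) hpos.le, by rw [← add_div, div_eq_one_iff_eq hpos.ne']; ring, ?_⟩
    have e : s = (s₂ - s) / (s₂ - s₁) * s₁ + (s - s₁) / (s₂ - s₁) * s₂ := by field_simp; ring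
    have e1 : (s₂ - s) / (s₂ - s₁) + (s - s₁) / (s₂ - s₁) = 1 := by
      rw [← add_div, div_eq_one_iff_eq hpos.ne']; ring
    generalize (s₂ - s) / (s₂ - s₁) = α at *
    generalize (s - s₁) / (s₂ - s₁) = β at *
    rw [e, show α = 1 - β by linarith]
    module

/-- A segment leaving a triangle crosses one of its sides. -/
theorem exists_mem_side {t : Finset Plane} {C : Plane} {R : ℝ} (hC : ∀ p ∈ t, dist p C = R)
    (hcard : t.card = 3) {x y : Plane} (hx : x ∈ convexHull ℝ (t : Set Plane))
    (hy : y ∉ convexHull ℝ (t : Set Plane)) :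
    ∃ τ : ℝ, 0 ≤ τ ∧ τ < 1 ∧ ∃ u ∈ t, ∃ w ∈ t, u ≠ w ∧ ∃ s : ℝ, 0 ≤ s ∧ s ≤ 1 ∧
      x + τ • (y - x) = u + s • (w - u) := by
  classical
  obtain ⟨v, hv⟩ : t.Nonempty := Finset.card_pos.1 (by omega)
  obtain ⟨w, q, hw, hq, hvw, hvq, hwq, rfl⟩ := exists_other_two hcard hv
  have hcl := (Finset.finite_toSet ({v, w, q} : Finset Plane)).isCompact_convexHull ℝ
  have hcpt : IsCompact {τ : ℝ | τ ∈ Set.Icc (0 : ℝ) 1 ∧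
      x + τ • (y - x) ∈ convexHull ℝ (({v, w, q} : Finset Plane) : Set Plane)} :=
    isCompact_Icc.inter_right (hcl.isClosed.preimage (f := fun τ : ℝ => x + τ • (y - x))
      (by fun_prop))
  -- At the last parameter in the triangle one barycentric coordinate vanishes; were all positive,
  -- the segment could be followed further.
  obtain ⟨τ, ⟨⟨hτ0, hτ1⟩, hmem⟩, hmax⟩ := hcpt.exists_isGreatest ⟨0, by simp, by simpa using hx⟩
  have hτlt : τ < 1 := by
    refine lt_of_le_of_ne hτ1 fun h => hy ?_
    rw [h, one_smul, add_sub_cancel] at hmem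
    exact hmem
  obtain ⟨a, b, ha, hb, hab, hz⟩ := (mem_convexHull_triple hvw hvq hwq).1 hmem
  refine ⟨τ, hτ0, hτlt, ?_⟩
  rcases ha.eq_or_lt with ha0 | ha0
  · refine ⟨v, hv, q, hq, hvq, b, hb, by linarith, ?_⟩
    rw [hz, ← ha0]; module
  rcases hb.eq_or_lt with hb0 | hb0
  · refine ⟨v, hv, w, hw, hvw, a, ha, by linarith, ?_⟩
    rw [hz, ← hb0]; module
  rcases hab.eq_or_lt with hab1 | hab1
  · refine ⟨w, hw, q, hq, hwq, b, hb, by linarith, ?_⟩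
    rw [hz, show a = 1 - b by linarith]; module
  exfalso
  obtain ⟨a', b', hxy⟩ := exists_coords (hC v hv) (hC w hw) (hC q hq) hvw hvq hwq (v + (y - x))
  have hyx : y - x = a' • (w - v) + b' • (q - v) := by
    rw [add_assoc] at hxy; exact add_left_cancel hxy
  have lim : ∀ c d : ℝ, 0 < c → ∀ᶠ e in 𝓝[>] (0 : ℝ), 0 < c + e * d := by
    intro c d hc
    have hcont : Continuous fun e : ℝ => c + e * d := by fun_prop
    exact ((hcont.tendsto 0).mono_left nhdsWithin_le_nhds).eventually (lt_mem_nhds (by simpa))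
  obtain ⟨e, h1, h2, h3, h4, h5⟩ := ((lim a a' ha0).and ((lim b b' hb0).and
    ((lim (1 - a - b) (-a' - b') (by linarith)).and ((lim (1 - τ) (-1) (by linarith)).and
      self_mem_nhdsWithin)))).exists
  have h5 : 0 < e := h5
  have : τ + e ≤ τ := by
    refine hmax ⟨⟨by linarith, by linarith⟩, ?_⟩
    refine (mem_convexHull_triple hvw hvq hwq).2
      ⟨a + e * a', b + e * b', h1.le, h2.le, by linarith, ?_⟩
    rw [add_smul, ← add_assoc, hz, hyx]
    module
  linarith

/-- Every triangle of the refined triangulation lies in an old triangle. -/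
theorem IsRefinement.exists_triangle_superset (h : IsRefinement δ S S' K K') {t' : Finset Plane}
    (ht' : IsTriangle K' t') :
    ∃ t, IsTriangle K t ∧ (t' : Set Plane) ⊆ convexHull ℝ (t : Set Plane) := by
  classical
  -- From the centroid towards a vertex of `t'` outside `t`, a side of `t` is met before that vertex
  -- is reached, so at a point with all weights positive. That point also lies on a new edge, which
  -- would have to contain all three vertices of `t'`.
  obtain ⟨x, hx⟩ : ∃ x : Plane, x = ∑ y ∈ t', (1 / 3 : ℝ) • y := ⟨_, rfl⟩
  have hsum : ∑ y ∈ t', (1 / 3 : ℝ) = 1 := by rw [Finset.sum_const, ht'.2]; norm_num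
  obtain ⟨t, ht, hxt⟩ := h.delaunay.exists_triangle_mem h.isNet x
  refine ⟨t, ht, fun s hs => ?_⟩
  by_contra hst
  have hs : s ∈ t' := hs
  obtain ⟨-, C, R, hC, -⟩ := triangle_data h.delaunay h.isNet ht
  obtain ⟨τ, hτ0, hτ1, u, hu, w, hw, huw, σ, hσ0, hσ1, he⟩ := exists_mem_side hC ht.2 hxt hst
  have hedge : ({u, w} : Finset Plane) ∈ K.faces :=
    K.down_closed ht.1 (by intro y hy; simp at hy; rcases hy with rfl | rfl <;> assumption)
      ⟨u, by simp⟩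
  obtain ⟨s₁, s₂, -, hp, hs1, hs2, -⟩ := h.exists_piece huw hedge hσ0 hσ1
  have hmem := mem_convexHull_pair_of_between (u := u) (w := w) hs1 hs2
  rw [← he] at hmem
  have hg1 : ∑ y ∈ t', ((1 - τ) * (1 / 3) + if y = s then τ else 0) = 1 := by
    rw [Finset.sum_add_distrib, ← Finset.mul_sum, hsum, Finset.sum_ite_eq' t' s fun _ => τ,
      if_pos hs]
    ring
  have hg2 : ∑ y ∈ t', ((1 - τ) * (1 / 3) + if y = s then τ else 0) • y = x + τ • (s - x) := by
    simp only [add_smul, Finset.sum_add_distrib, mul_smul, ← Finset.smul_sum, ite_smul, zero_smul]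
    rw [Finset.sum_ite_eq' t' s fun y => τ • y, if_pos hs]
    rw [← hx]
    module
  have hpos : ∀ y ∈ t', 0 < (1 - τ) * (1 / 3) + if y = s then τ else 0 := by
    intro y _
    have : 0 < (1 - τ) * (1 / 3 : ℝ) := mul_pos (by linarith) (by norm_num)
    split_ifs <;> linarith
  have hsub : t' ⊆ {u + s₁ • (w - u), u + s₂ • (w - u)} := fun y hy =>
    carrier_subset ht'.1 hp hg1 (fun y hy => (hpos y hy).le) hg2 hmem hy (hpos y hy).ne'
  have := Finset.card_le_card hsub
  have := Finset.card_le_two (a := u + s₁ • (w - u)) (b := u + s₂ • (w - u))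
  have := ht'.2
  omega

/-- Every point of an old simplex lies in a new simplex contained in it. -/
theorem IsRefinement.exists_face_subset (h : IsRefinement δ S S' K K') {t : Finset Plane}
    (ht : t ∈ K.faces) {x : Plane} (hx : x ∈ convexHull ℝ (t : Set Plane)) :
    ∃ s ∈ K'.faces, x ∈ convexHull ℝ (s : Set Plane) ∧
      convexHull ℝ (s : Set Plane) ⊆ convexHull ℝ (t : Set Plane) := by
  classical
  obtain ⟨t', ht', hxt'⟩ := h.delaunay'.exists_triangle_mem (h.isGromov.isNet h.pos) x
  obtain ⟨t₂, ht₂, hsub⟩ := h.exists_triangle_superset ht'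
  obtain ⟨g, hg, h1, h2⟩ := Finset.mem_convexHull'.1 hxt'
  have hch : ∀ y ∈ t', ∃ k : Plane → ℝ, (∀ z ∈ t₂, 0 ≤ k z) ∧ ∑ z ∈ t₂, k z = 1 ∧
      ∑ z ∈ t₂, k z • z = y := fun y hy => Finset.mem_convexHull'.1 (hsub hy)
  choose! k hk0 hk1 hk2 using hch
  have hH1 : ∑ z ∈ t₂, ∑ y ∈ t', g y * k y z = 1 := by
    rw [Finset.sum_comm, ← h1]
    refine Finset.sum_congr rfl fun y hy => ?_
    rw [← Finset.mul_sum, hk1 y hy, mul_one]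
  have hH2 : ∑ z ∈ t₂, (∑ y ∈ t', g y * k y z) • z = x := by
    simp only [Finset.sum_smul, mul_smul]
    rw [Finset.sum_comm, ← h2]
    refine Finset.sum_congr rfl fun y hy => ?_
    rw [← Finset.smul_sum, hk2 y hy]
  have hterm : ∀ z ∈ t₂, ∀ y ∈ t', 0 ≤ g y * k y z := fun z hz y hy =>
    mul_nonneg (hg y hy) (hk0 y hy z hz)
  -- Expanding the vertices of `t'` in those of `t₂` gives weights of `x` supported on `t`. Nothing
  -- cancels, so each carrier `y` is itself supported on `t`.
  have hvert : ∀ y ∈ t', g y ≠ 0 → y ∈ convexHull ℝ (t : Set Plane) := by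
    intro y hy hy0
    refine mem_convexHull_of_weights (hk0 y hy) (hk1 y hy) (hk2 y hy) fun z hz hz0 => ?_
    refine carrier_subset ht₂.1 ht hH1 (fun z hz => Finset.sum_nonneg (hterm z hz)) hH2 hx hz ?_
    intro hsum
    have := (Finset.sum_eq_zero_iff_of_nonneg (hterm z hz)).1 hsum y hy
    rcases mul_eq_zero.1 this with h | h
    · exact hy0 h
    · exact hz0 h
  have hxs : x ∈ convexHull ℝ ((t'.filter fun y => g y ≠ 0 : Finset Plane) : Set Plane) :=
    mem_convexHull_of_weights hg h1 h2 fun y hy hy0 => by simp [hy, hy0]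
  refine ⟨t'.filter fun y => g y ≠ 0, K'.down_closed ht'.1 (Finset.filter_subset _ _) ?_, hxs, ?_⟩
  · exact_mod_cast convexHull_nonempty_iff.1 ⟨x, hxs⟩
  · refine convexHull_min ?_ (convex_convexHull ℝ _)
    intro y hy
    have := Finset.mem_filter.1 (Finset.mem_coe.1 hy)
    exact hvert y this.1 this.2

/-- The faces of `K'` that lie in simplices of `T`. -/
def restrictTo (K' T : PlaneComplex) : PlaneComplex where
  faces := {s | s ∈ K'.faces ∧ ∃ t ∈ T.faces,
    convexHull ℝ (s : Set Plane) ⊆ convexHull ℝ (t : Set Plane)}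
  isRelLowerSet_faces := by
    rintro s ⟨hs, t, ht, hst⟩
    refine ⟨K'.nonempty_of_mem_faces hs, fun s' hs' hne => ⟨K'.down_closed hs hs' hne, t, ht, ?_⟩⟩
    exact (convexHull_mono (by exact_mod_cast hs')).trans hst
  indep := fun hs => K'.indep hs.1
  inter_subset_convexHull := fun hs ht => K'.inter_subset_convexHull hs.1 ht.1

theorem IsRefinement.isSubdivision (h : IsRefinement δ S S' K K') {T : PlaneComplex}
    (hT : T.faces ⊆ K.faces) : IsSubdivision (restrictTo K' T) T := by
  refine ⟨fun s hs => hs.2, fun t ht => ?_⟩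
  refine ⟨{s | s ∈ K'.faces ∧ convexHull ℝ (s : Set Plane) ⊆ convexHull ℝ (t : Set Plane)}, ?_,
    fun s hs => ⟨hs.1, t, ht, hs.2⟩, ?_⟩
  · obtain ⟨r, hr⟩ := (t.finite_toSet.isCompact_convexHull ℝ).isBounded.subset_closedBall (0 : Plane)
    have hfin := h.isGromov.prop.finite_inter_closedBall h.pos 0 r
    refine (Set.Finite.finite_subsets hfin).preimage (f := fun t : Finset Plane => (t : Set Plane))
      (Finset.coe_injective.injOn) |>.subset ?_
    rintro s ⟨hs, hst⟩ p hp
    exact ⟨h.delaunay'.face_subset hs hp, hr (hst (subset_convexHull ℝ _ hp))⟩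
  · refine Set.Subset.antisymm (fun x hx => ?_) ?_
    · obtain ⟨s, hs, hxs, hst⟩ := h.exists_face_subset (hT ht) hx
      exact Set.mem_biUnion (show s ∈ {s | s ∈ K'.faces ∧ _} from ⟨hs, hst⟩) hxs
    · exact Set.iUnion₂_subset fun s hs => hs.2

end Refinement

end

noncomputable section

open Set Filter Topology

/-! ### The subdivision theorem -/

section Refinement

variable {δ : ℝ} {S S' : Set Plane} {K K' : PlaneComplex}

theorem edgePoint_injective {u w : Plane} (huw : u ≠ w) {s s' : ℝ}
    (h : u + s • (w - u) = u + s' • (w - u)) : s = s' :=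
  smul_left_injective ℝ (sub_ne_zero.2 huw.symm) (add_left_cancel h)

/-- The new edges on an old edge are the end pieces and the short middle pieces. -/
theorem IsRefinement.edge_cases (h : IsRefinement δ S S' K K') {u w : Plane} (huw : u ≠ w)
    (he : ({u, w} : Finset Plane) ∈ K.faces) {s s' : ℝ} (h0 : 0 ≤ s) (hlt : s < s') (h1 : s' ≤ 1)
    (hab : ({u + s • (w - u), u + s' • (w - u)} : Finset Plane) ∈ K'.faces) :
    s = 0 ∧ s' = 1 / 10 ∨ s = 9 / 10 ∧ s' = 1 ∨
      1 / 10 ≤ s ∧ s' ≤ 9 / 10 ∧ (s' - s) * dist u w ≤ 9 / 8 * δ := by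
  -- The midpoint of the new edge lies in one of the known pieces, and two edges of a complex
  -- meeting in an inner point of one of them have its ends in common.
  obtain ⟨s₁, s₂, h12, hp, hs1, hs2, hc⟩ := h.exists_piece huw he (s := (s + s') / 2)
    (by linarith) (by linarith)
  have hmem := mem_convexHull_pair_of_between (u := u) (w := w) hs1 hs2
  have heq : u + ((s + s') / 2) • (w - u) = (u + s • (w - u)) +
      (1 / 2 : ℝ) • ((u + s' • (w - u)) - (u + s • (w - u))) := by module
  rw [heq] at hmem
  obtain ⟨ha, hb⟩ := carrier_pair (fun e => hlt.ne (edgePoint_injective huw e)) hab hp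
    (by norm_num) (by norm_num) hmem
  simp only [Finset.mem_insert, Finset.mem_singleton] at ha hb
  have ha := ha.imp (edgePoint_injective huw) (edgePoint_injective huw)
  have hb := hb.imp (edgePoint_injective huw) (edgePoint_injective huw)
  obtain rfl : s = s₁ := by rcases ha with e | e <;> rcases hb with e' | e' <;> linarith
  obtain rfl : s' = s₂ := by rcases hb with e | e <;> linarith
  exact hc

theorem edgePoint_mem_segment_iff {u w : Plane} (huw : u ≠ w) {s s' r : ℝ} (hlt : s < s') :
    u + r • (w - u) ∈ segment ℝ (u + s • (w - u)) (u + s' • (w - u)) ↔ s ≤ r ∧ r ≤ s' := by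
  have : (fun r : ℝ => u + r • (w - u)) = AffineMap.lineMap u w := by
    ext1 r; rw [AffineMap.lineMap_apply]; simp [add_comm]
  have happ : ∀ r : ℝ, u + r • (w - u) = AffineMap.lineMap u w r := fun r => congrFun this r
  rw [happ, happ, happ, ← image_segment, (AffineMap.lineMap_injective ℝ huw).mem_set_image,
    segment_eq_Icc hlt.le]
  rfl

/-- The assertions about the new edges on an old edge. -/
theorem IsRefinement.edge_spec_of_lt (h : IsRefinement δ S S' K K') {u w : Plane} (huw : u ≠ w)
    (he : ({u, w} : Finset Plane) ∈ K.faces) {s s' : ℝ} (h0 : 0 ≤ s) (hlt : s < s') (h1 : s' ≤ 1)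
    {a b : Plane} (ha : a = u + s • (w - u)) (hb : b = u + s' • (w - u))
    (hab : ({a, b} : Finset Plane) ∈ K'.faces) :
    (u ∉ segment ℝ a b → w ∉ segment ℝ a b → dist a b < (√2 - 1 / 10) * δ) ∧
      (u ∈ segment ℝ a b ∨ w ∈ segment ℝ a b → dist a b = dist u w / 10) := by
  subst ha hb
  have hu := edgePoint_mem_segment_iff huw (r := 0) hlt
  have hw := edgePoint_mem_segment_iff huw (r := 1) hlt
  rw [zero_smul, add_zero] at hu
  rw [one_smul, add_sub_cancel] at hw
  have hδ := h.pos
  rw [hu, hw, dist_edge_points, abs_sub_comm, abs_of_pos (sub_pos.2 hlt)]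
  -- This leaves room for the middle pieces, since `9 / 8 < 7 / 5 - 1 / 10`.
  have hsqrt : (7 / 5 : ℝ) ≤ √2 := Real.le_sqrt_of_sq_le (by norm_num)
  rcases h.edge_cases huw he h0 hlt h1 hab with ⟨rfl, rfl⟩ | ⟨rfl, rfl⟩ | ⟨h2, h3, h4⟩
  · exact ⟨fun hn => absurd ⟨le_rfl, hlt.le⟩ hn, fun _ => by ring⟩
  · exact ⟨fun _ hn => absurd ⟨hlt.le, le_rfl⟩ hn, fun _ => by ring⟩
  · refine ⟨fun _ _ => by nlinarith, ?_⟩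
    rintro (⟨h5, -⟩ | ⟨-, h5⟩) <;> linarith

theorem IsRefinement.edge_spec (h : IsRefinement δ S S' K K') {u w : Plane} (huw : u ≠ w)
    (he : ({u, w} : Finset Plane) ∈ K.faces) {a b : Plane} (hne : a ≠ b)
    (hab : ({a, b} : Finset Plane) ∈ K'.faces) (hsub : segment ℝ a b ⊆ segment ℝ u w) :
    (u ∉ segment ℝ a b → w ∉ segment ℝ a b →
      dist a b < (√2 - 1 / 10) * δ ∧ IsStable (1 / 100 * δ) S' a b) ∧
      (u ∈ segment ℝ a b ∨ w ∈ segment ℝ a b → dist a b = dist u w / 10) := by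
  have hmem : a ∈ S' ∧ b ∈ S' :=
    ⟨h.delaunay'.face_subset hab (by simp), h.delaunay'.face_subset hab (by simp)⟩
  suffices (u ∉ segment ℝ a b → w ∉ segment ℝ a b → dist a b < (√2 - 1 / 10) * δ) ∧
      (u ∈ segment ℝ a b ∨ w ∈ segment ℝ a b → dist a b = dist u w / 10) from
    ⟨fun hu hw => ⟨this.1 hu hw,
      isStable_of_dist_lt h.pos h.isGromov hmem.1 hmem.2 hne (this.1 hu hw)⟩, this.2⟩
  have ha := hsub (left_mem_segment ℝ a b)
  have hb := hsub (right_mem_segment ℝ a b)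
  rw [segment_eq_image'] at ha hb
  obtain ⟨s, ⟨hs0, hs1⟩, ha⟩ := ha
  obtain ⟨s', ⟨hs0', hs1'⟩, hb⟩ := hb
  rcases lt_trichotomy s s' with hlt | rfl | hlt
  · exact h.edge_spec_of_lt huw he hs0 hlt hs1' ha.symm hb.symm hab
  · exact absurd (ha.symm.trans hb) hne
  · rw [segment_symm, dist_comm a b]
    exact h.edge_spec_of_lt huw he hs0' hlt hs1 hb.symm ha.symm (Finset.pair_comm a b ▸ hab)

theorem similarTriangles_of_shrink {s t : Finset Plane} {v w q : Plane}
    (ht : (t : Set Plane) = {v, w, q}) (hs : (s : Set Plane) = shrink v '' (t : Set Plane)) :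
    SimilarTriangles s t := by
  have hr : Set.range ![v, w, q] = ({v, w, q} : Set Plane) := by
    rw [Matrix.range_cons, Matrix.range_cons_cons_empty, Set.singleton_union]
  refine ⟨shrink v ∘ ![v, w, q], ![v, w, q], ?_, by rw [hr, ht], ?_⟩
  · rw [Set.range_comp, hr, hs, ht]
  · refine similar_iff_exists_dist_eq.2 ⟨1 / 10, by norm_num, fun i j => ?_⟩
    rw [Function.comp_apply, Function.comp_apply, dist_shrink]
    push_cast
    ring

/-- A new triangle at an old vertex `v` lying in an old triangle is the image of that triangle
under the shrinking at `v`. -/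
theorem IsRefinement.eq_shrink (h : IsRefinement δ S S' K K') {t t' : Finset Plane} {v : Plane}
    (ht : IsTriangle K t) (ht' : IsTriangle K' t') (hv' : v ∈ t') (hv : v ∈ t)
    (hsub : convexHull ℝ (t' : Set Plane) ⊆ convexHull ℝ (t : Set Plane)) :
    (t' : Set Plane) = shrink v '' (t : Set Plane) := by
  classical
  obtain ⟨t₀, ht₀, hset⟩ := h.star_mem t ht v hv
  obtain ⟨x, y, hx, hy, hvx, hvy, hxy, rfl⟩ := exists_other_two ht'.2 hv'
  obtain ⟨w, q, hw, hq, hvw, hvq, hwq, rfl⟩ := exists_other_two ht.2 hv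
  obtain ⟨a, b, ha, hb, hab, ex⟩ :=
    (mem_convexHull_triple hvw hvq hwq).1 (hsub (subset_convexHull ℝ _ (Finset.mem_coe.2 hx)))
  obtain ⟨a', b', ha', hb', hab', ey⟩ :=
    (mem_convexHull_triple hvw hvq hwq).1 (hsub (subset_convexHull ℝ _ (Finset.mem_coe.2 hy)))
  -- This inner point of `t'` is the image of the midpoint of `xy` under the shrinking, so it lies
  -- in the shrunken triangle, and all vertices of `t'` must belong to the latter.
  have hc : v + (1 / 20 : ℝ) • (x - v) + (1 / 20 : ℝ) • (y - v) ∈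
      convexHull ℝ (t₀ : Set Plane) := by
    have heq : v + (1 / 20 : ℝ) • (x - v) + (1 / 20 : ℝ) • (y - v) =
        shrink v (v + ((a + a') / 2) • (w - v) + ((b + b') / 2) • (q - v)) := by
      rw [ex, ey]; unfold shrink; module
    have hlin : shrink v = AffineMap.homothety v (1 / 10 : ℝ) := by
      ext1 z; rw [AffineMap.homothety_apply]; simp [shrink, add_comm]
    rw [heq, hset, hlin, ← AffineMap.image_convexHull]
    exact ⟨_, (mem_convexHull_triple hvw hvq hwq).2
      ⟨_, _, by positivity, by positivity, by linarith, rfl⟩, rfl⟩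
  obtain ⟨h1, h2, h3⟩ := carrier_triple hvx hvy hxy ht'.1 ht₀ (by norm_num) (by norm_num)
    (by norm_num) hc
  have hle : ({v, x, y} : Finset Plane) ⊆ t₀ := by
    intro z hz
    simp only [Finset.mem_insert, Finset.mem_singleton] at hz
    rcases hz with rfl | rfl | rfl
    exacts [h1 (by norm_num), h2 (by norm_num), h3 (by norm_num)]
  rw [Finset.eq_of_subset_of_card_le hle (by rw [ht'.2]; exact face_card_le ht₀), hset]

theorem card_eq_three_of_convexHull_subset {t t' : Finset Plane} (ht : t ∈ K.faces)
    (ht' : IsTriangle K' t')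
    (hsub : convexHull ℝ (t' : Set Plane) ⊆ convexHull ℝ (t : Set Plane)) : t.card = 3 := by
  refine le_antisymm (face_card_le ht) ?_
  rw [← ht'.2]
  exact (K'.indep ht'.1).card_le_card_of_subset_affineSpan
    (((subset_convexHull ℝ _).trans hsub).trans (convexHull_subset_affineSpan _))

end Refinement

end

theorem mainTheorem2 (η : ℝ) (hη : 0 < η) (T : PlaneComplex) (hT : IsCDG η T) :
    ∃ (T' : PlaneComplex) (S' : Set Plane),
      IsSubdivision T' T ∧
      IsCDGOf (η / 10) S' T' ∧
      (∀ a b u w : Plane, IsEdge T' a b → IsEdge T u w → segment ℝ a b ⊆ segment ℝ u w →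
        (u ∉ segment ℝ a b → w ∉ segment ℝ a b →
          dist a b < (√2 - 1 / 10) * (η / 10) ∧
          IsStable (1 / 100 * (η / 10)) S' a b) ∧
        (u ∈ segment ℝ a b ∨ w ∈ segment ℝ a b →
          dist a b = dist u w / 10)) ∧
      (∀ Δ' : Finset Plane, IsTriangle T' Δ' → (∃ v ∈ Δ', v ∈ T.vertices) →
        ∃ Δ : Finset Plane, IsTriangle T Δ ∧
          convexHull ℝ (Δ' : Set Plane) ⊆ convexHull ℝ (Δ : Set Plane) ∧
          SimilarTriangles Δ' Δ) := by
  classical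
  obtain ⟨S, hS, K, hK, hTK⟩ := hT
  have hnet : IsNet (10 * (η / 10)) (10 * (η / 10)) S := by
    rw [mul_div_cancel₀ η (by norm_num : (10 : ℝ) ≠ 0)]; exact hS.isNet hη
  obtain ⟨S', K', h⟩ := exists_isRefinement (by positivity) hK hnet
  have hface : ∀ {L : PlaneComplex} {a b : Plane}, IsEdge L a b →
      ({a, b} : Finset Plane) ∈ L.faces := by
    rintro L a b ⟨-, s, hs, hsab⟩
    rwa [Finset.coe_inj.1 (hsab.trans Finset.coe_pair.symm)] at hs
  refine ⟨restrictTo K' T, S', h.isSubdivision hTK,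
    ⟨h.isGromov, K', h.delaunay', fun s hs => hs.1⟩, fun a b u w hab huw hsub =>
      h.edge_spec huw.1 (hTK (hface huw)) hab.1 (hface hab).1 hsub, ?_⟩
  rintro Δ' ⟨⟨hΔ', t, ht, hsub⟩, hcard⟩ ⟨v, hv, hvT⟩
  have htri : IsTriangle T t := ⟨ht, card_eq_three_of_convexHull_subset ht ⟨hΔ', hcard⟩ hsub⟩
  have hvt : v ∈ t := (T.vertex_mem_convexHull_iff hvT ht).1
    (hsub (subset_convexHull ℝ _ (Finset.mem_coe.2 hv)))
  refine ⟨t, htri, hsub, ?_⟩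
  obtain ⟨w, q, -, -, -, -, -, heq⟩ := exists_other_two htri.2 hvt
  exact similarTriangles_of_shrink (w := w) (q := q) (by rw [heq]; simp)
    (h.eq_shrink ⟨hTK ht, htri.2⟩ ⟨hΔ', hcard⟩ hv hvt hsub)
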